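/- Let $V:\mathbb R\to\mathbb R_+$ be smooth and even with $V(0)=0$, $0<\delta_-\le V''\le\delta_+<\infty$ and $\delta_- /\delta_+>(3/4)^{1/16}$, and let $\beta,\gamma>0$. On $\Omega=(\mathbb R^2)^{\mathbb Z}$, with points $(p_i,r_i)_{i\in\mathbb Z}$, let $\nu_\beta$ be the product measure whose one-site marginal has density proportional to $e^{-\beta(p^2/2+V(r))}$, write $\langle\cdot\rangle$ for its expectation, and let $\tau_j$ be the shift ($\tau_jp_i=p_{i+j}$, $\tau_jr_i=r_{i+j}$). Put $\mathcal E_i=p_i^2/2+V(r_i)$, $\chi_\beta=\operatorname{Var}_{\nu_\beta}(\mathcal E_0)$, $Y_{i,j}=p_i\partial_{r_j}-V'(r_j)\partial_{p_i}$, $X_i=Y_{i,i}$, $$S=\tfrac\gamma2\sum_{i}(X_i^2+Y_{i,i+1}^2),\quad A=\sum_i(X_i-Y_{i,i+1}),\quad L=S+A,\quad L^*=S-A,$$ $$W^A_{0,1}=-p_0V'(r_1),\quad W^S_{0,1}=\tfrac\gamma2\big(p_0^2V''(r_1)-V'(r_1)^2\big),\quad W_{0,1}=W^S_{0,1}+W^A_{0,1},\quad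 W^*_{0,1}=W^S_{0,1}-W^A_{0,1}.$$ Let $\mathcal C$ be the set of smooth functions of finitely many coordinates, with compact support as functions of these coordinates and with zero $\nu_\beta$-average. For $f\in\mathcal C$ let $\Gamma_f=\sum_{j\in\mathbb Z}\tau_jf$ (a formal sum: only finitely many terms contribute to $X_0\Gamma_f$, $Y_{0,1}\Gamma_f$, and $\langle h\,\Gamma_f\rangle$ means $\sum_j\langle h\,\tau_jf\rangle$). Let $\tilde{\mathcal C}$ be the set of smooth functions $f$ of finitely many coordinates with $f,X_if,Y_{i,i+1}f\in L^2(\nu_\beta)$ for all $i$, and let $\mathcal C_0$ be the space of finite sums $\sum_i(X_iF_i+Y_{i,i+1}G_i)$ with $F_i,G_i\in\tilde{\mathcal C}$. For $h\in\mathcal C_0$ set $$|||h|||_{-1}^2=\sup_{g\in\mathcal C,\,a\in\mathbb R}\Big\{2\sum_{i}\langle g\,\tau_ih\rangle+2a\sum_i i\,\langle h\,\mathcal E_i\rangle-\tfrac\gamma2\big\langle(a\,p_0V'(r_1)+Y_{0,1}\Gamma_g)^2\big\rangle-\tfrac\gamma2\big\langle(X_0\Gamma_g)^2\big\rangle\Big\},$$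 and let $\mathcal H_{-1}$ be the completion of $\mathcal C_0$ (modulo null vectors) for this seminorm. Then there is exactly one constant $\kappa_\beta\in\mathbb R$ such that $W_{0,1}+\kappa_\beta(p_1^2-p_0^2)$ lies in the closure of $L\mathcal C$ in $\mathcal H_{-1}$ (the diffusion coefficient $D_\beta$ being defined by $\kappa_\beta=D_\beta\chi_\beta\beta^2$). It is positive and satisfies $$\kappa_\beta=\beta^2\inf_{f\in\mathcal C}|||W^*_{0,1}-L^*f|||_{-1}^2=\frac1{\beta^2\inf_{f\in\mathcal C}|||p_1^2-p_0^2-L^*f|||_{-1}^2}.$$ Moreover, if $\mathbb L_e$ and $\mathbb L_o$ denote the sets of functions in $\mathcal C$ that are even, respectively odd, under $(p,r)\mapsto(-p,r)$, then $$\kappa_\beta=\beta^2\inf_{f\in\mathbb L_e}\sup_{g\in\mathbb L_o}\Big\{\gamma\big[\tfrac12\langle(p_0V'(r_1)-Y_{0,1}\Gamma_f)^2\rangle+\tfrac12\langle(X_0\Gamma_f)^2\rangle\big]+2\langle(W^A_{0,1}-Af)\,\Gamma_g\rangle-\gamma\big[\tfrac12\langle(Y_{0,1}\Gamma_g)^2\rangle+\tfrac12\langle(X_0\Gamma_g)^2\rangle\big]\Big\}.$$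 -/

import Mathlib

open MeasureTheory ProbabilityTheory

noncomputable section

namespace OscChain

/-- Configurations of the infinite chain: `(ω i).1 = p_i` is the momentum and `(ω i).2 = r_i` the
inter-particle distance at the site `i`. -/
abbrev Config : Type := ℤ → ℝ × ℝ

/-- The assumptions on the interaction potential: smooth, symmetric, normalized by `V 0 = 0`,
with `0 < δ₁ ≤ V'' ≤ δ₂ < ∞` and `δ₁ / δ₂ > (3/4)^(1/16)`. (These force `V ≥ 0`.) -/
structure IsPotential (V : ℝ → ℝ) : Prop where
  smooth : ContDiff ℝ ((⊤ : ℕ∞) : WithTop ℕ∞) V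
  even : ∀ r, V (-r) = V r
  zero : V 0 = 0
  bounds : ∃ δ₁ δ₂ : ℝ, 0 < δ₁ ∧ (∀ r, δ₁ ≤ deriv (deriv V) r ∧ deriv (deriv V) r ≤ δ₂) ∧
    (3 / 4 : ℝ) ^ (1 / 16 : ℝ) < δ₁ / δ₂

/-- One-site Gibbs measure, with density proportional to `exp (-β (p ^ 2 / 2 + V r))`. -/
def siteGibbs (V : ℝ → ℝ) (β : ℝ) : Measure (ℝ × ℝ) :=
  (gaussianReal 0 (Real.toNNReal β⁻¹)).prod ((volume : Measure ℝ).tilted (fun r => -β * V r))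

/-- The grand canonical measure `ν_β` on the infinite lattice. -/
def gibbs (V : ℝ → ℝ) (β : ℝ) : Measure Config :=
  Measure.infinitePi (fun _ : ℤ => siteGibbs V β)

/-- The expectation `⟨f⟩` with respect to `ν_β`. -/
def avg (V : ℝ → ℝ) (β : ℝ) (f : Config → ℝ) : ℝ := ∫ ω, f ω ∂(gibbs V β)

/-- The shift `τ_j`, so that `τ_j p_i = p_{i+j}` and `τ_j r_i = r_{i+j}`. -/
def shift (j : ℤ) (f : Config → ℝ) : Config → ℝ := fun ω => f (fun i => ω (i + j))

/-- `∂f/∂p_i`. -/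
def dP (i : ℤ) (f : Config → ℝ) : Config → ℝ := fun ω =>
  deriv (fun t : ℝ => f (Function.update ω i (t, (ω i).2))) (ω i).1

/-- `∂f/∂r_i`. -/
def dR (i : ℤ) (f : Config → ℝ) : Config → ℝ := fun ω =>
  deriv (fun t : ℝ => f (Function.update ω i ((ω i).1, t))) (ω i).2

/-- The vector field `Y_{i,j} = p_i ∂_{r_j} - V'(r_j) ∂_{p_i}`. -/
def Y (V : ℝ → ℝ) (i j : ℤ) (f : Config → ℝ) : Config → ℝ := fun ω =>
  (ω i).1 * dR j f ω - deriv V (ω j).2 * dP i f ω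

/-- The vector field `X_i = Y_{i,i}`. -/
def X (V : ℝ → ℝ) (i : ℤ) (f : Config → ℝ) : Config → ℝ := Y V i i f

/-- `S = (γ/2) ∑_i (X_i² + Y_{i,i+1}²)`; for a local function the sum is finite. -/
def S (V : ℝ → ℝ) (γ : ℝ) (f : Config → ℝ) : Config → ℝ := fun ω =>
  γ / 2 * ∑ᶠ i : ℤ, (X V i (X V i f) ω + Y V i (i + 1) (Y V i (i + 1) f) ω)

/-- `A = ∑_i (X_i - Y_{i,i+1})`; for a local function the sum is finite. -/
def A (V : ℝ → ℝ) (f : Config → ℝ) : Config → ℝ := fun ω =>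
  ∑ᶠ i : ℤ, (X V i f ω - Y V i (i + 1) f ω)

/-- `L = S + A`. -/
def L (V : ℝ → ℝ) (γ : ℝ) (f : Config → ℝ) : Config → ℝ := S V γ f + A V f

/-- `L* = S - A`. -/
def Lstar (V : ℝ → ℝ) (γ : ℝ) (f : Config → ℝ) : Config → ℝ := S V γ f - A V f

/-- The energy `ℰ_i = p_i² / 2 + V(r_i)`. -/
def energy (V : ℝ → ℝ) (i : ℤ) : Config → ℝ := fun ω => (ω i).1 ^ 2 / 2 + V (ω i).2

/-- `χ_β`, the variance of `ℰ_0` under `ν_β`. -/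
def chi (V : ℝ → ℝ) (β : ℝ) : ℝ := variance (energy V 0) (gibbs V β)

/-- `W^A_{0,1} = - p_0 V'(r_1)`. -/
def WA (V : ℝ → ℝ) : Config → ℝ := fun ω => -((ω 0).1 * deriv V (ω 1).2)

/-- `W^S_{0,1} = (γ/2) (p_0² V''(r_1) - V'(r_1)²)`. -/
def WS (V : ℝ → ℝ) (γ : ℝ) : Config → ℝ := fun ω =>
  γ / 2 * ((ω 0).1 ^ 2 * deriv (deriv V) (ω 1).2 - deriv V (ω 1).2 ^ 2)

/-- The energy current `W_{0,1} = W^S_{0,1} + W^A_{0,1}`. -/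
def W (V : ℝ → ℝ) (γ : ℝ) : Config → ℝ := WS V γ + WA V

/-- `W*_{0,1} = W^S_{0,1} - W^A_{0,1}`. -/
def Wstar (V : ℝ → ℝ) (γ : ℝ) : Config → ℝ := WS V γ - WA V

/-- The gradient `p_1² - p_0²`. -/
def gradP : Config → ℝ := fun ω => (ω 1).1 ^ 2 - (ω 0).1 ^ 2

/-- Smooth local functions: smooth functions of finitely many coordinates. -/
def IsSmoothLocal (f : Config → ℝ) : Prop :=
  ∃ (Λ : Finset ℤ) (φ : (Λ → ℝ × ℝ) → ℝ), ContDiff ℝ ((⊤ : ℕ∞) : WithTop ℕ∞) φ ∧ ∀ ω, f ω = φ (Λ.restrict ω)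

/-- The class `𝒞` of smooth local functions with compact support (as functions of finitely many
coordinates) and zero average. -/
def C (V : ℝ → ℝ) (β : ℝ) : Set (Config → ℝ) :=
  {f | (∃ (Λ : Finset ℤ) (φ : (Λ → ℝ × ℝ) → ℝ),
      ContDiff ℝ ((⊤ : ℕ∞) : WithTop ℕ∞) φ ∧ HasCompactSupport φ ∧ ∀ ω, f ω = φ (Λ.restrict ω)) ∧ avg V β f = 0}

/-- The functions of `𝒞` that are even in `p`. -/
def Ceven (V : ℝ → ℝ) (β : ℝ) : Set (Config → ℝ) :=
  {f ∈ C V β | ∀ ω : Config, f (fun i => (-(ω i).1, (ω i).2)) = f ω}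

/-- The functions of `𝒞` that are odd in `p`. -/
def Codd (V : ℝ → ℝ) (β : ℝ) : Set (Config → ℝ) :=
  {f ∈ C V β | ∀ ω : Config, f (fun i => (-(ω i).1, (ω i).2)) = -f ω}

/-- The class of smooth local `f` with `f`, `X_i f` and `Y_{i,i+1} f` in `L²(ν_β)` for all `i`. -/
def Ctilde (V : ℝ → ℝ) (β : ℝ) : Set (Config → ℝ) :=
  {f | IsSmoothLocal f ∧ MemLp f 2 (gibbs V β) ∧
    ∀ i : ℤ, MemLp (X V i f) 2 (gibbs V β) ∧ MemLp (Y V i (i + 1) f) 2 (gibbs V β)}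

/-- The space `𝒞_0` of the finite sums `∑_i (X_i F_i + Y_{i,i+1} G_i)` with `F_i`, `G_i` in the
preceding class; it carries the seminorm below. -/
def C0 (V : ℝ → ℝ) (β : ℝ) : Set (Config → ℝ) :=
  {f | ∃ (Λ : Finset ℤ) (F G : ℤ → Config → ℝ),
    (∀ i ∈ Λ, F i ∈ Ctilde V β ∧ G i ∈ Ctilde V β) ∧
    f = ∑ i ∈ Λ, (X V i (F i) + Y V i (i + 1) (G i))}

/-- `X_0 Γ_f`, where `Γ_f = ∑_j τ_j f` is a formal sum: only finitely many terms contribute. -/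
def XGamma (V : ℝ → ℝ) (f : Config → ℝ) : Config → ℝ := fun ω => ∑ᶠ j : ℤ, X V 0 (shift j f) ω

/-- `Y_{0,1} Γ_f`, understood in the same way. -/
def YGamma (V : ℝ → ℝ) (f : Config → ℝ) : Config → ℝ := fun ω => ∑ᶠ j : ℤ, Y V 0 1 (shift j f) ω

/-- `≪g, h≫_* = ∑_i ⟨g τ_i h⟩`, which is also the meaning of `⟨g Γ_h⟩`. For local `g`, `h` of zero
average only finitely many terms do not vanish. -/
def pairStar (V : ℝ → ℝ) (β : ℝ) (g h : Config → ℝ) : ℝ :=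
  ∑ᶠ i : ℤ, avg V β (fun ω => g ω * shift i h ω)

/-- `≪h≫_** = ∑_i i ⟨h ℰ_i⟩`. For local `h` of zero average only finitely many terms do not
vanish. -/
def momentStar (V : ℝ → ℝ) (β : ℝ) (h : Config → ℝ) : ℝ :=
  ∑ᶠ i : ℤ, (i : ℝ) * avg V β (fun ω => h ω * energy V i ω)

/-- The square of the seminorm on `𝒞_0`:
`|||h|||²_{-1} = sup_{g ∈ 𝒞, a ∈ ℝ} { 2 ≪g, h≫_* + 2 a ≪h≫_**
  - (γ/2) ⟨(a p_0 V'(r_1) + Y_{0,1} Γ_g)²⟩ - (γ/2) ⟨(X_0 Γ_g)²⟩ }`. -/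
def normSq (V : ℝ → ℝ) (β γ : ℝ) (h : Config → ℝ) : EReal :=
  ⨆ g ∈ C V β, ⨆ a : ℝ,
    ((2 * pairStar V β g h + 2 * a * momentStar V β h
      - γ / 2 * avg V β (fun ω => (a * ((ω 0).1 * deriv V (ω 1).2) + YGamma V g ω) ^ 2)
      - γ / 2 * avg V β (fun ω => XGamma V g ω ^ 2) : ℝ) : EReal)

/-- `h ∈ 𝒞_0` lies in the closure of `L𝒞 ⊆ 𝒞_0` in `𝓗_{-1}`, the Hilbert space completion of `𝒞_0`
for the seminorm `|||·|||_{-1}`. -/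
def MemClosureLC (V : ℝ → ℝ) (β γ : ℝ) (h : Config → ℝ) : Prop :=
  h ∈ C0 V β ∧ ∀ ε : ℝ, 0 < ε → ∃ f ∈ C V β, L V γ f ∈ C0 V β ∧
    normSq V β γ (h - L V γ f) < ((ε ^ 2 : ℝ) : EReal)

/-- The Dirichlet-form expression in the inf–sup formula. -/
def infSupFunctional (V : ℝ → ℝ) (β γ : ℝ) (f g : Config → ℝ) : ℝ :=
  γ * (1 / 2 * avg V β (fun ω => ((ω 0).1 * deriv V (ω 1).2 - YGamma V f ω) ^ 2)
      + 1 / 2 * avg V β (fun ω => XGamma V f ω ^ 2))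
    + 2 * pairStar V β (WA V - A V f) g
    - γ * (1 / 2 * avg V β (fun ω => YGamma V g ω ^ 2)
      + 1 / 2 * avg V β (fun ω => XGamma V g ω ^ 2))

end OscChain

end

open scoped InnerProductSpace
open Filter Topology

set_option linter.unusedSectionVars false

/-- A positive semidefinite symmetric bilinear form is the pull-back of the inner product of a
Hilbert space under a linear map with dense range, and the linear functionals that are bounded for
the form are represented by vectors of that Hilbert space. -/
theorem exists_hilbert_of_posSemidef {W : Type} [AddCommGroup W] [Module ℝ W]
    (Q : W →ₗ[ℝ] W →ₗ[ℝ] ℝ) (hsymm : ∀ u v, Q u v = Q v u) (hpos : ∀ u, 0 ≤ Q u u) :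
    ∃ (K : Type) (_ : NormedAddCommGroup K) (_ : InnerProductSpace ℝ K) (_ : CompleteSpace K)
      (Φ : W →ₗ[ℝ] K), DenseRange Φ ∧ (∀ u v, ⟪Φ u, Φ v⟫_ℝ = Q u v) ∧
      ∀ l : W →ₗ[ℝ] ℝ, (∃ M, ∀ u, |l u| ≤ M * √(Q u u)) → ∃ k : K, ∀ u, ⟪k, Φ u⟫_ℝ = l u := by
  let c : PreInnerProductSpace.Core ℝ W :=
    { inner := fun u v => Q u v
      conj_inner_symm := fun u v => by simpa using hsymm v u
      re_inner_nonneg := fun u => by simpa using hpos u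
      add_left := fun u v w => by simp
      smul_left := fun u v r => by simp }
  let i1 : SeminormedAddCommGroup W := InnerProductSpace.Core.toSeminormedAddCommGroup (𝕜 := ℝ)
  let i2 : InnerProductSpace ℝ W :=
    { InnerProductSpace.Core.toNormedSpace (𝕜 := ℝ) (F := W), c with
      norm_sq_eq_re_inner := fun u => by
        change (√(Q u u)) ^ 2 = Q u u
        exact Real.sq_sqrt (hpos u) }
  have hnorm : ∀ u : W, ‖u‖ = √(Q u u) := fun u => rfl
  refine ⟨UniformSpace.Completion W, inferInstance, inferInstance, inferInstance,
    (UniformSpace.Completion.toComplL (𝕜 := ℝ) (E := W)).toLinearMap, ?_, ?_, ?_⟩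
  · exact UniformSpace.Completion.denseRange_coe
  · intro u v
    exact UniformSpace.Completion.inner_coe u v
  · rintro l ⟨M, hM⟩
    let L : W →L[ℝ] ℝ := l.mkContinuous M fun u => by simpa [hnorm] using hM u
    have hd : DenseRange (UniformSpace.Completion.toComplL (𝕜 := ℝ) (E := W)) :=
      UniformSpace.Completion.denseRange_coe
    have hu : IsUniformInducing (UniformSpace.Completion.toComplL (𝕜 := ℝ) (E := W)) :=
      UniformSpace.Completion.isUniformInducing_coe W
    refine ⟨(InnerProductSpace.toDual ℝ _).symm
      (L.extend (UniformSpace.Completion.toComplL (𝕜 := ℝ) (E := W))), fun u => ?_⟩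
    rw [InnerProductSpace.toDual_symm_apply]
    exact L.extend_eq hd hu u

theorem EReal.coe_le_of_forall_pos {a : ℝ} {x : EReal}
    (h : ∀ ε : ℝ, 0 < ε → ((a - ε : ℝ) : EReal) ≤ x) : (a : EReal) ≤ x := by
  induction x with
  | bot => exact absurd (h 1 one_pos) (by simp [-EReal.coe_sub, -EReal.coe_add])
  | top => exact le_top
  | coe x =>
    rw [EReal.coe_le_coe_iff]
    refine le_of_forall_pos_le_add fun ε hε => ?_
    have := EReal.coe_le_coe_iff.1 (h ε hε)
    linarith

theorem EReal.le_coe_of_forall_pos {a : ℝ} {x : EReal}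
    (h : ∀ ε : ℝ, 0 < ε → x ≤ ((a + ε : ℝ) : EReal)) : x ≤ (a : EReal) := by
  induction x with
  | top => exact absurd (h 1 one_pos) (by simp [-EReal.coe_sub, -EReal.coe_add])
  | bot => exact bot_le
  | coe x =>
    rw [EReal.coe_le_coe_iff]
    refine le_of_forall_pos_le_add fun ε hε => ?_
    have := EReal.coe_le_coe_iff.1 (h ε hε)
    linarith

/-- The square of the dual seminorm of a functional `l` for a quadratic form, computed on the
elements `(g, a)` with `g` in a given set. -/
noncomputable def dualNormSq {U : Type} [AddCommGroup U] [Module ℝ U]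
    (Q : (U × ℝ) →ₗ[ℝ] (U × ℝ) →ₗ[ℝ] ℝ) (D : Set U) (l : U × ℝ → ℝ) : EReal :=
  ⨆ g ∈ D, ⨆ a : ℝ, ((2 * l (g, a) - Q (g, a) (g, a) : ℝ) : EReal)

section Hilbert

variable {U W K : Type} [AddCommGroup W] [Module ℝ W] [AddCommGroup U] [Module ℝ U]
  [NormedAddCommGroup K] [InnerProductSpace ℝ K]

theorem dualNormSq_eq_norm_sq {Q : (U × ℝ) →ₗ[ℝ] (U × ℝ) →ₗ[ℝ] ℝ} {Φ : (U × ℝ) →ₗ[ℝ] K}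
    {D : Set U} (hd : ∀ (k : K) (ε : ℝ), 0 < ε → ∃ g ∈ D, ∃ a : ℝ, ‖k - Φ (g, a)‖ < ε)
    (hQ : ∀ u v, inner ℝ (Φ u) (Φ v) = Q u v)
    {l : U × ℝ → ℝ} {k : K} (hk : ∀ u, inner ℝ k (Φ u) = l u) :
    dualNormSq Q D l = ((‖k‖ ^ 2 : ℝ) : EReal) := by
  have key : ∀ u, 2 * l u - Q u u = ‖k‖ ^ 2 - ‖k - Φ u‖ ^ 2 := fun u => by
    rw [@norm_sub_sq_real, ← hk, ← hQ, real_inner_self_eq_norm_sq]; ring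
  refine le_antisymm (iSup₂_le fun g _ => iSup_le fun a => ?_)
    (EReal.coe_le_of_forall_pos fun ε hε => ?_)
  · rw [key, EReal.coe_le_coe_iff]
    linarith [sq_nonneg ‖k - Φ (g, a)‖]
  · obtain ⟨g, hg, a, hu⟩ := hd k _ (Real.sqrt_pos.2 hε)
    refine le_iSup₂_of_le g hg (le_iSup_of_le a ?_)
    rw [key, EReal.coe_le_coe_iff]
    have : ‖k - Φ (g, a)‖ ^ 2 ≤ ε := by
      rw [← Real.sq_sqrt hε.le]
      gcongr
    linarith

theorem eq_of_forall_inner_denseRange {Φ : W →ₗ[ℝ] K} (hd : DenseRange Φ) {x y : K}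
    (h : ∀ u, inner ℝ x (Φ u) = inner ℝ y (Φ u)) : x = y :=
  hd.eq_of_inner_left (𝕜 := ℝ) fun u => h u

end Hilbert

section Resolvent

variable {U K : Type} [AddCommGroup U] [Module ℝ U] [NormedAddCommGroup K] [InnerProductSpace ℝ K]
  {Φ j : U × ℝ →ₗ[ℝ] K} {n : K} {ρ : ℝ}

theorem inner_skew_self (hj : ∀ u v, ⟪j v, Φ u⟫_ℝ = -⟪j u, Φ v⟫_ℝ) (v : U × ℝ) :
    ⟪j v, Φ v⟫_ℝ = 0 := by
  linarith [hj v v]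

theorem norm_le_norm_sub_skew (hj : ∀ u v, ⟪j v, Φ u⟫_ℝ = -⟪j u, Φ v⟫_ℝ) (v : U × ℝ) :
    ‖Φ v‖ ≤ ‖Φ v - j v‖ := by
  have h1 : ⟪Φ v - j v, Φ v⟫_ℝ = ‖Φ v‖ ^ 2 := by
    rw [inner_sub_left, inner_skew_self hj, real_inner_self_eq_norm_sq, sub_zero]
  have h2 := real_inner_le_norm (Φ v - j v) (Φ v)
  rw [h1] at h2
  by_contra! h
  nlinarith [norm_nonneg (Φ v - j v), norm_nonneg (Φ v)]

/-- The orthogonal complement of the range of `Φ - j` on `U`, intersected with that of `n`,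
is trivial. -/
theorem eq_zero_of_inner_sub_skew_eq_zero [CompleteSpace K] (hd : DenseRange Φ) (hρ : 0 < ρ)
    (hn : ∀ u, ⟪n, Φ u⟫_ℝ = ρ * u.2) (hj : ∀ u v, ⟪j v, Φ u⟫_ℝ = -⟪j u, Φ v⟫_ℝ) {C : ℝ}
    (hC : ∀ f g : U, |⟪j (f, 0), Φ (g, 0)⟫_ℝ| ≤ C * ‖Φ (f, 0)‖ * ‖Φ (g, 0)‖)
    {w : K} (hwn : ⟪w, n⟫_ℝ = 0) (hw : ∀ f : U, ⟪w, Φ (f, 0) - j (f, 0)⟫_ℝ = 0) : w = 0 := by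
  let K₀ : Submodule ℝ K := LinearMap.range (Φ ∘ₗ LinearMap.inl ℝ U ℝ)
  have hmem : w ∈ K₀.topologicalClosure := by
    rw [← Submodule.orthogonal_orthogonal_eq_closure, Submodule.mem_orthogonal]
    intro x hx
    have hx0 : ∀ f : U, ⟪x, Φ (f, 0)⟫_ℝ = 0 := fun f =>
      Submodule.inner_left_of_mem_orthogonal (K := K₀) ⟨f, rfl⟩ hx
    have hxn : x = (⟪x, Φ (0, 1)⟫_ℝ / ρ) • n := by
      refine eq_of_forall_inner_denseRange hd fun u => ?_
      have : u = (u.1, 0) + u.2 • ((0, 1) : U × ℝ) := by ext <;> simp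
      rw [inner_smul_left, hn]
      conv_lhs => rw [this, map_add, map_smul, inner_add_right, inner_smul_right, hx0]
      simp
      field_simp
    rw [hxn, inner_smul_left, real_inner_comm w n, hwn, mul_zero]
  have hbd : ∀ f : U, ∀ x ∈ K₀.topologicalClosure,
      |⟪j (f, 0), x⟫_ℝ| ≤ C * ‖Φ (f, 0)‖ * ‖x‖ := by
    intro f x hx
    have hcl : IsClosed {x : K | |⟪j (f, 0), x⟫_ℝ| ≤ C * ‖Φ (f, 0)‖ * ‖x‖} :=
      isClosed_le (by fun_prop) (by fun_prop)
    refine closure_minimal ?_ hcl hx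
    rintro _ ⟨g, rfl⟩
    exact hC f g
  obtain ⟨y, hy, hlim⟩ := mem_closure_iff_seq_limit.1 hmem
  choose f hf using hy
  have hf' : ∀ k, Φ (f k, 0) = y k := hf
  have hlim' : Tendsto (fun k => Φ (f k, 0)) atTop (𝓝 w) := by simpa only [hf'] using hlim
  have hC0 : ∀ k, |⟪w, Φ (f k, 0)⟫_ℝ| ≤ C * ‖Φ (f k, 0)‖ * ‖w - Φ (f k, 0)‖ := by
    intro k
    have h1 := hw (f k)
    rw [inner_sub_right, sub_eq_zero] at h1
    have h2 : ⟪w, j (f k, 0)⟫_ℝ = ⟪j (f k, 0), w - Φ (f k, 0)⟫_ℝ := by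
      rw [inner_sub_right, inner_skew_self hj, sub_zero, real_inner_comm]
    rw [h1, h2]
    exact hbd _ _ (Submodule.sub_mem _ hmem
      (Submodule.le_topologicalClosure _ ⟨f k, rfl⟩))
  have hl : Tendsto (fun k => |⟪w, Φ (f k, 0)⟫_ℝ|) atTop (𝓝 |⟪w, w⟫_ℝ|) :=
    (tendsto_const_nhds.inner hlim').abs
  have hr : Tendsto (fun k => C * ‖Φ (f k, 0)‖ * ‖w - Φ (f k, 0)‖) atTop
      (𝓝 (C * ‖w‖ * ‖w - w‖)) :=
    (hlim'.norm.const_mul C).mul (tendsto_const_nhds.sub hlim').norm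
  have := le_of_tendsto_of_tendsto' hl hr hC0
  rw [sub_self, norm_zero, mul_zero] at this
  exact inner_self_eq_zero.1 (abs_nonpos_iff.1 this)

theorem not_forall_exists_norm_sub_lt (hρ : 0 < ρ)
    (hn : ∀ u, ⟪n, Φ u⟫_ℝ = ρ * u.2) (hj : ∀ u v, ⟪j v, Φ u⟫_ℝ = -⟪j u, Φ v⟫_ℝ) :
    ¬ ∀ ε : ℝ, 0 < ε → ∃ f : U, ‖n - (Φ (f, 0) - j (f, 0))‖ < ε := by
  intro h
  set e := Φ ((0, 1) : U × ℝ)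
  set m := 2 * ‖e‖ + ‖j ((0, 1) : U × ℝ)‖ + 1
  have hm : 0 < m := by positivity
  obtain ⟨f, hf⟩ := h (ρ / m) (div_pos hρ hm)
  set x := Φ ((f, 0) : U × ℝ)
  set d := n - (x - j (f, 0)) with hd
  have h1 : ‖x‖ ≤ ‖d‖ := by
    have h2 : ⟪d, x⟫_ℝ = -‖x‖ ^ 2 := by
      rw [hd, inner_sub_left, inner_sub_left, inner_skew_self hj, hn, real_inner_self_eq_norm_sq]
      simp
    have h3 := (abs_le.1 (abs_real_inner_le_norm d x)).1
    rw [h2] at h3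
    by_contra! h
    nlinarith [norm_nonneg d, norm_nonneg x]
  have h2 : ρ = ⟪d, e⟫_ℝ + ⟪x, e⟫_ℝ + ⟪j (0, 1), x⟫_ℝ := by
    have : ⟪j (f, 0), e⟫_ℝ = -⟪j (0, 1), x⟫_ℝ := hj _ _
    rw [hd, inner_sub_left, inner_sub_left, this, hn]
    ring
  have h3 := real_inner_le_norm d e
  have h4 := real_inner_le_norm x e
  have h5 := real_inner_le_norm (j (0, 1)) x
  have h6 : ρ ≤ ‖d‖ * m := by
    have : ρ ≤ ‖d‖ * ‖e‖ + ‖x‖ * ‖e‖ + ‖j (0, 1)‖ * ‖x‖ := by linarith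
    have h7 : ‖x‖ * ‖e‖ ≤ ‖d‖ * ‖e‖ := by gcongr
    have h8 : ‖j (0, 1)‖ * ‖x‖ ≤ ‖j (0, 1)‖ * ‖d‖ := by gcongr
    simp only [m]
    nlinarith [norm_nonneg d]
  have h9 : ‖d‖ * m < ρ := by
    have := mul_lt_mul_of_pos_right hf hm
    rwa [div_mul_cancel₀ _ hm.ne'] at this
  linarith

theorem exists_tendsto_smul [CompleteSpace K] (hd : DenseRange Φ) (hρ : 0 < ρ)
    (hn : ∀ u, ⟪n, Φ u⟫_ℝ = ρ * u.2) (hj : ∀ u v, ⟪j v, Φ u⟫_ℝ = -⟪j u, Φ v⟫_ℝ) {C : ℝ}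
    (hC : ∀ f g : U, |⟪j (f, 0), Φ (g, 0)⟫_ℝ| ≤ C * ‖Φ (f, 0)‖ * ‖Φ (g, 0)‖) :
    ∃ (κ : ℝ) (f : ℕ → U), Tendsto (fun k => Φ (f k, 1) - j (f k, 1)) atTop (𝓝 (κ • n)) := by
  let R : U × ℝ →ₗ[ℝ] K := Φ - j
  let M : Submodule ℝ K := (LinearMap.range (R ∘ₗ LinearMap.inl ℝ U ℝ)).topologicalClosure
  have : CompleteSpace M := (Submodule.isClosed_topologicalClosure _).completeSpace_coe
  have hRM : ∀ f : U, R (f, 0) ∈ M := fun f => Submodule.le_topologicalClosure _ ⟨f, rfl⟩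
  have hperp : ∀ w ∈ Mᗮ, ⟪w, n⟫_ℝ = 0 → w = 0 := fun w hw hwn =>
    eq_zero_of_inner_sub_skew_eq_zero hd hρ hn hj hC hwn fun f =>
      Submodule.inner_left_of_mem_orthogonal (hRM f) hw
  have hnM : n ∉ M := by
    intro h
    refine not_forall_exists_norm_sub_lt hρ hn hj fun ε hε => ?_
    obtain ⟨_, ⟨f, rfl⟩, hf⟩ := Metric.mem_closure_iff.1 h ε hε
    exact ⟨f, by rw [← dist_eq_norm]; exact hf⟩
  obtain ⟨n₁, hn₁, n₂, hn₂, hnn⟩ := M.exists_add_mem_mem_orthogonal n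
  obtain ⟨x₁, hx₁, x₂, hx₂, hxx⟩ := M.exists_add_mem_mem_orthogonal (R (0, 1))
  have hn20 : n₂ ≠ 0 := by
    rintro rfl
    exact hnM (by rw [hnn, add_zero]; exact hn₁)
  have hnn2 : ∀ w ∈ Mᗮ, ⟪w, n⟫_ℝ = ⟪w, n₂⟫_ℝ := fun w hw => by
    rw [hnn, inner_add_right, Submodule.inner_left_of_mem_orthogonal hn₁ hw, zero_add]
  have hn22 : ⟪n₂, n⟫_ℝ ≠ 0 := by
    rw [hnn2 _ hn₂]
    exact inner_self_ne_zero.2 hn20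
  set κ := ⟪x₂, n⟫_ℝ / ⟪n₂, n⟫_ℝ
  have hx2 : x₂ = κ • n₂ := by
    rw [← sub_eq_zero]
    refine hperp _ (Submodule.sub_mem _ hx₂ (Submodule.smul_mem _ _ hn₂)) ?_
    rw [inner_sub_left, inner_smul_left]
    simp only [κ, RCLike.conj_to_real]
    field_simp
    simp
  have hmem : R (0, 1) - κ • n ∈ M := by
    have : R (0, 1) - κ • n = x₁ - κ • n₁ := by
      rw [hxx, hx2]
      conv_lhs => rw [hnn]
      module
    rw [this]
    exact Submodule.sub_mem _ hx₁ (Submodule.smul_mem _ _ hn₁)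
  obtain ⟨y, hy, hlim⟩ := mem_closure_iff_seq_limit.1 hmem
  choose f hf using hy
  refine ⟨κ, fun k => -f k, ?_⟩
  have h1 : ∀ k, Φ (-f k, 1) - j (-f k, 1) = R (0, 1) - y k := fun k => by
    rw [← hf k]
    change R (-f k, 1) = R (0, 1) - R (f k, 0)
    rw [← map_sub]
    simp
  simp only [h1]
  have := (tendsto_const_nhds (x := R (0, 1))).sub hlim
  rwa [sub_sub_cancel] at this

/-- The limit of `Φ` along a sequence on which `Φ - j` tends to a multiple of `n`. -/
theorem exists_tendsto_of_tendsto_smul [CompleteSpace K]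
    (hn : ∀ u, ⟪n, Φ u⟫_ℝ = ρ * u.2) (hj : ∀ u v, ⟪j v, Φ u⟫_ℝ = -⟪j u, Φ v⟫_ℝ) {κ : ℝ}
    {f : ℕ → U} (hf : Tendsto (fun k => Φ (f k, 1) - j (f k, 1)) atTop (𝓝 (κ • n))) :
    ∃ x : K, Tendsto (fun k => Φ (f k, 1)) atTop (𝓝 x) ∧ ⟪x, n⟫_ℝ = ρ ∧
      ‖x‖ ^ 2 = κ * ρ ∧ ∀ v, ⟪x, Φ v + j v⟫_ℝ = κ * ρ * v.2 := by
  have hc : CauchySeq fun k => Φ (f k, 1) := by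
    have h1 := hf.cauchySeq
    rw [Metric.cauchySeq_iff] at h1 ⊢
    intro ε hε
    obtain ⟨N, hN⟩ := h1 ε hε
    refine ⟨N, fun a ha b hb => lt_of_le_of_lt ?_ (hN a ha b hb)⟩
    rw [dist_eq_norm, dist_eq_norm, ← map_sub]
    refine (norm_le_norm_sub_skew hj _).trans_eq ?_
    rw [map_sub, map_sub]
    congr 1
    abel
  obtain ⟨x, hx⟩ := cauchySeq_tendsto_of_complete hc
  have hxn : ⟪x, n⟫_ℝ = ρ := by
    refine tendsto_nhds_unique (hx.inner tendsto_const_nhds) ?_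
    have : ∀ k, ⟪Φ (f k, 1), n⟫_ℝ = ρ := fun k => by rw [real_inner_comm, hn, mul_one]
    simp [this]
  have hv : ∀ v, ⟪x, Φ v + j v⟫_ℝ = κ * ρ * v.2 := by
    intro v
    refine tendsto_nhds_unique (hx.inner tendsto_const_nhds) ?_
    have h1 : ∀ k, ⟪Φ (f k, 1), Φ v + j v⟫_ℝ = ⟪Φ (f k, 1) - j (f k, 1), Φ v⟫_ℝ := fun k => by
      rw [inner_add_right, inner_sub_left, real_inner_comm (j v), hj, sub_eq_add_neg]
    simp only [h1]
    have h2 : Tendsto (fun k => ⟪Φ (f k, 1) - j (f k, 1), Φ v⟫_ℝ) atTop (𝓝 ⟪κ • n, Φ v⟫_ℝ) :=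
      hf.inner tendsto_const_nhds
    rw [inner_smul_left, hn, ← mul_assoc] at h2
    exact h2
  refine ⟨x, hx, hxn, ?_, hv⟩
  have h1 : Tendsto (fun k => ⟪Φ (f k, 1) - j (f k, 1), Φ (f k, 1)⟫_ℝ) atTop
      (𝓝 (⟪κ • n, x⟫_ℝ)) := hf.inner hx
  have h2 : Tendsto (fun k => ‖Φ (f k, 1)‖ ^ 2) atTop (𝓝 (‖x‖ ^ 2)) := hx.norm.pow 2
  rw [inner_smul_left, real_inner_comm, hxn] at h1
  refine tendsto_nhds_unique h2 (h1.congr fun k => ?_)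
  rw [inner_sub_left, inner_skew_self hj, real_inner_self_eq_norm_sq, sub_zero]

theorem iInf_norm_add_sq [CompleteSpace K] (hd : DenseRange Φ) (hρ : 0 < ρ)
    (hn : ∀ u, ⟪n, Φ u⟫_ℝ = ρ * u.2) (hj : ∀ u v, ⟪j v, Φ u⟫_ℝ = -⟪j u, Φ v⟫_ℝ) {C : ℝ}
    (hC : ∀ f g : U, |⟪j (f, 0), Φ (g, 0)⟫_ℝ| ≤ C * ‖Φ (f, 0)‖ * ‖Φ (g, 0)‖)
    {D : Set U} (hD : ∀ (f : U) (ε : ℝ), 0 < ε →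
      ∃ g ∈ D, ‖Φ (f, 0) - Φ (g, 0)‖ < ε ∧ ‖j (f, 0) - j (g, 0)‖ < ε)
    {x : K} (hxn : ⟪x, n⟫_ℝ = ρ) (hx : ∀ f : U, ⟪x, Φ (f, 0) + j (f, 0)⟫_ℝ = 0) (y : K) :
    ⨅ f ∈ D, ((‖y + (Φ (f, 0) + j (f, 0))‖ ^ 2 : ℝ) : EReal)
      = ((⟪x, y⟫_ℝ ^ 2 / ‖x‖ ^ 2 : ℝ) : EReal) := by
  have hx0 : x ≠ 0 := by
    rintro rfl
    rw [inner_zero_left] at hxn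
    exact hρ.ne hxn
  have hxp : 0 < ‖x‖ ^ 2 := by positivity
  refine le_antisymm (EReal.le_coe_of_forall_pos fun ε hε => ?_)
    (le_iInf₂ fun f _ => ?_)
  · let R : U × ℝ →ₗ[ℝ] K := Φ + j
    let M : Submodule ℝ K := (LinearMap.range (R ∘ₗ LinearMap.inl ℝ U ℝ)).topologicalClosure
    have : CompleteSpace M := (Submodule.isClosed_topologicalClosure _).completeSpace_coe
    have hRM : ∀ f : U, R (f, 0) ∈ M := fun f => Submodule.le_topologicalClosure _ ⟨f, rfl⟩
    have hperp : ∀ w ∈ Mᗮ, w = (⟪w, n⟫_ℝ / ρ) • x := fun w hw => by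
      rw [← sub_eq_zero]
      refine eq_zero_of_inner_sub_skew_eq_zero (j := -j) (C := C) hd hρ hn ?_ ?_ ?_ ?_
      · intro u v
        simp only [LinearMap.neg_apply, inner_neg_left]
        rw [hj]
      · intro f g
        simpa only [LinearMap.neg_apply, inner_neg_left, abs_neg] using hC f g
      · rw [inner_sub_left, inner_smul_left, hxn]
        simp only [RCLike.conj_to_real]
        field_simp
        simp
      · intro f
        simp only [LinearMap.neg_apply, sub_neg_eq_add]
        rw [inner_sub_left, inner_smul_left, hx, mul_zero, sub_zero]
        exact Submodule.inner_left_of_mem_orthogonal (hRM f) hw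
    set c := ⟪x, y⟫_ℝ / ‖x‖ ^ 2
    have hmem : c • x - y ∈ M := by
      rw [← Submodule.orthogonal_orthogonal M, Submodule.mem_orthogonal]
      intro w hw
      rw [hperp w hw, inner_smul_left, inner_sub_right, inner_smul_right,
        real_inner_self_eq_norm_sq]
      simp only [c]
      field_simp
      simp
    obtain ⟨z, hz, hlim⟩ := mem_closure_iff_seq_limit.1 hmem
    choose f hf using hz
    choose g hgD hg using fun k : ℕ => hD (f k) (1 / ((k : ℝ) + 1)) Nat.one_div_pos_of_nat
    have hlim' : Tendsto (fun k => Φ (g k, 0) + j (g k, 0)) atTop (𝓝 (c • x - y)) := by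
      have h0 : Tendsto (fun k : ℕ => 1 / ((k : ℝ) + 1) + 1 / ((k : ℝ) + 1)) atTop (𝓝 (0 + 0)) :=
        tendsto_one_div_add_atTop_nhds_zero_nat.add tendsto_one_div_add_atTop_nhds_zero_nat
      rw [add_zero] at h0
      have h1 : Tendsto (fun k => (Φ (g k, 0) + j (g k, 0)) - z k) atTop (𝓝 0) := by
        refine squeeze_zero_norm (fun k => ?_) h0
        have : z k = Φ (f k, 0) + j (f k, 0) := (hf k).symm
        rw [this, add_sub_add_comm]
        refine (norm_add_le _ _).trans ?_
        rw [norm_sub_rev, norm_sub_rev (j _)]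
        exact add_le_add (hg k).1.le (hg k).2.le
      simpa using h1.add hlim
    have h1 : Tendsto (fun k => ‖y + (Φ (g k, 0) + j (g k, 0))‖ ^ 2) atTop
        (𝓝 (‖y + (c • x - y)‖ ^ 2)) :=
      (tendsto_const_nhds.add hlim').norm.pow 2
    have h2 : ‖y + (c • x - y)‖ ^ 2 = ⟪x, y⟫_ℝ ^ 2 / ‖x‖ ^ 2 := by
      rw [add_sub_cancel, norm_smul, mul_pow, Real.norm_eq_abs, sq_abs]
      simp only [c]
      field_simp
    rw [h2] at h1
    obtain ⟨k, hk⟩ := (h1.eventually_lt_const (lt_add_of_pos_right _ hε)).exists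
    exact iInf₂_le_of_le (g k) (hgD k) (EReal.coe_le_coe_iff.2 hk.le)
  · rw [EReal.coe_le_coe_iff, div_le_iff₀ hxp]
    have h1 : ⟪x, y⟫_ℝ = ⟪x, y + (Φ (f, 0) + j (f, 0))⟫_ℝ := by
      rw [inner_add_right, hx, add_zero]
    rw [h1, ← mul_pow, ← sq_abs, mul_comm ‖_‖]
    gcongr
    exact abs_real_inner_le_norm _ _


theorem iInf_iSup_of_parity
    (hn : ∀ u, ⟪n, Φ u⟫_ℝ = ρ * u.2) (hj : ∀ u v, ⟪j v, Φ u⟫_ℝ = -⟪j u, Φ v⟫_ℝ)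
    {Ue Uo : Submodule ℝ U}
    (hQ : ∀ e ∈ Ue, ∀ a : ℝ, ∀ o ∈ Uo, ⟪Φ (e, a), Φ (o, 0)⟫_ℝ = 0)
    (hBe : ∀ e ∈ Ue, ∀ a : ℝ, ∀ e' ∈ Ue, ∀ b : ℝ, ⟪j (e, a), Φ (e', b)⟫_ℝ = 0)
    (hBo : ∀ o ∈ Uo, ∀ o' ∈ Uo, ⟪j (o, 0), Φ (o', 0)⟫_ℝ = 0)
    {D : Set U} (hneg : ∀ f ∈ D, -f ∈ D) {κ : ℝ} {f fe fo : ℕ → U} (hfeo : ∀ k, f k = fe k + fo k)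
    (hfe : ∀ k, fe k ∈ Ue) (hfo : ∀ k, fo k ∈ Uo) (hfeD : ∀ k, fe k ∈ D) (hfoD : ∀ k, fo k ∈ D)
    (hf : Tendsto (fun k => Φ (f k, 1) - j (f k, 1)) atTop (𝓝 (κ • n)))
    {x : K} (hx : Tendsto (fun k => Φ (f k, 1)) atTop (𝓝 x)) (hxx : ‖x‖ ^ 2 = κ * ρ) :
    ⨅ f ∈ {f ∈ D | f ∈ Ue}, ⨆ g ∈ {g ∈ D | g ∈ Uo}, ((‖Φ (-f, 1)‖ ^ 2 + 2 * ⟪j (-f, 1), Φ (g, 0)⟫_ℝ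
      - ‖Φ (g, 0)‖ ^ 2 : ℝ) : EReal) = ((κ * ρ : ℝ) : EReal) := by
  have hsplit : ∀ k, ((f k, 1) : U × ℝ) = (fe k, 1) + (fo k, 0) := fun k => by
    ext <;> simp [hfeo k]
  have hnorm : ∀ k, ‖Φ (f k, 1)‖ ^ 2 = ‖Φ (fe k, 1)‖ ^ 2 + ‖Φ (fo k, 0)‖ ^ 2 := fun k => by
    rw [hsplit, map_add, @norm_add_sq_real, hQ _ (hfe k) _ _ (hfo k)]
    ring
  have hxlim : Tendsto (fun k => ‖Φ (f k, 1)‖ ^ 2) atTop (𝓝 (κ * ρ)) := by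
    rw [← hxx]
    exact hx.norm.pow 2
  have hdiff : Tendsto (fun k => ‖Φ (f k, 1) - j (f k, 1) - κ • n‖) atTop (𝓝 0) := by
    have := (hf.sub (tendsto_const_nhds (x := κ • n))).norm
    simpa using this
  refine le_antisymm (EReal.le_coe_of_forall_pos fun ε hε => ?_)
    (le_iInf₂ fun h hh => EReal.coe_le_of_forall_pos fun ε hε => ?_)
  · set r := fun k => Φ (f k, 1) - j (f k, 1) - κ • n with hr
    have hlim : Tendsto (fun k => ‖Φ (f k, 1)‖ ^ 2 + 2 * (‖Φ (f k, 1)‖ * ‖r k‖) + ‖r k‖ ^ 2)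
        atTop (𝓝 (κ * ρ + 2 * (‖x‖ * 0) + 0 ^ 2)) :=
      (hxlim.add ((hx.norm.mul hdiff).const_mul 2)).add (hdiff.pow 2)
    rw [mul_zero, mul_zero, add_zero, zero_pow two_ne_zero, add_zero] at hlim
    obtain ⟨k, hk⟩ := (hlim.eventually_lt_const (lt_add_of_pos_right _ hε)).exists
    refine iInf₂_le_of_le (-fe k) ⟨hneg _ (hfeD k), neg_mem (hfe k)⟩ (iSup₂_le fun g hg => ?_)
    replace hg := hg.2
    rw [EReal.coe_le_coe_iff, neg_neg]
    refine le_trans ?_ hk.le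
    have h1 : ⟪j (fe k, 1), Φ (g, 0)⟫_ℝ = ⟪Φ (fo k, 0) - r k, Φ (g, 0)⟫_ℝ := by
      have h2 : ⟪j (f k, 1), Φ (g, 0)⟫_ℝ = ⟪j (fe k, 1), Φ (g, 0)⟫_ℝ := by
        rw [hsplit, map_add, inner_add_left, hBo _ (hfo k) _ hg, add_zero]
      have h3 : ⟪Φ (f k, 1), Φ (g, 0)⟫_ℝ = ⟪Φ (fo k, 0), Φ (g, 0)⟫_ℝ := by
        rw [hsplit, map_add, inner_add_left, hQ _ (hfe k) _ _ hg, zero_add]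
      simp only [hr, inner_sub_left, inner_smul_left, hn]
      rw [h3, h2]
      simp
    have h4 : ‖Φ (fo k, 0) - r k‖ ^ 2 ≤ (‖Φ (fo k, 0)‖ + ‖r k‖) ^ 2 := by
      gcongr
      exact norm_sub_le _ _
    have h5 : 0 ≤ ‖Φ (fo k, 0) - r k - Φ (g, 0)‖ ^ 2 := sq_nonneg _
    rw [@norm_sub_sq_real] at h5
    have h6 : ‖Φ (fo k, 0)‖ ≤ ‖Φ (f k, 1)‖ := by
      refine le_of_sq_le_sq ?_ (norm_nonneg _)
      rw [hnorm]
      linarith [sq_nonneg ‖Φ (fe k, 1)‖]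
    have h7 : ‖Φ (fo k, 0)‖ * ‖r k‖ ≤ ‖Φ (f k, 1)‖ * ‖r k‖ := by gcongr
    rw [h1]
    linarith [hnorm k]
  · have hlim : Tendsto (fun k => 2 * ⟪Φ (f k, 1) - j (f k, 1), Φ (-h, 1)⟫_ℝ - ‖Φ (f k, 1)‖ ^ 2)
        atTop (𝓝 (2 * ⟪κ • n, Φ (-h, 1)⟫_ℝ - κ * ρ)) :=
      ((hf.inner tendsto_const_nhds).const_mul 2).sub hxlim
    rw [inner_smul_left, hn] at hlim
    have hval : 2 * (starRingEnd ℝ κ * (ρ * ((-h, 1) : U × ℝ).2)) - κ * ρ = κ * ρ := by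
      simp; ring
    rw [hval] at hlim
    obtain ⟨k, hk⟩ := (hlim.eventually_const_lt (sub_lt_self _ hε)).exists
    replace hh := hh.2
    refine le_iSup₂_of_le (fo k) ⟨hfoD k, hfo k⟩ ?_
    rw [EReal.coe_le_coe_iff]
    refine hk.le.trans ?_
    have h1 : ⟪j (-h, 1), Φ (fo k, 0)⟫_ℝ = -⟪j (f k, 1), Φ (-h, 1)⟫_ℝ := by
      rw [hj, hsplit, map_add, inner_add_left, hBe _ (hfe k) _ _ (neg_mem hh), zero_add]
    have h2 : ⟪Φ (f k, 1), Φ (-h, 1)⟫_ℝ = ⟪Φ (fe k, 1), Φ (-h, 1)⟫_ℝ := by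
      rw [hsplit, map_add, inner_add_left, real_inner_comm _ (Φ (fo k, 0)),
        hQ _ (neg_mem hh) _ _ (hfo k), add_zero]
    have h3 : 0 ≤ ‖Φ (fe k, 1) - Φ (-h, 1)‖ ^ 2 := sq_nonneg _
    rw [@norm_sub_sq_real] at h3
    rw [h1, inner_sub_left, h2]
    linarith [hnorm k]

end Resolvent

/-- The abstract form of the variational characterization of the diffusivity. The elements of
`U × ℝ` stand for `g + a E`, with `Q` the Dirichlet form, `B` the skew form of the Hamiltonian part
and `u ↦ ρ * u.2` the functional of the gradient. -/
theorem exists_diffusivity {U : Type} [AddCommGroup U] [Module ℝ U]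
    (Q B : (U × ℝ) →ₗ[ℝ] (U × ℝ) →ₗ[ℝ] ℝ) (hsymm : ∀ u v, Q u v = Q v u)
    (hpos : ∀ u, 0 ≤ Q u u) (hanti : ∀ u v, B u v = -B v u)
    (hB : ∀ v, ∃ M, ∀ u, |B u v| ≤ M * √(Q u u))
    {C : ℝ} (hC : ∀ f g : U, |B (f, 0) (g, 0)| ≤ C * √(Q (f, 0) (f, 0)) * √(Q (g, 0) (g, 0)))
    {ρ : ℝ} (hρ : 0 < ρ) (hn : ∃ M, ∀ u : U × ℝ, |ρ * u.2| ≤ M * √(Q u u))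
    (Ue Uo : Submodule ℝ U) (hdec : ∀ f : U, ∃ e ∈ Ue, ∃ o ∈ Uo, f = e + o)
    (hQ : ∀ e ∈ Ue, ∀ a : ℝ, ∀ o ∈ Uo, Q (e, a) (o, 0) = 0)
    (hBe : ∀ e ∈ Ue, ∀ a : ℝ, ∀ e' ∈ Ue, ∀ b : ℝ, B (e, a) (e', b) = 0)
    (hBo : ∀ o ∈ Uo, ∀ o' ∈ Uo, B (o, 0) (o', 0) = 0)
    (D : Set U) (hneg : ∀ f ∈ D, -f ∈ D)
    (happ : ∀ (f : U) (ε : ℝ), 0 < ε → ∃ g ∈ D, √(Q (f - g, 0) (f - g, 0)) ≤ ε ∧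
      (∀ u, |B u (f - g, 0)| ≤ ε * √(Q u u)) ∧ (f ∈ Ue → g ∈ Ue) ∧ (f ∈ Uo → g ∈ Uo)) :
    ∃ κ : ℝ, 0 < κ ∧
      (∀ c : ℝ, (∀ ε : ℝ, 0 < ε → ∃ f ∈ D,
        dualNormSq Q D (fun u => -Q u (-f, 1) + B u (-f, 1) + c * (ρ * u.2))
          < ((ε ^ 2 : ℝ) : EReal)) ↔ c = κ) ∧
      (⨅ f ∈ D, dualNormSq Q D (fun u => -Q u (-f, 1) - B u (-f, 1)) = ((κ * ρ : ℝ) : EReal)) ∧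
      (⨅ f ∈ D, dualNormSq Q D (fun u => ρ * u.2 + (Q u (f, 0) + B u (f, 0)))
        = ((ρ / κ : ℝ) : EReal)) ∧
      ⨅ f ∈ {f ∈ D | f ∈ Ue}, ⨆ g ∈ {g ∈ D | g ∈ Uo},
        ((Q (-f, 1) (-f, 1) + 2 * B (g, 0) (-f, 1) - Q (g, 0) (g, 0) : ℝ) : EReal)
          = ((κ * ρ : ℝ) : EReal) := by
  obtain ⟨K, _, _, _, Φ, hd, hΦ, hrep⟩ := exists_hilbert_of_posSemidef Q hsymm hpos
  have hnorm : ∀ u, √(Q u u) = ‖Φ u‖ := fun u => by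
    rw [← hΦ, real_inner_self_eq_norm_sq, Real.sqrt_sq (norm_nonneg _)]
  have hself : ∀ u, Q u u = ‖Φ u‖ ^ 2 := fun u => by rw [← hΦ, real_inner_self_eq_norm_sq]
  obtain ⟨n, hn⟩ := hrep (ρ • LinearMap.snd ℝ U ℝ) (by simpa using hn)
  replace hn : ∀ u, ⟪n, Φ u⟫_ℝ = ρ * u.2 := fun u => by simpa using hn u
  choose j₀ hj₀ using fun v => hrep (B.flip v) (hB v)
  replace hj₀ : ∀ v u, ⟪j₀ v, Φ u⟫_ℝ = B u v := hj₀
  let j : U × ℝ →ₗ[ℝ] K :=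
    { toFun := j₀
      map_add' := fun v w => eq_of_forall_inner_denseRange hd fun u => by
        rw [inner_add_left, hj₀, hj₀, hj₀, map_add]
      map_smul' := fun c v => eq_of_forall_inner_denseRange hd fun u => by
        rw [RingHom.id_apply, inner_smul_left, hj₀, hj₀, map_smul]
        simp }
  have hjB : ∀ v u, ⟪j v, Φ u⟫_ℝ = B u v := hj₀
  have hj : ∀ u v, ⟪j v, Φ u⟫_ℝ = -⟪j u, Φ v⟫_ℝ := fun u v => by rw [hjB, hjB, hanti]
  have hC' : ∀ f g : U, |⟪j (f, 0), Φ (g, 0)⟫_ℝ| ≤ C * ‖Φ (f, 0)‖ * ‖Φ (g, 0)‖ := fun f g => by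
    rw [hjB, ← hnorm, ← hnorm]
    refine (hC g f).trans_eq ?_
    ring
  have happ' : ∀ (f : U) (ε : ℝ), 0 < ε → ∃ g ∈ D, ‖Φ (f, 0) - Φ (g, 0)‖ ≤ ε ∧
      ‖j (f, 0) - j (g, 0)‖ ≤ ε ∧ (f ∈ Ue → g ∈ Ue) ∧ (f ∈ Uo → g ∈ Uo) := by
    intro f ε hε
    obtain ⟨g, hg, h1, h2, h3⟩ := happ f ε hε
    have hsub : ((f, 0) : U × ℝ) - (g, 0) = (f - g, 0) := by simp
    refine ⟨g, hg, ?_, ?_, h3⟩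
    · rw [← map_sub, hsub, ← hnorm]
      exact h1
    · rw [← map_sub, hsub]
      have h4 : ∀ y : K, |⟪j (f - g, 0), y⟫_ℝ| ≤ ε * ‖y‖ := by
        intro y
        have hcl : IsClosed {y : K | |⟪j (f - g, 0), y⟫_ℝ| ≤ ε * ‖y‖} :=
          isClosed_le (by fun_prop) (by fun_prop)
        refine hd.induction_on (p := fun y => |⟪j (f - g, 0), y⟫_ℝ| ≤ ε * ‖y‖) y hcl fun u => ?_
        rw [hjB, ← hnorm]
        exact h2 u
      have h5 := h4 (j (f - g, 0))
      rw [real_inner_self_eq_norm_sq, abs_of_nonneg (sq_nonneg _)] at h5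
      by_contra! h6
      nlinarith [norm_nonneg (j (f - g, 0))]
  have hD : ∀ (f : U) (ε : ℝ), 0 < ε →
      ∃ g ∈ D, ‖Φ (f, 0) - Φ (g, 0)‖ < ε ∧ ‖j (f, 0) - j (g, 0)‖ < ε := by
    intro f ε hε
    obtain ⟨g, hg, h1, h2, -⟩ := happ' f (ε / 2) (half_pos hε)
    exact ⟨g, hg, by linarith, by linarith⟩
  have hdD : ∀ (k : K) (ε : ℝ), 0 < ε → ∃ g ∈ D, ∃ a : ℝ, ‖k - Φ (g, a)‖ < ε := by
    intro k ε hε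
    obtain ⟨⟨f, a⟩, hu⟩ := hd.exists_dist_lt k (half_pos hε)
    obtain ⟨g, hg, h1, -⟩ := hD f (ε / 2) (half_pos hε)
    refine ⟨g, hg, a, ?_⟩
    have h2 : k - Φ (g, a) = (k - Φ (f, a)) + (Φ (f, 0) - Φ (g, 0)) := by
      have : Φ (f, a) - Φ (g, a) = Φ (f, 0) - Φ (g, 0) := by
        rw [← map_sub, ← map_sub]
        simp
      rw [← this]
      abel
    rw [h2]
    rw [dist_eq_norm] at hu
    exact (norm_add_le _ _).trans_lt (by linarith)
  obtain ⟨κ, f₀, hf₀⟩ := exists_tendsto_smul hd hρ hn hj hC'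
  choose e₀ he₀ o₀ ho₀ heo₀ using fun k => hdec (f₀ k)
  choose fe hfeD hfe₁ hfe₂ hfe' using
    fun k : ℕ => happ' (e₀ k) (1 / ((k : ℝ) + 1)) Nat.one_div_pos_of_nat
  choose fo hfoD hfo₁ hfo₂ hfo' using
    fun k : ℕ => happ' (o₀ k) (1 / ((k : ℝ) + 1)) Nat.one_div_pos_of_nat
  have hfe : ∀ k, fe k ∈ Ue := fun k => (hfe' k).1 (he₀ k)
  have hfo : ∀ k, fo k ∈ Uo := fun k => (hfo' k).2 (ho₀ k)
  let f : ℕ → U := fun k => fe k + fo k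
  have hf : Tendsto (fun k => Φ (f k, 1) - j (f k, 1)) atTop (𝓝 (κ • n)) := by
    have h0 : Tendsto (fun k : ℕ => 4 * (1 / ((k : ℝ) + 1))) atTop (𝓝 (4 * 0)) :=
      tendsto_one_div_add_atTop_nhds_zero_nat.const_mul 4
    rw [mul_zero] at h0
    have h1 : Tendsto (fun k => (Φ (f₀ k, 1) - j (f₀ k, 1)) - (Φ (f k, 1) - j (f k, 1))) atTop
        (𝓝 0) := by
      refine squeeze_zero_norm (fun k => ?_) h0
      have h2 : ((f₀ k, 1) : U × ℝ) = (f k, 1) + (((e₀ k, 0) - (fe k, 0))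
          + ((o₀ k, 0) - (fo k, 0))) := by
        ext
        · simp only [f, heo₀ k, Prod.fst_add, Prod.fst_sub]
          abel
        · simp
      have h3 : (Φ (f₀ k, 1) - j (f₀ k, 1)) - (Φ (f k, 1) - j (f k, 1))
          = (Φ (e₀ k, 0) - Φ (fe k, 0)) + (Φ (o₀ k, 0) - Φ (fo k, 0))
            - ((j (e₀ k, 0) - j (fe k, 0)) + (j (o₀ k, 0) - j (fo k, 0))) := by
        rw [h2]
        simp only [map_add, map_sub]
        abel
      rw [h3]
      refine (norm_sub_le _ _).trans ?_
      have h4 := norm_add_le (Φ (e₀ k, 0) - Φ (fe k, 0)) (Φ (o₀ k, 0) - Φ (fo k, 0))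
      have h5 := norm_add_le (j (e₀ k, 0) - j (fe k, 0)) (j (o₀ k, 0) - j (fo k, 0))
      linarith [hfe₁ k, hfe₂ k, hfo₁ k, hfo₂ k]
    have h2 := hf₀.sub h1
    simpa using h2
  obtain ⟨x, hx, hxn, hxx, hxv⟩ := exists_tendsto_of_tendsto_smul hn hj hf
  have hxf : ∀ f : U, ⟪x, Φ (f, 0) + j (f, 0)⟫_ℝ = 0 := fun f => by simpa using hxv (f, 0)
  have hκρ : 0 < κ * ρ := by
    rw [← hxx]
    have : x ≠ 0 := by
      rintro rfl
      rw [inner_zero_left] at hxn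
      exact hρ.ne hxn
    positivity
  have hκ : 0 < κ := pos_of_mul_pos_left hκρ hρ.le
  refine ⟨κ, hκ, fun c => ?_, ?_, ?_, ?_⟩
  · have hdual : ∀ f : U, dualNormSq Q D (fun u => -Q u (-f, 1) + B u (-f, 1) + c * (ρ * u.2))
        = ((‖c • n - (Φ (-f, 1) - j (-f, 1))‖ ^ 2 : ℝ) : EReal) := fun f =>
      dualNormSq_eq_norm_sq hdD hΦ fun u => by
        rw [inner_sub_left, inner_sub_left, inner_smul_left, hn, hΦ, hjB, hsymm]
        simp only [RCLike.conj_to_real]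
        ring
    simp only [hdual, EReal.coe_lt_coe_iff]
    constructor
    · intro h
      by_contra hc
      have hcκ : 0 < |c - κ| := abs_pos.2 (sub_ne_zero.2 hc)
      refine not_forall_exists_norm_sub_lt hρ hn hj fun ε hε => ?_
      obtain ⟨g, -, hg⟩ := h (|c - κ| * ε / 2) (by positivity)
      have hg' := lt_of_pow_lt_pow_left₀ 2 (by positivity) hg
      have hlim : Tendsto (fun k => ‖(Φ (f k, 1) - j (f k, 1)) - κ • n‖) atTop (𝓝 0) := by
        have := (hf.sub (tendsto_const_nhds (x := κ • n))).norm
        simpa using this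
      obtain ⟨k, hk⟩ := (hlim.eventually_lt_const
        (show 0 < |c - κ| * ε / 2 by positivity)).exists
      refine ⟨(c - κ)⁻¹ • (-g - f k), ?_⟩
      have hlin : n - (Φ ((c - κ)⁻¹ • (-g - f k), 0) - j ((c - κ)⁻¹ • (-g - f k), 0))
          = (c - κ)⁻¹ • ((c • n - (Φ (-g, 1) - j (-g, 1)))
            + ((Φ (f k, 1) - j (f k, 1)) - κ • n)) := by
        have h1 : (((c - κ)⁻¹ • (-g - f k), 0) : U × ℝ) = (c - κ)⁻¹ • ((-g, 1) - (f k, 1)) := by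
          ext <;> simp
        have h2 : n = (c - κ)⁻¹ • (c - κ) • n := by
          rw [smul_smul, inv_mul_cancel₀ (sub_ne_zero.2 hc), one_smul]
        rw [h1, map_smul, map_smul, map_sub, map_sub]
        conv_lhs => rw [h2]
        module
      rw [hlin, norm_smul, norm_inv, Real.norm_eq_abs, inv_mul_lt_iff₀ hcκ]
      refine (norm_add_le _ _).trans_lt ?_
      linarith
    · rintro rfl ε hε
      have hlim : Tendsto (fun k => ‖c • n - (Φ (f k, 1) - j (f k, 1))‖) atTop (𝓝 0) := by
        have := ((tendsto_const_nhds (x := c • n)).sub hf).norm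
        simpa using this
      obtain ⟨k, hk⟩ := (hlim.eventually_lt_const (half_pos hε)).exists
      obtain ⟨g, hgD, hg₁, hg₂⟩ := hD (-f k) (ε / 4) (by positivity)
      refine ⟨g, hgD, ?_⟩
      have hlin : c • n - (Φ (-g, 1) - j (-g, 1)) = (c • n - (Φ (f k, 1) - j (f k, 1)))
          - (Φ (-f k, 0) - Φ (g, 0)) + (j (-f k, 0) - j (g, 0)) := by
        have h2 : ((-g, 1) : U × ℝ) = (f k, 1) + ((-f k, 0) - (g, 0)) := by
          ext
          · simp only [Prod.fst_add, Prod.fst_sub]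
            abel
          · simp
        rw [h2]
        simp only [map_add, map_sub]
        abel
      have hlt : ‖c • n - (Φ (-g, 1) - j (-g, 1))‖ < ε := by
        rw [hlin]
        refine (norm_add_le _ _).trans_lt ?_
        have := norm_sub_le (c • n - (Φ (f k, 1) - j (f k, 1))) (Φ (-f k, 0) - Φ (g, 0))
        linarith
      gcongr
  · have hdual : ∀ f : U, dualNormSq Q D (fun u => -Q u (-f, 1) - B u (-f, 1))
        = ((‖(Φ (0, 1) + j (0, 1)) + (Φ (-f, 0) + j (-f, 0))‖ ^ 2 : ℝ) : EReal) := fun f => by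
      rw [← norm_neg]
      refine dualNormSq_eq_norm_sq hdD hΦ fun u => ?_
      have : ((-f, 1) : U × ℝ) = (0, 1) + (-f, 0) := by simp
      rw [this, map_add, map_add, inner_neg_left, inner_add_left, inner_add_left, inner_add_left,
        hΦ, hΦ, hjB, hjB, hsymm _ u, hsymm _ u]
      ring
    simp only [hdual]
    have hreindex : ⨅ f ∈ D, ((‖(Φ (0, 1) + j (0, 1)) + (Φ (-f, 0) + j (-f, 0))‖ ^ 2 : ℝ) : EReal)
        = ⨅ f ∈ D, ((‖(Φ (0, 1) + j (0, 1)) + (Φ (f, 0) + j (f, 0))‖ ^ 2 : ℝ) : EReal) := by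
      refine le_antisymm (le_iInf₂ fun f hf => iInf₂_le_of_le (-f) (hneg f hf) ?_)
        (le_iInf₂ fun f hf => iInf₂_le_of_le (-f) (hneg f hf) le_rfl)
      rw [neg_neg]
    rw [hreindex, iInf_norm_add_sq hd hρ hn hj hC' hD hxn hxf, hxv, hxx]
    congr 1
    field_simp
  · have hdual : ∀ f : U, dualNormSq Q D (fun u => ρ * u.2 + (Q u (f, 0) + B u (f, 0)))
        = ((‖n + (Φ (f, 0) + j (f, 0))‖ ^ 2 : ℝ) : EReal) := fun f =>
      dualNormSq_eq_norm_sq hdD hΦ fun u => by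
        rw [inner_add_left, inner_add_left, hn, hΦ, hjB, hsymm]
    simp only [hdual]
    rw [iInf_norm_add_sq hd hρ hn hj hC' hD hxn hxf, hxn, hxx]
    congr 1
    field_simp
  · have := iInf_iSup_of_parity (Ue := Ue) (Uo := Uo) hn hj
      (fun e he a o ho => by rw [hΦ, hQ e he a o ho])
      (fun e he a e' he' b => by rw [hjB, hBe e' he' b e he a])
      (fun o ho o' ho' => by rw [hjB, hBo o' ho' o ho]) hneg
      (fun k => rfl) hfe hfo hfeD hfoD hf hx hxx
    rw [← this]
    simp only [hself, hjB]

section OneDim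

theorem integrable_exp_neg_mul_of_sq_le {U : ℝ → ℝ} (hc : Continuous U) {β δ : ℝ} (hβ : 0 < β)
    (hδ : 0 < δ) (hU : ∀ x, δ * x ^ 2 ≤ U x) (s : ℝ) :
    Integrable fun x : ℝ => Real.exp (s * x - β * U x) := by
  have hb : 0 < β * δ / 2 := by positivity
  have h1 := (integrable_exp_neg_mul_sq hb).const_mul (Real.exp (s ^ 2 / (2 * (β * δ))))
  refine h1.mono' (by fun_prop) (Eventually.of_forall fun x => ?_)
  rw [Real.norm_eq_abs, abs_of_pos (Real.exp_pos _), ← Real.exp_add, Real.exp_le_exp]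
  have h2 : β * (δ * x ^ 2) ≤ β * U x := by gcongr; exact hU x
  have h3 : s ^ 2 / (2 * (β * δ)) + -(β * δ / 2) * x ^ 2 - (s * x - β * (δ * x ^ 2))
      = (s - β * δ * x) ^ 2 / (2 * (β * δ)) := by
    field_simp
    ring
  have h4 : 0 ≤ (s - β * δ * x) ^ 2 / (2 * (β * δ)) := by positivity
  linarith

theorem memLp_id_tilted_of_sq_le {U : ℝ → ℝ} (hc : Continuous U) {β δ : ℝ} (hβ : 0 < β)
    (hδ : 0 < δ) (hU : ∀ x, δ * x ^ 2 ≤ U x) {q : ENNReal} (hq : q ≠ ⊤) :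
    MemLp (fun x : ℝ => x) q ((volume : Measure ℝ).tilted fun r => -β * U r) := by
  lift q to NNReal using hq
  refine memLp_of_mem_interior_integrableExpSet ?_ q
  have : integrableExpSet (fun x : ℝ => x) ((volume : Measure ℝ).tilted fun r => -β * U r)
      = Set.univ := by
    refine Set.eq_univ_of_forall fun s => ?_
    have h0 := integrable_exp_neg_mul_of_sq_le hc hβ hδ hU 0
    have hs := integrable_exp_neg_mul_of_sq_le hc hβ hδ hU s
    rw [integrableExpSet, Set.mem_ofPred_eq, integrable_tilted_iff]
    · refine hs.congr (Eventually.of_forall fun x => ?_)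
      simp only [smul_eq_mul, ← Real.exp_add]
      congr 1
      ring
    · refine h0.congr (Eventually.of_forall fun x => ?_)
      simp
  rw [this, interior_univ]
  trivial

/-- Integration by parts for the measure with density proportional to `exp (-β U)`. -/
theorem integral_deriv_tilted {U U' h : ℝ → ℝ} {β : ℝ} (hU : ∀ x, HasDerivAt U (U' x) x)
    (hint : Integrable fun x : ℝ => Real.exp (-β * U x)) (hh : Differentiable ℝ h)
    (h1 : Integrable h ((volume : Measure ℝ).tilted fun r => -β * U r))
    (h2 : Integrable (deriv h) ((volume : Measure ℝ).tilted fun r => -β * U r))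
    (h3 : Integrable (fun x => U' x * h x) ((volume : Measure ℝ).tilted fun r => -β * U r)) :
    ∫ x, deriv h x ∂((volume : Measure ℝ).tilted fun r => -β * U r)
      = β * ∫ x, U' x * h x ∂((volume : Measure ℝ).tilted fun r => -β * U r) := by
  rw [integrable_tilted_iff hint] at h1 h2 h3
  simp only [smul_eq_mul] at h1 h2 h3
  have hder : ∀ x, HasDerivAt (fun x => Real.exp (-β * U x) * h x)
      (Real.exp (-β * U x) * deriv h x - β * (Real.exp (-β * U x) * (U' x * h x))) x := by
    intro x
    have := (((hU x).const_mul (-β)).exp).mul (hh x).hasDerivAt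
    refine this.congr_deriv ?_
    ring
  have h0 := integral_eq_zero_of_hasDerivAt_of_integrable hder (h2.sub (h3.const_mul β)) h1
  rw [integral_sub h2 (h3.const_mul β), integral_const_mul, sub_eq_zero] at h0
  rw [integral_tilted, integral_tilted]
  simp only [smul_eq_mul, div_mul_eq_mul_div]
  rw [integral_div, integral_div, h0, mul_div_assoc]

theorem gaussianReal_eq_tilted {β : ℝ} (hβ : 0 < β) :
    gaussianReal 0 (Real.toNNReal β⁻¹)
      = (volume : Measure ℝ).tilted fun p => -β * (p ^ 2 / 2) := by
  have hv : (Real.toNNReal β⁻¹ : ℝ) = β⁻¹ := Real.coe_toNNReal _ (by positivity)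
  have hv0 : Real.toNNReal β⁻¹ ≠ 0 := by
    rw [Ne, Real.toNNReal_eq_zero, not_le]
    positivity
  rw [gaussianReal_of_var_ne_zero _ hv0, Measure.tilted]
  congr with p
  have h1 := integral_gaussianPDFReal_eq_one 0 hv0
  have h2 : ∀ x, gaussianPDFReal 0 (Real.toNNReal β⁻¹) x
      = (√(2 * Real.pi * β⁻¹))⁻¹ * Real.exp (-β * (x ^ 2 / 2)) := fun x => by
    rw [gaussianPDFReal, hv, sub_zero]
    congr 2
    field_simp
  simp only [h2] at h1
  rw [integral_const_mul] at h1
  rw [gaussianPDF, h2, eq_inv_of_mul_eq_one_left h1, mul_comm, ← div_eq_mul_inv]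

end OneDim

namespace OscChain

section Potential

variable {V : ℝ → ℝ}

theorem IsPotential.differentiable (hV : IsPotential V) : Differentiable ℝ V :=
  hV.smooth.differentiable (by simp)

theorem IsPotential.contDiff_deriv (hV : IsPotential V) :
    ContDiff ℝ ((⊤ : ℕ∞) : WithTop ℕ∞) (deriv V) :=
  (contDiff_infty_iff_deriv.1 hV.smooth).2

theorem IsPotential.differentiable_deriv (hV : IsPotential V) : Differentiable ℝ (deriv V) :=
  hV.contDiff_deriv.differentiable (by simp)

theorem IsPotential.deriv_zero (hV : IsPotential V) : deriv V 0 = 0 := by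
  have h1 : deriv (fun r => V (-r)) 0 = deriv V 0 := by
    congr 1
    exact funext hV.even
  rw [deriv_comp_neg, neg_zero] at h1
  linarith

theorem IsPotential.exists_bounds (hV : IsPotential V) :
    ∃ δ₁ δ₂ : ℝ, 0 < δ₁ ∧ 0 < δ₂ ∧ (∀ r, δ₁ ≤ deriv (deriv V) r) ∧
      (∀ r, |deriv (deriv V) r| ≤ δ₂) ∧ (∀ r, |deriv V r| ≤ δ₂ * |r|) ∧
      (∀ r, |V r| ≤ δ₂ * |r| ^ 2) ∧ ∀ r, δ₁ / 2 * r ^ 2 ≤ V r := by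
  obtain ⟨δ₁, δ₂, h1, h2, -⟩ := hV.bounds
  have h0 : 0 < δ₂ := h1.trans_le ((h2 0).1.trans (h2 0).2)
  have hbd : ∀ r, |deriv (deriv V) r| ≤ δ₂ := fun r =>
    abs_le.2 ⟨by linarith [(h2 r).1], (h2 r).2⟩
  have hder : ∀ r, |deriv V r| ≤ δ₂ * |r| := fun r => by
    have := Convex.norm_image_sub_le_of_norm_deriv_le (𝕜 := ℝ) (f := deriv V) (s := Set.univ)
      (x := 0) (y := r) (fun x _ => hV.differentiable_deriv x) (fun x _ => hbd x) convex_univ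
      trivial trivial
    simpa [hV.deriv_zero] using this
  refine ⟨δ₁, δ₂, h1, h0, fun r => (h2 r).1, hbd, hder, fun r => ?_, ?_⟩
  · have := Convex.norm_image_sub_le_of_norm_deriv_le (𝕜 := ℝ) (f := V) (C := δ₂ * |r|)
      (s := Metric.closedBall 0 |r|)
      (x := 0) (y := r) (fun x _ => hV.differentiable x) (fun x hx => (hder x).trans ?_)
      (convex_closedBall _ _) (by simp) (by simp)
    · rw [hV.zero, sub_zero, sub_zero, Real.norm_eq_abs, Real.norm_eq_abs] at this
      rw [pow_two, ← mul_assoc]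
      exact this
    · exact mul_le_mul_of_nonneg_left (by simpa using hx) h0.le
  · have hpos : ∀ r, 0 ≤ r → δ₁ / 2 * r ^ 2 ≤ V r := by
      have hm1 : Monotone fun r => deriv V r - δ₁ * r := by
        refine monotone_of_deriv_nonneg
          (hV.differentiable_deriv.sub (differentiable_id.const_mul _)) fun r => ?_
        rw [deriv_fun_sub (hV.differentiable_deriv r) (by fun_prop)]
        simp only [deriv_const_mul_id']
        linarith [(h2 r).1]
      have hm2 : MonotoneOn (fun r => V r - δ₁ / 2 * r ^ 2) (Set.Ici 0) := by
        have hdv : ∀ r, HasDerivAt (fun r => V r - δ₁ / 2 * r ^ 2) (deriv V r - δ₁ * r) r := by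
          intro r
          have := (hV.differentiable r).hasDerivAt.sub (((hasDerivAt_id r).pow 2).const_mul (δ₁ / 2))
          refine this.congr_deriv ?_
          simp
          ring
        refine monotoneOn_of_deriv_nonneg (convex_Ici 0)
          (fun r _ => (hdv r).continuousAt.continuousWithinAt)
          (fun r _ => (hdv r).differentiableAt.differentiableWithinAt) fun r hr => ?_
        rw [(hdv r).deriv]
        rw [interior_Ici] at hr
        have := hm1 (le_of_lt hr)
        simpa [hV.deriv_zero] using this
      intro r hr
      have := hm2 (Set.mem_Ici.2 le_rfl) (Set.mem_Ici.2 hr) hr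
      simp [hV.zero] at this
      linarith
    intro r
    rcases le_total 0 r with h | h
    · exact hpos r h
    · have := hpos (-r) (by linarith)
      rwa [hV.even, neg_sq] at this

end Potential


section Gibbs

variable {V : ℝ → ℝ} {β : ℝ} [hV : Fact (IsPotential V)] [hβ : Fact (0 < β)]

/-- The law of a distance `r_i`. -/
noncomputable abbrev distLaw (V : ℝ → ℝ) (β : ℝ) : Measure ℝ :=
  (volume : Measure ℝ).tilted fun r => -β * V r

/-- The law of a momentum `p_i`. -/
noncomputable abbrev momLaw (β : ℝ) : Measure ℝ := gaussianReal 0 (Real.toNNReal β⁻¹)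

theorem integrable_exp_potential (V : ℝ → ℝ) (β : ℝ) [hV : Fact (IsPotential V)]
    [hβ : Fact (0 < β)] : Integrable fun r : ℝ => Real.exp (-β * V r) := by
  obtain ⟨δ₁, δ₂, h1, -, -, -, -, -, h⟩ := hV.out.exists_bounds
  simpa using integrable_exp_neg_mul_of_sq_le hV.out.differentiable.continuous hβ.out
    (half_pos h1) h 0

instance : IsProbabilityMeasure (distLaw V β) :=
  isProbabilityMeasure_tilted (integrable_exp_potential V β)

instance : IsProbabilityMeasure (siteGibbs V β) := by
  unfold siteGibbs
  infer_instance

instance : IsProbabilityMeasure (gibbs V β) := by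
  unfold gibbs
  infer_instance

theorem piCongrLeft_addRight_neg (j : ℤ) :
    ⇑(MeasurableEquiv.piCongrLeft (fun _ : ℤ => ℝ × ℝ) (Equiv.addRight (-j)))
      = fun (ω : Config) i => ω (i + j) := by
  funext ω i
  rw [MeasurableEquiv.coe_piCongrLeft]
  have := Equiv.piCongrLeft_apply_apply (fun _ : ℤ => ℝ × ℝ) (Equiv.addRight (-j)) ω (i + j)
  simpa using this

theorem measurePreserving_shift (j : ℤ) :
    MeasurePreserving (fun (ω : Config) i => ω (i + j)) (gibbs V β) (gibbs V β) := by
  refine ⟨by fun_prop, ?_⟩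
  have h := Measure.infinitePi_map_piCongrLeft (X := fun _ : ℤ => ℝ × ℝ)
    (μ := fun _ : ℤ => siteGibbs V β) (Equiv.addRight (-j))
  rw [piCongrLeft_addRight_neg] at h
  exact h

theorem measurePreserving_neg_fst :
    MeasurePreserving (fun x : ℝ × ℝ => (-x.1, x.2)) (siteGibbs V β) (siteGibbs V β) := by
  have h1 : MeasurePreserving (fun x : ℝ => -x) (momLaw β) (momLaw β) :=
    ⟨by fun_prop, by rw [gaussianReal_map_neg, neg_zero]⟩
  exact h1.prod (MeasurePreserving.id _)

/-- Reversal of the momenta `p_i`, `i ∈ s`. -/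
noncomputable def flip (s : Set ℤ) [DecidablePred (· ∈ s)] (ω : Config) : Config :=
  fun i => if i ∈ s then (-(ω i).1, (ω i).2) else ω i

theorem measurePreserving_flip (s : Set ℤ) [DecidablePred (· ∈ s)] :
    MeasurePreserving (flip s) (gibbs V β) (gibbs V β) := by
  have hm : ∀ i : ℤ, MeasurePreserving
      (fun x : ℝ × ℝ => if i ∈ s then (-x.1, x.2) else x) (siteGibbs V β) (siteGibbs V β) := by
    intro i
    by_cases hi : i ∈ s
    · simpa only [hi, if_true] using measurePreserving_neg_fst
    · simp only [hi, if_false]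
      exact MeasurePreserving.id _
  have h := Measure.infinitePi_map_pi (X := fun _ : ℤ => ℝ × ℝ)
    (μ := fun _ : ℤ => siteGibbs V β) (fun i => (hm i).measurable)
  refine ⟨?_, ?_⟩
  · unfold flip
    exact measurable_pi_lambda _ fun i => (hm i).measurable.comp (measurable_pi_apply i)
  · simp only [(hm _).map_eq] at h
    exact h

theorem measurePreserving_update {Z : Type*} [MeasurableSpace Z] {ζ : Measure Z}
    [IsProbabilityMeasure ζ] {T : (ℝ × ℝ) × Z → ℝ × ℝ}
    (hT : MeasurePreserving T ((siteGibbs V β).prod ζ) (siteGibbs V β)) (i : ℤ) :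
    MeasurePreserving (fun x : Config × Z => Function.update x.1 i (T (x.1 i, x.2)))
      ((gibbs V β).prod ζ) (gibbs V β) := by
  have hTm := hT.measurable
  have hm : Measurable fun x : Config × Z => Function.update x.1 i (T (x.1 i, x.2)) := by
    refine measurable_pi_lambda _ fun k => ?_
    by_cases hk : k = i
    · subst hk
      simp only [Function.update_self]
      fun_prop
    · simp only [Function.update_of_ne hk]
      fun_prop
  refine ⟨hm, ?_⟩
  refine Measure.eq_infinitePi (μ := fun _ : ℤ => siteGibbs V β) fun s t ht => ?_
  have hms : MeasurableSet (Set.pi (s : Set ℤ) t) := .pi s.countable_toSet fun k _ => ht k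
  rw [Measure.map_apply hm hms, Measure.prod_apply_symm (hm hms)]
  have hpre : ∀ z : Z, (fun ω : Config => (ω, z)) ⁻¹'
      ((fun x : Config × Z => Function.update x.1 i (T (x.1 i, x.2))) ⁻¹' Set.pi (s : Set ℤ) t)
      = Set.pi (s : Set ℤ) (Function.update t i ((fun x => T (x, z)) ⁻¹' t i)) := by
    intro z
    ext ω
    simp only [Set.mem_preimage, Set.mem_pi]
    refine forall₂_congr fun k _ => ?_
    by_cases hk : k = i
    · subst hk
      simp
    · simp [Function.update_of_ne hk]
  have hmi : ∀ z : Z, MeasurableSet ((fun x => T (x, z)) ⁻¹' t i) := fun z =>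
    (hTm.comp (by fun_prop : Measurable fun x => (x, z))) (ht i)
  have hval : ∀ z : Z, gibbs V β (Set.pi (s : Set ℤ)
      (Function.update t i ((fun x => T (x, z)) ⁻¹' t i)))
      = ∏ k ∈ s, siteGibbs V β (Function.update t i ((fun x => T (x, z)) ⁻¹' t i) k) := by
    intro z
    refine Measure.infinitePi_pi (μ := fun _ : ℤ => siteGibbs V β) fun k _ => ?_
    by_cases hk : k = i
    · subst hk
      simpa using hmi z
    · simpa [Function.update_of_ne hk] using ht k
  simp only [hpre, hval]
  by_cases hi : i ∈ s
  · have h1 : ∀ z : Z, ∏ k ∈ s, siteGibbs V β (Function.update t i ((fun x => T (x, z)) ⁻¹' t i) k)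
        = siteGibbs V β ((fun x => T (x, z)) ⁻¹' t i) * ∏ k ∈ s.erase i, siteGibbs V β (t k) := by
      intro z
      rw [← Finset.mul_prod_erase s _ hi, Function.update_self]
      congr 1
      refine Finset.prod_congr rfl fun k hk => ?_
      rw [Function.update_of_ne (Finset.ne_of_mem_erase hk)]
    have h2 : ∫⁻ z, siteGibbs V β ((fun x => T (x, z)) ⁻¹' t i) ∂ζ = siteGibbs V β (t i) := by
      have h3 : ∀ z, (fun x => T (x, z)) ⁻¹' t i = (fun x => (x, z)) ⁻¹' (T ⁻¹' t i) := fun _ => rfl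
      simp only [h3]
      rw [← Measure.prod_apply_symm (hTm (ht i)), hT.measure_preimage (ht i).nullMeasurableSet]
    simp only [h1]
    rw [lintegral_mul_const, h2, Finset.mul_prod_erase s (fun k => siteGibbs V β (t k)) hi]
    exact measurable_measure_prodMk_right (hTm (ht i))
  · have h1 : ∀ z : Z, ∏ k ∈ s, siteGibbs V β (Function.update t i ((fun x => T (x, z)) ⁻¹' t i) k)
        = ∏ k ∈ s, siteGibbs V β (t k) := by
      intro z
      refine Finset.prod_congr rfl fun k hk => ?_
      rw [Function.update_of_ne (ne_of_mem_of_not_mem hk hi)]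
    simp [h1]

theorem measurePreserving_update_fst (i : ℤ) :
    MeasurePreserving (fun x : Config × ℝ => Function.update x.1 i (x.2, (x.1 i).2))
      ((gibbs V β).prod (momLaw β)) (gibbs V β) := by
  refine measurePreserving_update (T := fun y : (ℝ × ℝ) × ℝ => (y.2, y.1.2)) ?_ i
  refine ⟨by fun_prop, ?_⟩
  refine (Measure.prod_eq fun s t hs ht => ?_).symm
  rw [Measure.map_apply (by fun_prop) (hs.prod ht)]
  have : (fun y : (ℝ × ℝ) × ℝ => (y.2, y.1.2)) ⁻¹' s ×ˢ t = (Set.univ ×ˢ t) ×ˢ s := by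
    ext y
    simp [and_comm]
  rw [this, Measure.prod_prod, siteGibbs, Measure.prod_prod, measure_univ, one_mul, mul_comm]

theorem measurePreserving_update_snd (i : ℤ) :
    MeasurePreserving (fun x : Config × ℝ => Function.update x.1 i ((x.1 i).1, x.2))
      ((gibbs V β).prod (distLaw V β)) (gibbs V β) := by
  refine measurePreserving_update (T := fun y : (ℝ × ℝ) × ℝ => (y.1.1, y.2)) ?_ i
  refine ⟨by fun_prop, ?_⟩
  refine (Measure.prod_eq fun s t hs ht => ?_).symm
  rw [Measure.map_apply (by fun_prop) (hs.prod ht)]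
  have : (fun y : (ℝ × ℝ) × ℝ => (y.1.1, y.2)) ⁻¹' s ×ˢ t = (s ×ˢ Set.univ) ×ˢ t := by
    ext y
    simp
  rw [this, Measure.prod_prod, siteGibbs, Measure.prod_prod, measure_univ, mul_one]

theorem avg_shift (j : ℤ) (f : Config → ℝ) : avg V β (shift j f) = avg V β f := by
  have h : MeasurableEmbedding fun (ω : Config) (i : ℤ) => ω (i + j) := by
    rw [← piCongrLeft_addRight_neg]
    exact MeasurableEquiv.measurableEmbedding _
  exact (measurePreserving_shift (V := V) (β := β) j).integral_comp h f

theorem flip_flip (s : Set ℤ) [DecidablePred (· ∈ s)] (ω : Config) : flip s (flip s ω) = ω := by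
  funext i
  by_cases hi : i ∈ s <;> simp [flip, hi]

theorem avg_comp_flip (s : Set ℤ) [DecidablePred (· ∈ s)] (f : Config → ℝ) :
    avg V β (fun ω => f (flip s ω)) = avg V β f := by
  have hm := measurePreserving_flip (V := V) (β := β) s
  let e : Config ≃ᵐ Config :=
    { toFun := flip s
      invFun := flip s
      left_inv := flip_flip s
      right_inv := flip_flip s
      measurable_toFun := hm.measurable
      measurable_invFun := hm.measurable }
  exact hm.integral_comp e.measurableEmbedding f

/-- Integration by parts in `p_i`. -/
theorem avg_dP {i : ℤ} {F : Config → ℝ}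
    (hd : ∀ ω : Config, Differentiable ℝ fun t : ℝ => F (Function.update ω i (t, (ω i).2)))
    (h1 : Integrable F (gibbs V β)) (h2 : Integrable (dP i F) (gibbs V β))
    (h3 : Integrable (fun ω => (ω i).1 * F ω) (gibbs V β)) :
    avg V β (dP i F) = β * avg V β (fun ω => (ω i).1 * F ω) := by
  have hm := measurePreserving_update_fst (V := V) (β := β) i
  have hint : ∀ {G : Config → ℝ}, Integrable G (gibbs V β) → avg V β G
      = ∫ ω, ∫ t, G (Function.update ω i (t, (ω i).2)) ∂(momLaw β) ∂(gibbs V β) := by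
    intro G hG
    rw [avg]
    conv_lhs => rw [← hm.map_eq]
    rw [integral_map hm.measurable.aemeasurable (by rw [hm.map_eq]; exact hG.1)]
    exact integral_prod _ (hm.integrable_comp_of_integrable hG)
  rw [hint h2, hint h3, ← integral_const_mul]
  refine integral_congr_ae ?_
  filter_upwards [(hm.integrable_comp_of_integrable h1).prod_right_ae,
    (hm.integrable_comp_of_integrable h2).prod_right_ae,
    (hm.integrable_comp_of_integrable h3).prod_right_ae] with ω k1 k2 k3
  have hU : ∀ p : ℝ, HasDerivAt (fun p : ℝ => p ^ 2 / 2) p p := fun p => by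
    have := ((hasDerivAt_id p).pow 2).div_const 2
    refine this.congr_deriv ?_
    simp
  have hexp : Integrable fun p : ℝ => Real.exp (-β * (p ^ 2 / 2)) := by
    have := integrable_exp_neg_mul_sq (half_pos hβ.out)
    refine this.congr (Eventually.of_forall fun p => ?_)
    ring_nf
  have hdP : ∀ t : ℝ, dP i F (Function.update ω i (t, (ω i).2))
      = deriv (fun t : ℝ => F (Function.update ω i (t, (ω i).2))) t := fun t => by
    simp [dP]
  simp only [Function.comp_def, hdP, Function.update_self] at k1 k2 k3 ⊢
  simp only [momLaw, gaussianReal_eq_tilted hβ.out] at k1 k2 k3 ⊢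
  exact integral_deriv_tilted hU hexp (hd ω) k1 k2 k3

/-- Integration by parts in `r_i`. -/
theorem avg_dR {i : ℤ} {F : Config → ℝ}
    (hd : ∀ ω : Config, Differentiable ℝ fun t : ℝ => F (Function.update ω i ((ω i).1, t)))
    (h1 : Integrable F (gibbs V β)) (h2 : Integrable (dR i F) (gibbs V β))
    (h3 : Integrable (fun ω => deriv V (ω i).2 * F ω) (gibbs V β)) :
    avg V β (dR i F) = β * avg V β (fun ω => deriv V (ω i).2 * F ω) := by
  have hm := measurePreserving_update_snd (V := V) (β := β) i
  have hint : ∀ {G : Config → ℝ}, Integrable G (gibbs V β) → avg V β G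
      = ∫ ω, ∫ t, G (Function.update ω i ((ω i).1, t)) ∂(distLaw V β) ∂(gibbs V β) := by
    intro G hG
    rw [avg]
    conv_lhs => rw [← hm.map_eq]
    rw [integral_map hm.measurable.aemeasurable (by rw [hm.map_eq]; exact hG.1)]
    exact integral_prod _ (hm.integrable_comp_of_integrable hG)
  rw [hint h2, hint h3, ← integral_const_mul]
  refine integral_congr_ae ?_
  filter_upwards [(hm.integrable_comp_of_integrable h1).prod_right_ae,
    (hm.integrable_comp_of_integrable h2).prod_right_ae,
    (hm.integrable_comp_of_integrable h3).prod_right_ae] with ω k1 k2 k3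
  have hdR : ∀ t : ℝ, dR i F (Function.update ω i ((ω i).1, t))
      = deriv (fun t : ℝ => F (Function.update ω i ((ω i).1, t))) t := fun t => by
    simp [dR]
  simp only [Function.comp_def, hdR, Function.update_self] at k1 k2 k3 ⊢
  exact integral_deriv_tilted (fun r => (hV.out.differentiable r).hasDerivAt)
    (integrable_exp_potential V β) (hd ω) k1 k2 k3

/-- Functions in `L^q(ν_β)` for all `q < ∞`. -/
def AllLp (V : ℝ → ℝ) (β : ℝ) (F : Config → ℝ) : Prop :=
  ∀ q : ENNReal, q ≠ ⊤ → MemLp F q (gibbs V β)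

namespace AllLp

variable {F G : Config → ℝ}

theorem memLp_two (hF : AllLp V β F) : MemLp F 2 (gibbs V β) := hF 2 (by simp)

theorem integrable (hF : AllLp V β F) : Integrable F (gibbs V β) :=
  memLp_one_iff_integrable.1 (hF 1 (by simp))

theorem add (hF : AllLp V β F) (hG : AllLp V β G) : AllLp V β (F + G) :=
  fun q hq => (hF q hq).add (hG q hq)

theorem sub (hF : AllLp V β F) (hG : AllLp V β G) : AllLp V β (F - G) :=
  fun q hq => (hF q hq).sub (hG q hq)

theorem smul (c : ℝ) (hF : AllLp V β F) : AllLp V β (c • F) := fun q hq => (hF q hq).const_smul c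

theorem mul (hF : AllLp V β F) (hG : AllLp V β G) : AllLp V β (F * G) := by
  intro q hq
  have : ENNReal.HolderTriple (2 * q) (2 * q) q := by
    refine ⟨?_⟩
    rw [← two_mul, ENNReal.mul_inv (by simp) (by simp), ← mul_assoc,
      ENNReal.mul_inv_cancel (by simp) (by simp), one_mul]
  exact MemLp.mul (p := 2 * q) (q := 2 * q) (hG _ (ENNReal.mul_ne_top (by simp) hq))
    (hF _ (ENNReal.mul_ne_top (by simp) hq))

theorem zero : AllLp V β 0 := fun _ _ => MemLp.zero

theorem sum {ι : Type*} {s : Finset ι} {F : ι → Config → ℝ} (h : ∀ i ∈ s, AllLp V β (F i)) :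
    AllLp V β (∑ i ∈ s, F i) :=
  fun q hq => memLp_finsetSum' s fun i hi => h i hi q hq

theorem of_bounded (hm : Measurable F) {M : ℝ} (hM : ∀ ω, |F ω| ≤ M) : AllLp V β F :=
  fun _ _ => MemLp.of_bound hm.aestronglyMeasurable M (Eventually.of_forall hM)

theorem mono (hG : AllLp V β G) (hm : Measurable F) (h : ∀ ω, |F ω| ≤ |G ω|) : AllLp V β F :=
  fun q hq => (hG q hq).mono hm.aestronglyMeasurable (Eventually.of_forall h)

theorem shift (hF : AllLp V β F) (j : ℤ) : AllLp V β (shift j F) :=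
  fun q hq => (hF q hq).comp_measurePreserving (measurePreserving_shift j)

theorem comp_flip (hF : AllLp V β F) (s : Set ℤ) [DecidablePred (· ∈ s)] :
    AllLp V β (fun ω => F (flip s ω)) :=
  fun q hq => (hF q hq).comp_measurePreserving (measurePreserving_flip s)

end AllLp

theorem allLp_dist (i : ℤ) : AllLp V β (fun ω => (ω i).2) := by
  intro q hq
  obtain ⟨δ₁, δ₂, h1, -, -, -, -, -, h⟩ := hV.out.exists_bounds
  have h0 := memLp_id_tilted_of_sq_le hV.out.differentiable.continuous hβ.out (half_pos h1) h hq
  have h2 : MeasurePreserving (Prod.snd : ℝ × ℝ → ℝ) (siteGibbs V β) (distLaw V β) :=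
    measurePreserving_snd
  exact h0.comp_measurePreserving (h2.comp (measurePreserving_eval_infinitePi _ i))

theorem allLp_mom (i : ℤ) : AllLp V β (fun ω => (ω i).1) := by
  intro q hq
  have h0 : MemLp (fun x : ℝ => x) q (momLaw β) := by
    rw [momLaw, gaussianReal_eq_tilted hβ.out]
    exact memLp_id_tilted_of_sq_le (by fun_prop) hβ.out (half_pos one_pos)
      (fun x => by linarith) hq
  have h2 : MeasurePreserving (Prod.fst : ℝ × ℝ → ℝ) (siteGibbs V β) (momLaw β) :=
    measurePreserving_fst
  exact h0.comp_measurePreserving (h2.comp (measurePreserving_eval_infinitePi _ i))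

end Gibbs


section Calculus

variable {F G : Config → ℝ}

theorem hasDerivAt_update_pair {ι : Type*} [Fintype ι] (s : ι → ℤ) (ω : Config) (i : ℤ)
    {x : ℝ → ℝ × ℝ} {x' : ℝ × ℝ} {t : ℝ} (hx : HasDerivAt x x' t) :
    HasDerivAt (fun t : ℝ => fun k => Function.update ω i (x t) (s k))
      (fun k => if s k = i then x' else 0) t := by
  rw [hasDerivAt_pi]
  intro k
  by_cases hk : s k = i
  · simpa [hk] using hx
  · simpa [hk] using hasDerivAt_const t (ω (s k))

theorem hasDerivAt_comp_update {ι : Type*} [Fintype ι] {s : ι → ℤ} {φ : (ι → ℝ × ℝ) → ℝ}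
    (hφ : ContDiff ℝ ((⊤ : ℕ∞) : WithTop ℕ∞) φ) (ω : Config) (i : ℤ)
    {x : ℝ → ℝ × ℝ} {x' : ℝ × ℝ} {t : ℝ} (hx : HasDerivAt x x' t) :
    HasDerivAt (fun t : ℝ => φ fun k => Function.update ω i (x t) (s k))
      (fderiv ℝ φ (fun k => Function.update ω i (x t) (s k)) fun k => if s k = i then x' else 0)
      t :=
  ((hφ.differentiable (by simp)) _).hasFDerivAt.comp_hasDerivAt t
    (hasDerivAt_update_pair s ω i hx)

theorem hasDerivAt_prodMk_left' (r t : ℝ) : HasDerivAt (fun t : ℝ => (t, r)) (1, 0) t :=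
  (hasDerivAt_id t).prodMk (hasDerivAt_const t r)

theorem hasDerivAt_prodMk_right' (p t : ℝ) : HasDerivAt (fun t : ℝ => (p, t)) (0, 1) t :=
  (hasDerivAt_const t p).prodMk (hasDerivAt_id t)

theorem dP_comp {ι : Type*} [Fintype ι] {s : ι → ℤ} {φ : (ι → ℝ × ℝ) → ℝ}
    (hφ : ContDiff ℝ ((⊤ : ℕ∞) : WithTop ℕ∞) φ) (hF : ∀ ω, F ω = φ fun k => ω (s k)) (i : ℤ)
    (ω : Config) :
    dP i F ω = fderiv ℝ φ (fun k => ω (s k)) fun k => if s k = i then (1, 0) else 0 := by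
  have h := hasDerivAt_comp_update hφ (s := s) ω i (hasDerivAt_prodMk_left' (ω i).2 (ω i).1)
  simp only [dP, hF]
  rw [h.deriv, Function.update_eq_self]

theorem dR_comp {ι : Type*} [Fintype ι] {s : ι → ℤ} {φ : (ι → ℝ × ℝ) → ℝ}
    (hφ : ContDiff ℝ ((⊤ : ℕ∞) : WithTop ℕ∞) φ) (hF : ∀ ω, F ω = φ fun k => ω (s k)) (i : ℤ)
    (ω : Config) :
    dR i F ω = fderiv ℝ φ (fun k => ω (s k)) fun k => if s k = i then (0, 1) else 0 := by
  have h := hasDerivAt_comp_update hφ (s := s) ω i (hasDerivAt_prodMk_right' (ω i).1 (ω i).2)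
  simp only [dR, hF]
  rw [h.deriv, Function.update_eq_self]

theorem isSmoothLocal_of_comp {ι : Type*} [Fintype ι] (s : ι → ℤ) {φ : (ι → ℝ × ℝ) → ℝ}
    (hφ : ContDiff ℝ ((⊤ : ℕ∞) : WithTop ℕ∞) φ) (hF : ∀ ω, F ω = φ fun k => ω (s k)) :
    IsSmoothLocal F := by
  classical
  refine ⟨Finset.univ.image s, fun x => φ fun k => x ⟨s k, by simp⟩, hφ.comp ?_, fun ω => hF ω⟩
  fun_prop

namespace IsSmoothLocal

theorem add (hF : IsSmoothLocal F) (hG : IsSmoothLocal G) : IsSmoothLocal (F + G) := by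
  obtain ⟨Λ, φ, hφ, h⟩ := hF
  obtain ⟨Λ', φ', hφ', h'⟩ := hG
  refine isSmoothLocal_of_comp (ι := Λ ⊕ Λ') (Sum.elim (fun k => k) fun k => k)
    (φ := fun x => φ (fun k => x (Sum.inl k)) + φ' fun k => x (Sum.inr k))
    ((hφ.comp (by fun_prop)).add (hφ'.comp (by fun_prop))) fun ω => ?_
  simp only [Pi.add_apply, h, h']
  rfl

theorem mul (hF : IsSmoothLocal F) (hG : IsSmoothLocal G) : IsSmoothLocal (F * G) := by
  obtain ⟨Λ, φ, hφ, h⟩ := hF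
  obtain ⟨Λ', φ', hφ', h'⟩ := hG
  refine isSmoothLocal_of_comp (ι := Λ ⊕ Λ') (Sum.elim (fun k => k) fun k => k)
    (φ := fun x => φ (fun k => x (Sum.inl k)) * φ' fun k => x (Sum.inr k))
    ((hφ.comp (by fun_prop)).mul (hφ'.comp (by fun_prop))) fun ω => ?_
  simp only [Pi.mul_apply, h, h']
  rfl

theorem const (c : ℝ) : IsSmoothLocal fun _ => c :=
  ⟨∅, fun _ => c, contDiff_const, fun _ => rfl⟩

theorem smul (c : ℝ) (hF : IsSmoothLocal F) : IsSmoothLocal (c • F) := (const c).mul hF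

theorem comp_mom {u : ℝ → ℝ} (hu : ContDiff ℝ ((⊤ : ℕ∞) : WithTop ℕ∞) u) (i : ℤ) :
    IsSmoothLocal fun ω => u (ω i).1 :=
  isSmoothLocal_of_comp (ι := Unit) (fun _ => i) (φ := fun x => u (x ()).1)
    (hu.comp (by fun_prop)) fun _ => rfl

theorem comp_dist {u : ℝ → ℝ} (hu : ContDiff ℝ ((⊤ : ℕ∞) : WithTop ℕ∞) u) (i : ℤ) :
    IsSmoothLocal fun ω => u (ω i).2 :=
  isSmoothLocal_of_comp (ι := Unit) (fun _ => i) (φ := fun x => u (x ()).2)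
    (hu.comp (by fun_prop)) fun _ => rfl

theorem shift (hF : IsSmoothLocal F) (j : ℤ) : IsSmoothLocal (shift j F) := by
  obtain ⟨Λ, φ, hφ, h⟩ := hF
  exact isSmoothLocal_of_comp (ι := Λ) (fun k => k + j) hφ fun ω => h _

theorem comp_flip (hF : IsSmoothLocal F) (s : Set ℤ) [DecidablePred (· ∈ s)] :
    IsSmoothLocal fun ω => F (flip s ω) := by
  obtain ⟨Λ, φ, hφ, h⟩ := hF
  refine isSmoothLocal_of_comp (ι := Λ) (fun k => k)
    (φ := fun x => φ fun k => if (k : ℤ) ∈ s then (-(x k).1, (x k).2) else x k)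
    (hφ.comp (contDiff_pi.2 fun k => ?_)) fun ω => h _
  by_cases hk : (k : ℤ) ∈ s
  · simp only [hk, if_true]
    fun_prop
  · simp only [hk, if_false]
    fun_prop

theorem measurable (hF : IsSmoothLocal F) : Measurable F := by
  obtain ⟨Λ, φ, hφ, h⟩ := hF
  rw [funext h]
  exact hφ.continuous.measurable.comp (by fun_prop)

theorem dP (hF : IsSmoothLocal F) (i : ℤ) : IsSmoothLocal (dP i F) := by
  obtain ⟨Λ, φ, hφ, h⟩ := hF
  exact isSmoothLocal_of_comp (ι := Λ) (fun k => k)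
    ((hφ.fderiv_right (m := ((⊤ : ℕ∞) : WithTop ℕ∞)) (by simp)).clm_apply contDiff_const)
    (dP_comp (s := fun k : Λ => (k : ℤ)) hφ h i)

theorem dR (hF : IsSmoothLocal F) (i : ℤ) : IsSmoothLocal (dR i F) := by
  obtain ⟨Λ, φ, hφ, h⟩ := hF
  exact isSmoothLocal_of_comp (ι := Λ) (fun k => k)
    ((hφ.fderiv_right (m := ((⊤ : ℕ∞) : WithTop ℕ∞)) (by simp)).clm_apply contDiff_const)
    (dR_comp (s := fun k : Λ => (k : ℤ)) hφ h i)

theorem differentiable_fst (hF : IsSmoothLocal F) (i : ℤ) (ω : Config) (r : ℝ) :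
    Differentiable ℝ fun t : ℝ => F (Function.update ω i (t, r)) := by
  obtain ⟨Λ, φ, hφ, h⟩ := hF
  intro t
  simp only [h]
  exact (hasDerivAt_comp_update hφ (s := fun k : Λ => (k : ℤ)) ω i
    (hasDerivAt_prodMk_left' r t)).differentiableAt

theorem differentiable_snd (hF : IsSmoothLocal F) (i : ℤ) (ω : Config) (p : ℝ) :
    Differentiable ℝ fun t : ℝ => F (Function.update ω i (p, t)) := by
  obtain ⟨Λ, φ, hφ, h⟩ := hF
  intro t
  simp only [h]
  exact (hasDerivAt_comp_update hφ (s := fun k : Λ => (k : ℤ)) ω i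
    (hasDerivAt_prodMk_right' p t)).differentiableAt

theorem dP_add (hF : IsSmoothLocal F) (hG : IsSmoothLocal G) (i : ℤ) :
    OscChain.dP i (F + G) = OscChain.dP i F + OscChain.dP i G := by
  funext ω
  exact deriv_fun_add (hF.differentiable_fst i ω _ _) (hG.differentiable_fst i ω _ _)

theorem dR_add (hF : IsSmoothLocal F) (hG : IsSmoothLocal G) (i : ℤ) :
    OscChain.dR i (F + G) = OscChain.dR i F + OscChain.dR i G := by
  funext ω
  exact deriv_fun_add (hF.differentiable_snd i ω _ _) (hG.differentiable_snd i ω _ _)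

theorem dP_mul (hF : IsSmoothLocal F) (hG : IsSmoothLocal G) (i : ℤ) :
    OscChain.dP i (F * G) = OscChain.dP i F * G + F * OscChain.dP i G := by
  funext ω
  have := deriv_fun_mul (hF.differentiable_fst i ω (ω i).2 (ω i).1)
    (hG.differentiable_fst i ω (ω i).2 (ω i).1)
  simpa [OscChain.dP] using this

theorem dR_mul (hF : IsSmoothLocal F) (hG : IsSmoothLocal G) (i : ℤ) :
    OscChain.dR i (F * G) = OscChain.dR i F * G + F * OscChain.dR i G := by
  funext ω
  have := deriv_fun_mul (hF.differentiable_snd i ω (ω i).1 (ω i).2)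
    (hG.differentiable_snd i ω (ω i).1 (ω i).2)
  simpa [OscChain.dR] using this

end IsSmoothLocal

theorem dP_smul (c : ℝ) (F : Config → ℝ) (i : ℤ) : dP i (c • F) = c • dP i F := by
  funext ω
  simp [dP]

theorem dR_smul (c : ℝ) (F : Config → ℝ) (i : ℤ) : dR i (c • F) = c • dR i F := by
  funext ω
  simp [dR]

theorem dP_zero (i : ℤ) : dP i 0 = 0 := by
  funext ω
  simp [dP]

theorem dR_zero (i : ℤ) : dR i 0 = 0 := by
  funext ω
  simp [dR]

theorem dP_comp_dist (u : ℝ → ℝ) (i j : ℤ) : dP i (fun ω => u (ω j).2) = 0 := by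
  funext ω
  have : (fun t : ℝ => u (Function.update ω i (t, (ω i).2) j).2) = fun _ => u (ω j).2 := by
    funext t
    by_cases h : j = i
    · subst h
      simp
    · simp [Function.update_of_ne h]
  simp [dP, this]

theorem dR_comp_mom (u : ℝ → ℝ) (i j : ℤ) : dR i (fun ω => u (ω j).1) = 0 := by
  funext ω
  have : (fun t : ℝ => u (Function.update ω i ((ω i).1, t) j).1) = fun _ => u (ω j).1 := by
    funext t
    by_cases h : j = i
    · subst h
      simp
    · simp [Function.update_of_ne h]
  simp [dR, this]

theorem dP_comp_mom (u : ℝ → ℝ) (i j : ℤ) :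
    dP i (fun ω => u (ω j).1) = fun ω => if i = j then deriv u (ω j).1 else 0 := by
  funext ω
  by_cases h : i = j
  · subst h
    simp [dP]
  · simp [dP, h, Function.update_of_ne (Ne.symm h)]

theorem dR_comp_dist (u : ℝ → ℝ) (i j : ℤ) :
    dR i (fun ω => u (ω j).2) = fun ω => if i = j then deriv u (ω j).2 else 0 := by
  funext ω
  by_cases h : i = j
  · subst h
    simp [dR]
  · simp [dR, h, Function.update_of_ne (Ne.symm h)]

theorem update_add_right (ω : Config) (i j : ℤ) (x : ℝ × ℝ) :
    (fun k => Function.update ω i x (k + j))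
      = Function.update (fun k => ω (k + j)) (i - j) x := by
  funext k
  by_cases h : k + j = i
  · subst h
    simp
  · rw [Function.update_of_ne h, Function.update_of_ne (by omega)]

theorem dP_shift (i j : ℤ) (F : Config → ℝ) : dP i (shift j F) = shift j (dP (i - j) F) := by
  funext ω
  simp only [dP, shift, update_add_right, sub_add_cancel]

theorem dR_shift (i j : ℤ) (F : Config → ℝ) : dR i (shift j F) = shift j (dR (i - j) F) := by
  funext ω
  simp only [dR, shift, update_add_right, sub_add_cancel]

theorem flip_update (s : Set ℤ) [DecidablePred (· ∈ s)] (ω : Config) (i : ℤ) (x : ℝ × ℝ) :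
    flip s (Function.update ω i x)
      = Function.update (flip s ω) i (if i ∈ s then (-x.1, x.2) else x) := by
  funext k
  by_cases h : k = i
  · subst h
    simp [flip]
  · simp [flip, Function.update_of_ne h]

theorem dP_comp_flip (s : Set ℤ) [DecidablePred (· ∈ s)] (i : ℤ) (F : Config → ℝ) :
    dP i (fun ω => F (flip s ω)) = fun ω => (if i ∈ s then -1 else 1) * dP i F (flip s ω) := by
  funext ω
  by_cases h : i ∈ s
  · have := deriv_comp_neg (fun t : ℝ => F (Function.update (flip s ω) i (t, (ω i).2))) (ω i).1
    simp only [dP, flip_update, h, if_true]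
    rw [this]
    simp [flip, h]
  · simp [dP, flip_update, h, flip]

theorem dR_comp_flip (s : Set ℤ) [DecidablePred (· ∈ s)] (i : ℤ) (F : Config → ℝ) :
    dR i (fun ω => F (flip s ω)) = fun ω => dR i F (flip s ω) := by
  funext ω
  by_cases h : i ∈ s <;> simp [dR, flip_update, h, flip]

theorem dP_of_dependsOn {s : Set ℤ} (hF : DependsOn F s) {i : ℤ} (hi : i ∉ s) : dP i F = 0 := by
  funext ω
  have : (fun t : ℝ => F (Function.update ω i (t, (ω i).2))) = fun _ => F ω := by
    funext t
    exact hF fun k hk => Function.update_of_ne (ne_of_mem_of_not_mem hk hi) _ _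
  simp [dP, this]

theorem dR_of_dependsOn {s : Set ℤ} (hF : DependsOn F s) {i : ℤ} (hi : i ∉ s) : dR i F = 0 := by
  funext ω
  have : (fun t : ℝ => F (Function.update ω i ((ω i).1, t))) = fun _ => F ω := by
    funext t
    exact hF fun k hk => Function.update_of_ne (ne_of_mem_of_not_mem hk hi) _ _
  simp [dR, this]

end Calculus

section Fields

variable {V : ℝ → ℝ} {F G : Config → ℝ}

theorem Y_eq (V : ℝ → ℝ) (i j : ℤ) (F : Config → ℝ) :
    Y V i j F = (fun ω : Config => (ω i).1) * dR j F - (fun ω : Config => deriv V (ω j).2) * dP i F :=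
  rfl

theorem Y_add (hF : IsSmoothLocal F) (hG : IsSmoothLocal G) (i j : ℤ) :
    Y V i j (F + G) = Y V i j F + Y V i j G := by
  rw [Y_eq, Y_eq, Y_eq, hF.dP_add hG, hF.dR_add hG]
  ring

theorem Y_mul (hF : IsSmoothLocal F) (hG : IsSmoothLocal G) (i j : ℤ) :
    Y V i j (F * G) = Y V i j F * G + F * Y V i j G := by
  rw [Y_eq, Y_eq, Y_eq, hF.dP_mul hG, hF.dR_mul hG]
  ring

theorem Y_smul (c : ℝ) (F : Config → ℝ) (i j : ℤ) : Y V i j (c • F) = c • Y V i j F := by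
  rw [Y_eq, Y_eq, dP_smul, dR_smul, mul_smul_comm, mul_smul_comm, smul_sub]

theorem Y_zero (i j : ℤ) : Y V i j 0 = 0 := by
  rw [Y_eq, dP_zero, dR_zero, mul_zero, mul_zero, sub_zero]

theorem Y_shift (i j k : ℤ) (F : Config → ℝ) :
    Y V i j (shift k F) = shift k (Y V (i - k) (j - k) F) := by
  funext ω
  simp only [Y, dP_shift, dR_shift, shift, sub_add_cancel]

theorem shift_Y (i j k : ℤ) (F : Config → ℝ) :
    shift k (Y V i j F) = Y V (i + k) (j + k) (shift k F) := by
  rw [Y_shift, add_sub_cancel_right, add_sub_cancel_right]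

theorem Y_comp_flip {s : Set ℤ} [DecidablePred (· ∈ s)] {i : ℤ} (hi : i ∈ s) (j : ℤ)
    (F : Config → ℝ) :
    Y V i j (fun ω => F (flip s ω)) = fun ω => -Y V i j F (flip s ω) := by
  funext ω
  have h1 : (flip s ω i).1 = -(ω i).1 := by simp [flip, hi]
  have h2 : (flip s ω j).2 = (ω j).2 := by by_cases hj : j ∈ s <;> simp [flip, hj]
  simp only [Y, dP_comp_flip, dR_comp_flip, hi, if_true, h1, h2]
  ring

theorem Y_of_dependsOn {s : Set ℤ} (hF : DependsOn F s) {i j : ℤ} (hi : i ∉ s) (hj : j ∉ s) :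
    Y V i j F = 0 := by
  rw [Y_eq, dP_of_dependsOn hF hi, dR_of_dependsOn hF hj, mul_zero, mul_zero, sub_zero]

theorem IsSmoothLocal.sum {ι : Type*} {s : Finset ι} {F : ι → Config → ℝ}
    (h : ∀ i ∈ s, IsSmoothLocal (F i)) : IsSmoothLocal (∑ i ∈ s, F i) := by
  classical
  induction s using Finset.induction_on with
  | empty => exact IsSmoothLocal.const 0
  | insert a s ha ih =>
    rw [Finset.sum_insert ha]
    exact (h a (by simp)).add (ih fun i hi => h i (by simp [hi]))

theorem Y_sum {ι : Type*} {s : Finset ι} {F : ι → Config → ℝ}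
    (h : ∀ i ∈ s, IsSmoothLocal (F i)) (i j : ℤ) :
    Y V i j (∑ k ∈ s, F k) = ∑ k ∈ s, Y V i j (F k) := by
  classical
  induction s using Finset.induction_on with
  | empty => exact Y_zero i j
  | insert a s ha ih =>
    rw [Finset.sum_insert ha, Finset.sum_insert ha, Y_add (h a (by simp))
      (IsSmoothLocal.sum fun i hi => h i (by simp [hi])), ih fun i hi => h i (by simp [hi])]

end Fields


/-- Smooth local functions that are, together with their first derivatives, in `L^q(ν_β)` for all
`q < ∞`. -/
structure Tame (V : ℝ → ℝ) (β : ℝ) (F : Config → ℝ) : Prop where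
  smooth : IsSmoothLocal F
  allLp : AllLp V β F
  dP : ∀ i, AllLp V β (dP i F)
  dR : ∀ i, AllLp V β (dR i F)

section Tame

variable {V : ℝ → ℝ} {β : ℝ} [hV : Fact (IsPotential V)] [hβ : Fact (0 < β)] {F G : Config → ℝ}

namespace Tame

theorem add (hF : Tame V β F) (hG : Tame V β G) : Tame V β (F + G) where
  smooth := hF.smooth.add hG.smooth
  allLp := hF.allLp.add hG.allLp
  dP i := by
    rw [hF.smooth.dP_add hG.smooth]
    exact (hF.dP i).add (hG.dP i)
  dR i := by
    rw [hF.smooth.dR_add hG.smooth]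
    exact (hF.dR i).add (hG.dR i)

theorem mul (hF : Tame V β F) (hG : Tame V β G) : Tame V β (F * G) where
  smooth := hF.smooth.mul hG.smooth
  allLp := hF.allLp.mul hG.allLp
  dP i := by
    rw [hF.smooth.dP_mul hG.smooth]
    exact ((hF.dP i).mul hG.allLp).add (hF.allLp.mul (hG.dP i))
  dR i := by
    rw [hF.smooth.dR_mul hG.smooth]
    exact ((hF.dR i).mul hG.allLp).add (hF.allLp.mul (hG.dR i))

theorem smul (c : ℝ) (hF : Tame V β F) : Tame V β (c • F) where
  smooth := hF.smooth.smul c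
  allLp := hF.allLp.smul c
  dP i := by
    rw [dP_smul]
    exact (hF.dP i).smul c
  dR i := by
    rw [dR_smul]
    exact (hF.dR i).smul c

theorem neg (hF : Tame V β F) : Tame V β (-F) := by
  rw [← neg_one_smul ℝ]
  exact hF.smul _

theorem sub (hF : Tame V β F) (hG : Tame V β G) : Tame V β (F - G) := by
  rw [sub_eq_add_neg]
  exact hF.add hG.neg

theorem zero : Tame V β 0 where
  smooth := IsSmoothLocal.const 0
  allLp := AllLp.zero
  dP i := by
    rw [dP_zero]
    exact AllLp.zero
  dR i := by
    rw [dR_zero]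
    exact AllLp.zero

theorem sum {ι : Type*} {s : Finset ι} {F : ι → Config → ℝ} (h : ∀ i ∈ s, Tame V β (F i)) :
    Tame V β (∑ i ∈ s, F i) := by
  classical
  induction s using Finset.induction_on with
  | empty => exact zero
  | insert a s ha ih =>
    rw [Finset.sum_insert ha]
    exact (h a (by simp)).add (ih fun i hi => h i (by simp [hi]))

theorem shift (hF : Tame V β F) (j : ℤ) : Tame V β (shift j F) where
  smooth := hF.smooth.shift j
  allLp := hF.allLp.shift j
  dP i := by
    rw [dP_shift]
    exact (hF.dP _).shift j
  dR i := by
    rw [dR_shift]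
    exact (hF.dR _).shift j

theorem comp_flip (hF : Tame V β F) (s : Set ℤ) [DecidablePred (· ∈ s)] :
    Tame V β (fun ω => F (flip s ω)) where
  smooth := hF.smooth.comp_flip s
  allLp := hF.allLp.comp_flip s
  dP i := by
    rw [dP_comp_flip]
    exact ((hF.dP i).comp_flip s).smul (if i ∈ s then -1 else 1)
  dR i := by
    rw [dR_comp_flip]
    exact (hF.dR i).comp_flip s

theorem of_bounded (hF : IsSmoothLocal F) (h0 : ∃ M, ∀ ω, |F ω| ≤ M)
    (h1 : ∀ i, ∃ M, ∀ ω, |OscChain.dP i F ω| ≤ M) (h2 : ∀ i, ∃ M, ∀ ω, |OscChain.dR i F ω| ≤ M) :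
    Tame V β F where
  smooth := hF
  allLp := AllLp.of_bounded hF.measurable h0.choose_spec
  dP i := AllLp.of_bounded (hF.dP i).measurable (h1 i).choose_spec
  dR i := AllLp.of_bounded (hF.dR i).measurable (h2 i).choose_spec

theorem comp_mom {u : ℝ → ℝ} (hu : ContDiff ℝ ((⊤ : ℕ∞) : WithTop ℕ∞) u) {i : ℤ}
    (h0 : AllLp V β fun ω => u (ω i).1) (h1 : AllLp V β fun ω => deriv u (ω i).1) :
    Tame V β fun ω => u (ω i).1 where
  smooth := IsSmoothLocal.comp_mom hu i
  allLp := h0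
  dP j := by
    rw [dP_comp_mom]
    by_cases h : j = i
    · simpa only [h, if_true] using h1
    · simp only [h, if_false]
      exact AllLp.zero
  dR j := by
    rw [dR_comp_mom]
    exact AllLp.zero

theorem comp_dist {u : ℝ → ℝ} (hu : ContDiff ℝ ((⊤ : ℕ∞) : WithTop ℕ∞) u) {i : ℤ}
    (h0 : AllLp V β fun ω => u (ω i).2) (h1 : AllLp V β fun ω => deriv u (ω i).2) :
    Tame V β fun ω => u (ω i).2 where
  smooth := IsSmoothLocal.comp_dist hu i
  allLp := h0
  dP j := by
    rw [dP_comp_dist]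
    exact AllLp.zero
  dR j := by
    rw [dR_comp_dist]
    by_cases h : j = i
    · simpa only [h, if_true] using h1
    · simp only [h, if_false]
      exact AllLp.zero

end Tame

theorem allLp_const (c : ℝ) : AllLp V β fun _ => c :=
  AllLp.of_bounded measurable_const (M := |c|) fun _ => le_rfl

theorem tame_mom (i : ℤ) : Tame V β fun ω => (ω i).1 :=
  Tame.comp_mom (u := fun x => x) contDiff_id (allLp_mom i) (by simpa using allLp_const 1)

theorem tame_dist (i : ℤ) : Tame V β fun ω => (ω i).2 :=
  Tame.comp_dist (u := fun x => x) contDiff_id (allLp_dist i) (by simpa using allLp_const 1)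

theorem allLp_deriv_potential (i : ℤ) : AllLp V β fun ω => deriv V (ω i).2 := by
  obtain ⟨δ₁, δ₂, -, h2, -, -, h, -, -⟩ := hV.out.exists_bounds
  refine ((allLp_dist i).smul δ₂).mono
    (hV.out.contDiff_deriv.continuous.measurable.comp (by fun_prop)) fun ω => ?_
  refine (h _).trans_eq ?_
  simp [abs_mul, abs_of_pos h2]

theorem tame_deriv_potential (i : ℤ) : Tame V β fun ω => deriv V (ω i).2 := by
  refine Tame.comp_dist hV.out.contDiff_deriv (allLp_deriv_potential i) ?_
  obtain ⟨δ₁, δ₂, -, -, -, h, -, -, -⟩ := hV.out.exists_bounds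
  exact AllLp.of_bounded
    ((contDiff_infty_iff_deriv.1 hV.out.contDiff_deriv).2.continuous.measurable.comp
      (by fun_prop)) fun ω => h _

theorem tame_potential (i : ℤ) : Tame V β fun ω => V (ω i).2 := by
  refine Tame.comp_dist hV.out.smooth ?_ (allLp_deriv_potential i)
  obtain ⟨δ₁, δ₂, -, h2, -, -, -, h, -⟩ := hV.out.exists_bounds
  refine (((allLp_dist i).mul (allLp_dist i)).smul δ₂).mono
    (hV.out.smooth.continuous.measurable.comp (by fun_prop)) fun ω => ?_
  refine (h _).trans_eq ?_
  simp [abs_mul, abs_of_pos h2, pow_two]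

theorem AllLp.congr (hF : AllLp V β F) (h : F = G) : AllLp V β G := h ▸ hF

theorem tame_energy (i : ℤ) : Tame V β (energy V i) := by
  have : energy V i = (1 / 2 : ℝ) • ((fun ω : Config => (ω i).1) * fun ω => (ω i).1)
      + fun ω => V (ω i).2 := by
    funext ω
    simp [energy]
    ring
  rw [this]
  exact (((tame_mom i).mul (tame_mom i)).smul _).add (tame_potential i)

theorem Tame.Y (hF : Tame V β F) (i j : ℤ) : AllLp V β (Y V i j F) := by
  rw [Y_eq]
  exact ((allLp_mom i).mul (hF.dR j)).sub ((allLp_deriv_potential j).mul (hF.dP i))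

theorem Tame.avg_dP (hF : Tame V β F) (i : ℤ) :
    avg V β (OscChain.dP i F) = β * avg V β (fun ω => (ω i).1 * F ω) :=
  OscChain.avg_dP (fun ω => hF.smooth.differentiable_fst i ω _) hF.allLp.integrable
    (hF.dP i).integrable ((allLp_mom i).mul hF.allLp).integrable

theorem Tame.avg_dR (hF : Tame V β F) (i : ℤ) :
    avg V β (OscChain.dR i F) = β * avg V β (fun ω => deriv V (ω i).2 * F ω) :=
  OscChain.avg_dR (fun ω => hF.smooth.differentiable_snd i ω _) hF.allLp.integrable
    (hF.dR i).integrable ((allLp_deriv_potential i).mul hF.allLp).integrable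

theorem AllLp.avg_add (hF : AllLp V β F) (hG : AllLp V β G) :
    avg V β (F + G) = avg V β F + avg V β G :=
  integral_add hF.integrable hG.integrable

theorem AllLp.avg_sub (hF : AllLp V β F) (hG : AllLp V β G) :
    avg V β (F - G) = avg V β F - avg V β G :=
  integral_sub hF.integrable hG.integrable

theorem avg_smul (c : ℝ) (F : Config → ℝ) : avg V β (c • F) = c * avg V β F :=
  integral_const_mul c F

theorem avg_neg (F : Config → ℝ) : avg V β (-F) = -avg V β F := integral_neg F

theorem avg_zero : avg V β 0 = 0 := integral_zero _ _

theorem AllLp.avg_sum {ι : Type*} {s : Finset ι} {F : ι → Config → ℝ}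
    (h : ∀ i ∈ s, AllLp V β (F i)) : avg V β (∑ i ∈ s, F i) = ∑ i ∈ s, avg V β (F i) := by
  simp only [avg, Finset.sum_apply]
  exact integral_finsetSum s fun i hi => (h i hi).integrable

/-- The vector fields `Y_{i,j}` are divergence free. -/
theorem Tame.avg_Y (hF : Tame V β F) (i j : ℤ) : avg V β (OscChain.Y V i j F) = 0 := by
  have h1 := ((tame_mom (V := V) (β := β) i).mul hF).avg_dR j
  have h2 := ((tame_deriv_potential (V := V) (β := β) j).mul hF).avg_dP i
  have h3 : OscChain.dR j ((fun ω : Config => (ω i).1) * F)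
      = (fun ω : Config => (ω i).1) * OscChain.dR j F := by
    rw [(tame_mom (V := V) (β := β) i).smooth.dR_mul hF.smooth,
      dR_comp_mom (fun x => x), zero_mul, zero_add]
  have h4 : OscChain.dP i ((fun ω : Config => deriv V (ω j).2) * F)
      = (fun ω : Config => deriv V (ω j).2) * OscChain.dP i F := by
    rw [(tame_deriv_potential (V := V) (β := β) j).smooth.dP_mul hF.smooth,
      dP_comp_dist, zero_mul, zero_add]
  rw [h3] at h1
  rw [h4] at h2
  rw [Y_eq, ((allLp_mom i).mul (hF.dR j)).avg_sub ((allLp_deriv_potential j).mul (hF.dP i)),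
    h1, h2, sub_eq_zero]
  congr 2
  funext ω
  simp only [Pi.mul_apply]
  ring

theorem Tame.avg_mul_Y (hF : Tame V β F) (hG : Tame V β G) (i j : ℤ) :
    avg V β (F * OscChain.Y V i j G) = -avg V β (OscChain.Y V i j F * G) := by
  have h := (hF.mul hG).avg_Y i j
  rw [Y_mul hF.smooth hG.smooth, ((hF.Y i j).mul hG.allLp).avg_add (hF.allLp.mul (hG.Y i j))] at h
  linarith

theorem AllLp.abs_avg_mul_le (hF : AllLp V β F) (hG : AllLp V β G) :
    |avg V β (F * G)| ≤ √(avg V β (F * F)) * √(avg V β (G * G)) := by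
  have hnn : ∀ H : Config → ℝ, 0 ≤ avg V β (H * H) := fun H =>
    integral_nonneg fun ω => mul_self_nonneg (H ω)
  have hdisc : discrim (avg V β (G * G)) (2 * avg V β (F * G)) (avg V β (F * F)) ≤ 0 := by
    refine discrim_le_zero fun t => ?_
    have h1 : (t • G + F) * (t • G + F)
        = (t * t) • (G * G) + (2 * t) • (F * G) + F * F := by
      funext ω
      simp
      ring
    have h2 := hnn (t • G + F)
    rw [h1, (((hG.mul hG).smul _).add ((hF.mul hG).smul _)).avg_add (hF.mul hF),
      ((hG.mul hG).smul _).avg_add ((hF.mul hG).smul _), avg_smul, avg_smul] at h2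
    linarith
  rw [discrim] at hdisc
  rw [← Real.sqrt_mul (hnn F)]
  refine Real.abs_le_sqrt ?_
  linarith

theorem avg_mul_self_nonneg (F : Config → ℝ) : 0 ≤ avg V β (F * F) :=
  integral_nonneg fun ω => mul_self_nonneg (F ω)

end Tame


section Sector

variable {V : ℝ → ℝ} {β : ℝ} [hV : Fact (IsPotential V)] [hβ : Fact (0 < β)] {F G : Config → ℝ}

theorem abs_le_of_odd (hG : IsSmoothLocal G) {i : ℤ} {M : ℝ} (hM : ∀ ω, |dP i G ω| ≤ M)
    (hodd : ∀ ω, G (flip {i} ω) = -G ω) (ω : Config) : |G ω| ≤ M * |(ω i).1| := by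
  set ω₀ := Function.update ω i (0, (ω i).2)
  have h0 : G ω₀ = 0 := by
    have h1 : flip {i} ω₀ = ω₀ := by
      rw [flip_update]
      simp only [ω₀, Set.mem_singleton_iff, if_true, neg_zero]
      funext k
      by_cases hk : k = i
      · subst hk
        simp
      · simp [flip, hk]
    have h2 := hodd ω₀
    rw [h1] at h2
    linarith
  have hbd : ∀ t : ℝ, ‖deriv (fun t : ℝ => G (Function.update ω i (t, (ω i).2))) t‖ ≤ M := by
    intro t
    have := hM (Function.update ω i (t, (ω i).2))
    simpa [dP] using this
  have := Convex.norm_image_sub_le_of_norm_deriv_le (𝕜 := ℝ)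
    (f := fun t : ℝ => G (Function.update ω i (t, (ω i).2))) (s := Set.univ)
    (x := 0) (y := (ω i).1) (fun x _ => hG.differentiable_fst i ω _ x) (fun x _ => hbd x)
    convex_univ trivial trivial
  simp only [Function.update_eq_self, Prod.mk.eta] at this
  change ‖G ω - G ω₀‖ ≤ _ at this
  simpa [h0] using this

/-- The smooth approximation `p / (p² + ε)` of `1 / p`. -/
noncomputable def regInv (ε p : ℝ) : ℝ := p / (p ^ 2 + ε)

theorem contDiff_regInv {ε : ℝ} (hε : 0 < ε) :
    ContDiff ℝ ((⊤ : ℕ∞) : WithTop ℕ∞) (regInv ε) := by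
  unfold regInv
  exact contDiff_id.div (by fun_prop) fun p => by positivity

theorem deriv_regInv {ε : ℝ} (hε : 0 < ε) (p : ℝ) :
    deriv (regInv ε) p = ε / (p ^ 2 + ε) ^ 2 - regInv ε p ^ 2 := by
  have hp : p ^ 2 + ε ≠ 0 := by positivity
  have h := (hasDerivAt_id p).div (((hasDerivAt_id p).pow 2).add_const ε) hp
  have h2 : deriv (regInv ε) p = _ := h.deriv
  rw [h2, regInv]
  simp
  field_simp
  ring

theorem tame_regInv {ε : ℝ} (hε : 0 < ε) (i : ℤ) : Tame V β fun ω => regInv ε (ω i).1 := by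
  have hle : ∀ p : ℝ, |regInv ε p| ≤ ε⁻¹ * |p| := fun p => by
    rw [regInv, abs_div, abs_of_pos (show 0 < p ^ 2 + ε by positivity), div_eq_inv_mul]
    gcongr
    linarith [sq_nonneg p]
  refine Tame.comp_mom (contDiff_regInv hε) ?_ ?_
  · refine ((allLp_mom i).smul ε⁻¹).mono
      ((contDiff_regInv hε).continuous.measurable.comp (by fun_prop)) fun ω => ?_
    refine (hle _).trans_eq ?_
    simp [abs_mul, abs_of_pos hε]
  · refine AllLp.of_bounded ((contDiff_infty_iff_deriv.1
      (contDiff_regInv hε)).2.continuous.measurable.comp (by fun_prop)) (M := ε⁻¹) fun ω => ?_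
    set p := (ω i).1
    have hp : 0 < p ^ 2 + ε := by positivity
    rw [deriv_regInv hε, regInv, div_pow, ← sub_div, abs_div, abs_of_pos (pow_pos hp 2),
      div_le_iff₀ (pow_pos hp 2)]
    have h1 : |ε - p ^ 2| ≤ p ^ 2 + ε := by
      rw [abs_le]
      constructor <;> linarith [sq_nonneg p]
    have h2 : p ^ 2 + ε ≤ ε⁻¹ * (p ^ 2 + ε) ^ 2 := by
      rw [inv_mul_eq_div, le_div_iff₀ hε, pow_two (p ^ 2 + ε)]
      gcongr
      linarith [sq_nonneg p]
    exact h1.trans h2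

theorem Y_mul_regInv_pointwise {ε : ℝ} (hε : 0 < ε) (hG : Tame V β G) (i j : ℤ) (ω : Config) :
    Y V i j ((fun ω : Config => deriv V (ω j).2) * (G * G) * fun ω : Config => regInv ε (ω i).1) ω
      = deriv (deriv V) (ω j).2 * ((ω i).1 * regInv ε (ω i).1) * G ω ^ 2
        + 2 * (deriv V (ω j).2 * G ω * regInv ε (ω i).1) * Y V i j G ω
        - deriv V (ω j).2 ^ 2 * G ω ^ 2 *
          (ε / ((ω i).1 ^ 2 + ε) ^ 2 - regInv ε (ω i).1 ^ 2) := by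
  have s1 := (tame_deriv_potential (V := V) (β := β) j).smooth
  have s2 := (tame_regInv (V := V) (β := β) hε i).smooth
  have s3 := hG.smooth
  rw [Y_mul (s1.mul (s3.mul s3)) s2, Y_mul s1 (s3.mul s3), Y_mul s3 s3]
  simp only [Pi.add_apply, Pi.mul_apply]
  have h1 : Y V i j (fun ω : Config => deriv V (ω j).2) ω
      = (ω i).1 * deriv (deriv V) (ω j).2 := by
    rw [Y, dR_comp_dist, dP_comp_dist]
    simp
  have h2 : Y V i j (fun ω : Config => regInv ε (ω i).1) ω
      = -(deriv V (ω j).2 * (ε / ((ω i).1 ^ 2 + ε) ^ 2 - regInv ε (ω i).1 ^ 2)) := by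
    rw [Y, dR_comp_mom, dP_comp_mom]
    simp [deriv_regInv hε]
  rw [h1, h2]
  ring

/-- A Poincaré inequality along the orbits of `Y_{i,j}` for the functions that are odd in `p_i`. -/
theorem poincare_of_odd {δ : ℝ} (hδ0 : 0 < δ) (hδ : ∀ r, δ ≤ deriv (deriv V) r) (hG : Tame V β G)
    {i : ℤ} {M : ℝ} (hM : ∀ ω, |dP i G ω| ≤ M) (hodd : ∀ ω, G (flip {i} ω) = -G ω) (j : ℤ) :
    δ * avg V β (G * G) ≤ avg V β (Y V i j G * Y V i j G) := by
  have hGp := abs_le_of_odd hG.smooth hM hodd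
  have hGp2 : ∀ ω : Config, G ω ^ 2 ≤ M ^ 2 * (ω i).1 ^ 2 := fun ω => by
    rw [← mul_pow, ← sq_abs, ← sq_abs (M * _), abs_mul]
    gcongr
    exact (hGp ω).trans (by gcongr; exact le_abs_self M)
  have hGm := hG.smooth.measurable
  have hVm : Measurable (deriv V) := hV.out.contDiff_deriv.continuous.measurable
  let k : ℝ → Config → ℝ := fun ε ω => δ * ((ω i).1 ^ 2 / ((ω i).1 ^ 2 + ε)) * G ω ^ 2
    - deriv V (ω j).2 ^ 2 * (G ω ^ 2 * (ε / ((ω i).1 ^ 2 + ε) ^ 2))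
  let b : Config → ℝ := fun ω => δ * G ω ^ 2 + M ^ 2 * deriv V (ω j).2 ^ 2
  have hb : AllLp V β b := by
    refine (((hG.allLp.mul hG.allLp).smul δ).add
      (((allLp_deriv_potential j).mul (allLp_deriv_potential j)).smul (M ^ 2))).congr ?_
    funext ω
    simp [b]
    ring
  have hbnn : ∀ ω, 0 ≤ b ω := fun ω => by positivity
  have hkm : ∀ ε, Measurable (k ε) := fun ε => by fun_prop
  have hkb : ∀ ε, 0 < ε → ∀ ω, |k ε ω| ≤ b ω := by
    intro ε hε ω
    set p := (ω i).1
    have hp : 0 < p ^ 2 + ε := by positivity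
    have h1 : p ^ 2 / (p ^ 2 + ε) ≤ 1 := by
      rw [div_le_one hp]
      linarith
    have h2 : G ω ^ 2 * (ε / (p ^ 2 + ε) ^ 2) ≤ M ^ 2 := by
      calc G ω ^ 2 * (ε / (p ^ 2 + ε) ^ 2) ≤ (M ^ 2 * p ^ 2) * (ε / (p ^ 2 + ε) ^ 2) := by
            gcongr
            exact hGp2 ω
        _ = M ^ 2 * ((p ^ 2 * ε) / (p ^ 2 + ε) ^ 2) := by ring
        _ ≤ M ^ 2 * 1 := by
            gcongr
            rw [div_le_one (pow_pos hp 2)]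
            nlinarith [sq_nonneg p, mul_nonneg (sq_nonneg p) hε.le]
        _ = M ^ 2 := mul_one _
    have h3 : δ * (p ^ 2 / (p ^ 2 + ε)) * G ω ^ 2 ≤ δ * G ω ^ 2 := by
      have := mul_le_mul_of_nonneg_left h1 hδ0.le
      rw [mul_one] at this
      gcongr
    have h4 : deriv V (ω j).2 ^ 2 * (G ω ^ 2 * (ε / (p ^ 2 + ε) ^ 2))
        ≤ M ^ 2 * deriv V (ω j).2 ^ 2 := by
      rw [mul_comm]
      gcongr
    have h5 : 0 ≤ δ * (p ^ 2 / (p ^ 2 + ε)) * G ω ^ 2 := by positivity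
    have h6 : 0 ≤ deriv V (ω j).2 ^ 2 * (G ω ^ 2 * (ε / (p ^ 2 + ε) ^ 2)) := by positivity
    rw [abs_le]
    simp only [k, b]
    constructor <;> nlinarith
  have hki : ∀ ε, 0 < ε → AllLp V β (k ε) := fun ε hε =>
    hb.mono (hkm ε) fun ω => (hkb ε hε ω).trans (le_abs_self _)
  have hle : ∀ ε, 0 < ε → avg V β (k ε) ≤ avg V β (Y V i j G * Y V i j G) := by
    intro ε hε
    have hH := ((tame_deriv_potential (V := V) (β := β) j).mul (hG.mul hG)).mul
      (tame_regInv (V := V) (β := β) hε i)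
    have hYY := (hG.Y i j).mul (hG.Y i j)
    have h1 := hYY.avg_add (hH.Y i j)
    rw [hH.avg_Y i j, add_zero] at h1
    rw [← h1]
    refine integral_mono (hki ε hε).integrable (hYY.add (hH.Y i j)).integrable fun ω => ?_
    simp only [Pi.add_apply, Pi.mul_apply]
    rw [Y_mul_regInv_pointwise hε hG]
    set p := (ω i).1
    have h2 : p * regInv ε p = p ^ 2 / (p ^ 2 + ε) := by
      rw [regInv]
      ring
    have h3 : 0 ≤ p ^ 2 / (p ^ 2 + ε) * G ω ^ 2 := by positivity
    have h4 := mul_le_mul_of_nonneg_right (hδ (ω j).2) h3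
    have h5 := sq_nonneg (Y V i j G ω + deriv V (ω j).2 * G ω * regInv ε p)
    simp only [k]
    rw [h2]
    nlinarith
  have hlim : Tendsto (fun n : ℕ => avg V β (k (1 / ((n : ℝ) + 1)))) atTop
      (𝓝 (avg V β (δ • (G * G)))) := by
    refine tendsto_integral_of_dominated_convergence b (fun n => (hkm _).aestronglyMeasurable)
      hb.integrable (fun n => Eventually.of_forall fun ω => hkb _ Nat.one_div_pos_of_nat ω)
      (Eventually.of_forall fun ω => ?_)
    by_cases hp : (ω i).1 = 0
    · have h0 : G ω = 0 := by
        have := hGp ω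
        rw [hp, abs_zero, mul_zero] at this
        exact abs_nonpos_iff.1 this
      simp [k, h0]
    · set p := (ω i).1
      have hp2 : p ^ 2 ≠ 0 := pow_ne_zero 2 hp
      have h0 : Tendsto (fun n : ℕ => 1 / ((n : ℝ) + 1)) atTop (𝓝 0) :=
        tendsto_one_div_add_atTop_nhds_zero_nat
      have h1 : Tendsto (fun n : ℕ => p ^ 2 + 1 / ((n : ℝ) + 1)) atTop (𝓝 (p ^ 2)) := by
        simpa using h0.const_add (p ^ 2)
      have h2 : Tendsto (fun n : ℕ => p ^ 2 / (p ^ 2 + 1 / ((n : ℝ) + 1))) atTop (𝓝 1) := by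
        have := (tendsto_const_nhds (x := p ^ 2)).div h1 hp2
        rwa [div_self hp2] at this
      have h3 : Tendsto (fun n : ℕ => 1 / ((n : ℝ) + 1) / (p ^ 2 + 1 / ((n : ℝ) + 1)) ^ 2) atTop
          (𝓝 0) := by
        have := h0.div (h1.pow 2) (pow_ne_zero 2 hp2)
        rwa [zero_div] at this
      have h4 := ((h2.const_mul δ).mul_const (G ω ^ 2)).sub
        ((h3.const_mul (G ω ^ 2)).const_mul (deriv V (ω j).2 ^ 2))
      have h5 : δ * 1 * G ω ^ 2 - deriv V (ω j).2 ^ 2 * (G ω ^ 2 * 0) = (δ • (G * G)) ω := by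
        simp only [Pi.smul_apply, Pi.mul_apply, smul_eq_mul]
        ring
      rw [h5] at h4
      exact h4
  rw [← avg_smul]
  exact le_of_tendsto' hlim fun n => hle _ Nat.one_div_pos_of_nat

/-- The odd part in `p_i`. -/
noncomputable def oddPart (i : ℤ) (F : Config → ℝ) : Config → ℝ :=
  (1 / 2 : ℝ) • (F - fun ω => F (flip {i} ω))

/-- The even part in `p_i`. -/
noncomputable def evenPart (i : ℤ) (F : Config → ℝ) : Config → ℝ :=
  (1 / 2 : ℝ) • (F + fun ω => F (flip {i} ω))

theorem evenPart_add_oddPart (i : ℤ) (F : Config → ℝ) : evenPart i F + oddPart i F = F := by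
  funext ω
  simp [evenPart, oddPart]
  ring

theorem Tame.oddPart (hF : Tame V β F) (i : ℤ) : Tame V β (oddPart i F) :=
  (hF.sub (hF.comp_flip _)).smul _

theorem Tame.evenPart (hF : Tame V β F) (i : ℤ) : Tame V β (evenPart i F) :=
  (hF.add (hF.comp_flip _)).smul _

theorem Y_evenPart (hF : IsSmoothLocal F) (i j : ℤ) :
    Y V i j (evenPart i F) = oddPart i (Y V i j F) := by
  rw [evenPart, Y_smul, Y_add hF (hF.comp_flip _), Y_comp_flip (Set.mem_singleton i)]
  rfl

theorem Y_oddPart (hF : IsSmoothLocal F) (i j : ℤ) :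
    Y V i j (oddPart i F) = evenPart i (Y V i j F) := by
  rw [oddPart, Y_smul, sub_eq_add_neg, ← neg_one_smul ℝ (fun ω => F (flip {i} ω)),
    Y_add hF ((hF.comp_flip _).smul _), Y_smul, Y_comp_flip (Set.mem_singleton i)]
  funext ω
  simp [evenPart]

theorem avg_oddPart_mul_evenPart (i : ℤ) (F G : Config → ℝ) :
    avg V β (oddPart i F * evenPart i G) = 0 := by
  have h := avg_comp_flip (V := V) (β := β) {i} (oddPart i F * evenPart i G)
  have h2 : (fun ω => (oddPart i F * evenPart i G) (flip {i} ω))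
      = -(oddPart i F * evenPart i G) := by
    funext ω
    simp [oddPart, evenPart, flip_flip]
    ring
  rw [h2, avg_neg] at h
  linarith

theorem avg_mul_self_comp_flip (s : Set ℤ) [DecidablePred (· ∈ s)] (F : Config → ℝ) :
    avg V β ((fun ω => F (flip s ω)) * fun ω => F (flip s ω)) = avg V β (F * F) :=
  avg_comp_flip s (F * F)

theorem avg_mul_self_oddPart_le (hF : AllLp V β F) (i : ℤ) :
    avg V β (oddPart i F * oddPart i F) ≤ avg V β (F * F) := by
  have hf := hF.comp_flip {i}
  have h1 : avg V β ((1 / 2 : ℝ) • (F * F + (fun ω => F (flip {i} ω)) * fun ω => F (flip {i} ω)))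
      = avg V β (F * F) := by
    rw [avg_smul, (hF.mul hF).avg_add (hf.mul hf), avg_mul_self_comp_flip]
    ring
  rw [← h1]
  refine integral_mono (((hF.sub hf).smul _).mul ((hF.sub hf).smul _)).integrable
    (((hF.mul hF).add (hf.mul hf)).smul _).integrable fun ω => ?_
  simp only [oddPart, Pi.mul_apply, Pi.smul_apply, Pi.add_apply, Pi.sub_apply, smul_eq_mul]
  nlinarith [sq_nonneg (F ω + F (flip {i} ω))]

theorem avg_mul_self_evenPart_le (hF : AllLp V β F) (i : ℤ) :
    avg V β (evenPart i F * evenPart i F) ≤ avg V β (F * F) := by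
  have hf := hF.comp_flip {i}
  have h1 : avg V β ((1 / 2 : ℝ) • (F * F + (fun ω => F (flip {i} ω)) * fun ω => F (flip {i} ω)))
      = avg V β (F * F) := by
    rw [avg_smul, (hF.mul hF).avg_add (hf.mul hf), avg_mul_self_comp_flip]
    ring
  rw [← h1]
  refine integral_mono (((hF.add hf).smul _).mul ((hF.add hf).smul _)).integrable
    (((hF.mul hF).add (hf.mul hf)).smul _).integrable fun ω => ?_
  simp only [evenPart, Pi.mul_apply, Pi.smul_apply, Pi.add_apply, smul_eq_mul]
  nlinarith [sq_nonneg (F ω - F (flip {i} ω))]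

theorem sqrt_avg_oddPart_le {δ : ℝ} (hδ0 : 0 < δ) (hδ : ∀ r, δ ≤ deriv (deriv V) r)
    (hG : Tame V β G) {i : ℤ} {M : ℝ} (hM : ∀ ω, |dP i G ω| ≤ M) (j : ℤ) :
    √(avg V β (oddPart i G * oddPart i G))
      ≤ (√δ)⁻¹ * √(avg V β (Y V i j G * Y V i j G)) := by
  have hMo : ∀ ω, |dP i (oddPart i G) ω| ≤ M := by
    intro ω
    have h1 : dP i (oddPart i G) = (1 / 2 : ℝ) • (dP i G + fun ω => dP i G (flip {i} ω)) := by
      rw [oddPart, dP_smul, sub_eq_add_neg, ← neg_one_smul ℝ (fun ω => G (flip {i} ω)),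
        hG.smooth.dP_add ((hG.smooth.comp_flip _).smul _), dP_smul, dP_comp_flip]
      funext ω
      simp
    rw [h1]
    have h2 := abs_add_le (dP i G ω) (dP i G (flip {i} ω))
    have h3 := hM ω
    have h4 := hM (flip {i} ω)
    simp only [Pi.smul_apply, Pi.add_apply, smul_eq_mul, abs_mul]
    rw [abs_of_pos (by norm_num : (0 : ℝ) < 1 / 2)]
    linarith
  have hodd : ∀ ω, oddPart i G (flip {i} ω) = -oddPart i G ω := fun ω => by
    simp [oddPart, flip_flip]
    ring
  have h1 := poincare_of_odd hδ0 hδ (hG.oddPart i) hMo hodd j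
  rw [Y_oddPart hG.smooth] at h1
  have h2 := h1.trans (avg_mul_self_evenPart_le (hG.Y i j) i)
  rw [← Real.sqrt_inv, ← Real.sqrt_mul (by positivity)]
  refine Real.sqrt_le_sqrt ?_
  rw [inv_mul_eq_div, le_div_iff₀ hδ0]
  linarith

/-- The sector condition for a single vector field. -/
theorem abs_avg_Y_mul_le {δ : ℝ} (hδ0 : 0 < δ) (hδ : ∀ r, δ ≤ deriv (deriv V) r)
    (hF : Tame V β F) (hG : Tame V β G) {i : ℤ} (hFM : ∃ M, ∀ ω, |dP i F ω| ≤ M)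
    (hGM : ∃ M, ∀ ω, |dP i G ω| ≤ M) (j : ℤ) :
    |avg V β (Y V i j F * G)| ≤ 2 * (√δ)⁻¹ * √(avg V β (Y V i j F * Y V i j F))
      * √(avg V β (Y V i j G * Y V i j G)) := by
  obtain ⟨M, hM⟩ := hFM
  obtain ⟨M', hM'⟩ := hGM
  have hFo := sqrt_avg_oddPart_le hδ0 hδ hF hM j
  have hGo := sqrt_avg_oddPart_le hδ0 hδ hG hM' j
  have h1 : avg V β (Y V i j F * G) = avg V β (Y V i j F * oddPart i G)
      - avg V β (oddPart i F * Y V i j (evenPart i G)) := by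
    have h2 : avg V β (Y V i j F * G)
        = avg V β (Y V i j F * evenPart i G) + avg V β (Y V i j F * oddPart i G) := by
      rw [← AllLp.avg_add ((hF.Y i j).mul (hG.evenPart i).allLp)
        ((hF.Y i j).mul (hG.oddPart i).allLp), ← mul_add, evenPart_add_oddPart]
    have h3 : avg V β (Y V i j F * evenPart i G)
        = avg V β (Y V i j (evenPart i F) * evenPart i G)
          + avg V β (Y V i j (oddPart i F) * evenPart i G) := by
      rw [← AllLp.avg_add (((hF.evenPart i).Y i j).mul (hG.evenPart i).allLp)
        (((hF.oddPart i).Y i j).mul (hG.evenPart i).allLp), ← add_mul,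
        ← Y_add (hF.evenPart i).smooth (hF.oddPart i).smooth, evenPart_add_oddPart]
    rw [h2, h3, Y_evenPart hF.smooth, avg_oddPart_mul_evenPart,
      (hF.oddPart i).avg_mul_Y (hG.evenPart i)]
    ring
  rw [h1]
  refine (abs_sub _ _).trans ?_
  have h4 := (hF.Y i j).abs_avg_mul_le (hG.oddPart i).allLp
  have h5 := (hF.oddPart i).allLp.abs_avg_mul_le ((hG.evenPart i).Y i j)
  have h6 : √(avg V β (Y V i j (evenPart i G) * Y V i j (evenPart i G)))
      ≤ √(avg V β (Y V i j G * Y V i j G)) := by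
    rw [Y_evenPart hG.smooth]
    exact Real.sqrt_le_sqrt (avg_mul_self_oddPart_le (hG.Y i j) i)
  calc _ ≤ √(avg V β (Y V i j F * Y V i j F)) * ((√δ)⁻¹ * √(avg V β (Y V i j G * Y V i j G)))
        + ((√δ)⁻¹ * √(avg V β (Y V i j F * Y V i j F))) * √(avg V β (Y V i j G * Y V i j G)) := by
        refine add_le_add (h4.trans ?_) (h5.trans ?_) <;> gcongr
    _ = _ := by ring

end Sector


section Mild

variable {V : ℝ → ℝ} {β : ℝ} {F G f g : Config → ℝ}

/-- Smooth local functions that are bounded together with their first derivatives. -/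
structure Mild (F : Config → ℝ) : Prop where
  smooth : IsSmoothLocal F
  bdd : ∃ M, ∀ ω, |F ω| ≤ M
  dP : ∀ i, ∃ M, ∀ ω, |dP i F ω| ≤ M
  dR : ∀ i, ∃ M, ∀ ω, |dR i F ω| ≤ M

theorem exists_bound_add {F G : Config → ℝ} (hF : ∃ M, ∀ ω, |F ω| ≤ M)
    (hG : ∃ M, ∀ ω, |G ω| ≤ M) : ∃ M, ∀ ω, |(F + G) ω| ≤ M := by
  obtain ⟨M, hM⟩ := hF
  obtain ⟨M', hM'⟩ := hG
  exact ⟨M + M', fun ω => (abs_add_le _ _).trans (add_le_add (hM ω) (hM' ω))⟩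

theorem exists_bound_smul (c : ℝ) {F : Config → ℝ} (hF : ∃ M, ∀ ω, |F ω| ≤ M) :
    ∃ M, ∀ ω, |(c • F) ω| ≤ M := by
  obtain ⟨M, hM⟩ := hF
  refine ⟨|c| * M, fun ω => ?_⟩
  rw [Pi.smul_apply, smul_eq_mul, abs_mul]
  exact mul_le_mul_of_nonneg_left (hM ω) (abs_nonneg c)

namespace Mild

theorem add (hF : Mild F) (hG : Mild G) : Mild (F + G) where
  smooth := hF.smooth.add hG.smooth
  bdd := exists_bound_add hF.bdd hG.bdd
  dP i := by
    rw [hF.smooth.dP_add hG.smooth]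
    exact exists_bound_add (hF.dP i) (hG.dP i)
  dR i := by
    rw [hF.smooth.dR_add hG.smooth]
    exact exists_bound_add (hF.dR i) (hG.dR i)

theorem smul (c : ℝ) (hF : Mild F) : Mild (c • F) where
  smooth := hF.smooth.smul c
  bdd := exists_bound_smul c hF.bdd
  dP i := by
    rw [dP_smul]
    exact exists_bound_smul c (hF.dP i)
  dR i := by
    rw [dR_smul]
    exact exists_bound_smul c (hF.dR i)

theorem zero : Mild 0 where
  smooth := IsSmoothLocal.const 0
  bdd := ⟨0, by simp⟩
  dP i := by
    rw [dP_zero]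
    exact ⟨0, by simp⟩
  dR i := by
    rw [dR_zero]
    exact ⟨0, by simp⟩

theorem sum {ι : Type*} {s : Finset ι} {F : ι → Config → ℝ} (h : ∀ i ∈ s, Mild (F i)) :
    Mild (∑ i ∈ s, F i) := by
  classical
  induction s using Finset.induction_on with
  | empty => exact zero
  | insert a s ha ih =>
    rw [Finset.sum_insert ha]
    exact (h a (by simp)).add (ih fun i hi => h i (by simp [hi]))

theorem shift (hF : Mild F) (j : ℤ) : Mild (shift j F) where
  smooth := hF.smooth.shift j
  bdd := ⟨hF.bdd.choose, fun _ => hF.bdd.choose_spec _⟩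
  dP i := by
    rw [dP_shift]
    exact ⟨(hF.dP _).choose, fun _ => (hF.dP _).choose_spec _⟩
  dR i := by
    rw [dR_shift]
    exact ⟨(hF.dR _).choose, fun _ => (hF.dR _).choose_spec _⟩

theorem comp_flip (hF : Mild F) (s : Set ℤ) [DecidablePred (· ∈ s)] :
    Mild (fun ω => F (flip s ω)) where
  smooth := hF.smooth.comp_flip s
  bdd := ⟨hF.bdd.choose, fun _ => hF.bdd.choose_spec _⟩
  dP i := by
    rw [dP_comp_flip]
    obtain ⟨M, hM⟩ := hF.dP i
    refine ⟨M, fun ω => ?_⟩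
    rw [abs_mul]
    by_cases h : i ∈ s <;> simpa [h] using hM _
  dR i := by
    rw [dR_comp_flip]
    exact ⟨(hF.dR _).choose, fun _ => (hF.dR _).choose_spec _⟩

theorem tame [Fact (IsPotential V)] [Fact (0 < β)] (hF : Mild F) : Tame V β F :=
  Tame.of_bounded hF.smooth hF.bdd hF.dP hF.dR

theorem exists_dependsOn (hF : Mild F) : ∃ N : ℤ, DependsOn F (Set.Icc (-N) N) := by
  obtain ⟨Λ, φ, -, h⟩ := hF.smooth
  refine ⟨∑ i ∈ Λ, |i|, fun ω ω' hω => ?_⟩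
  rw [h, h]
  congr 1
  funext k
  refine hω k ?_
  rw [Set.mem_Icc, ← abs_le]
  exact Finset.single_le_sum (f := fun i : ℤ => |i|) (fun i _ => abs_nonneg i) k.2

theorem of_compactSupport {ι : Type*} [Fintype ι] {s : ι → ℤ} {φ : (ι → ℝ × ℝ) → ℝ}
    (hφ : ContDiff ℝ ((⊤ : ℕ∞) : WithTop ℕ∞) φ) (hc : HasCompactSupport φ)
    (hF : ∀ ω, F ω = φ fun k => ω (s k)) : Mild F where
  smooth := isSmoothLocal_of_comp s hφ hF
  bdd := by
    obtain ⟨M, hM⟩ := hc.exists_bound_of_continuous hφ.continuous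
    exact ⟨M, fun ω => by rw [hF]; exact hM _⟩
  dP i := by
    obtain ⟨M, hM⟩ := (hc.fderiv_apply (𝕜 := ℝ) _).exists_bound_of_continuous
      ((hφ.continuous_fderiv (by simp)).clm_apply continuous_const)
    exact ⟨M, fun ω => by rw [dP_comp hφ hF]; exact hM _⟩
  dR i := by
    obtain ⟨M, hM⟩ := (hc.fderiv_apply (𝕜 := ℝ) _).exists_bound_of_continuous
      ((hφ.continuous_fderiv (by simp)).clm_apply continuous_const)
    exact ⟨M, fun ω => by rw [dR_comp hφ hF]; exact hM _⟩

end Mild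

theorem mild_of_mem_C (hf : f ∈ C V β) : Mild f := by
  obtain ⟨⟨Λ, φ, hφ, hc, h⟩, -⟩ := hf
  exact Mild.of_compactSupport (s := fun k : Λ => (k : ℤ)) hφ hc h

theorem mild_dP_of_mem_C (hf : f ∈ C V β) (i : ℤ) : Mild (dP i f) := by
  obtain ⟨⟨Λ, φ, hφ, hc, h⟩, -⟩ := hf
  exact Mild.of_compactSupport (s := fun k : Λ => (k : ℤ))
    ((hφ.fderiv_right (m := ((⊤ : ℕ∞) : WithTop ℕ∞)) (by simp)).clm_apply contDiff_const)
    (hc.fderiv_apply (𝕜 := ℝ) _) (dP_comp (s := fun k : Λ => (k : ℤ)) hφ h i)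

theorem mild_dR_of_mem_C (hf : f ∈ C V β) (i : ℤ) : Mild (dR i f) := by
  obtain ⟨⟨Λ, φ, hφ, hc, h⟩, -⟩ := hf
  exact Mild.of_compactSupport (s := fun k : Λ => (k : ℤ))
    ((hφ.fderiv_right (m := ((⊤ : ℕ∞) : WithTop ℕ∞)) (by simp)).clm_apply contDiff_const)
    (hc.fderiv_apply (𝕜 := ℝ) _) (dR_comp (s := fun k : Λ => (k : ℤ)) hφ h i)

theorem tame_Y_of_mem_C [Fact (IsPotential V)] [Fact (0 < β)] (hf : f ∈ C V β) (i j : ℤ) :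
    Tame V β (Y V i j f) := by
  rw [Y_eq]
  exact ((tame_mom i).mul (mild_dR_of_mem_C hf j).tame).sub
    ((tame_deriv_potential j).mul (mild_dP_of_mem_C hf i).tame)

end Mild

section Gamma

variable {V : ℝ → ℝ} {β : ℝ} [hV : Fact (IsPotential V)] [hβ : Fact (0 < β)]
  {F G f g h : Config → ℝ} {N d : ℤ}

theorem shift_shift (j k : ℤ) (F : Config → ℝ) : shift k (shift j F) = shift (j + k) F := by
  funext ω
  simp only [shift, add_assoc]

theorem shift_zero (F : Config → ℝ) : shift 0 F = F := by
  funext ω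
  simp [shift]

theorem shift_mul (j : ℤ) (F G : Config → ℝ) : shift j (F * G) = shift j F * shift j G := rfl

theorem shift_add (j : ℤ) (F G : Config → ℝ) : shift j (F + G) = shift j F + shift j G := rfl

theorem shift_smul (j : ℤ) (c : ℝ) (F : Config → ℝ) : shift j (c • F) = c • shift j F := rfl

theorem shift_sum {ι : Type*} (s : Finset ι) (F : ι → Config → ℝ) (j : ℤ) :
    shift j (∑ i ∈ s, F i) = ∑ i ∈ s, shift j (F i) := by
  funext ω
  simp [shift]

theorem avg_mul_shift (F G : Config → ℝ) (i : ℤ) :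
    avg V β (F * shift i G) = avg V β (shift (-i) F * G) := by
  rw [← avg_shift (-i) (F * shift i G), shift_mul, shift_shift, add_neg_cancel, shift_zero]

theorem avg_shift_mul (F G : Config → ℝ) (i : ℤ) :
    avg V β (shift i F * G) = avg V β (F * shift (-i) G) := by
  rw [avg_mul_shift, neg_neg]

/-- `Y_{0,d} Γ_f`. -/
noncomputable def fieldGamma (V : ℝ → ℝ) (d : ℤ) (f : Config → ℝ) : Config → ℝ :=
  fun ω => ∑ᶠ j : ℤ, Y V 0 d (shift j f) ω

/-- A window of shifts containing all those that contribute to `X_0 Γ_f` and `Y_{0,1} Γ_f`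
when `f` depends on the sites in `[-N, N]`. -/
noncomputable def window (N : ℤ) : Finset ℤ := Finset.Icc (-(N + 1)) (N + 1)

theorem mem_window {j : ℤ} : j ∈ window N ↔ -(N + 1) ≤ j ∧ j ≤ N + 1 := Finset.mem_Icc

theorem Y_eq_zero_of_notMem_window (hf : DependsOn f (Set.Icc (-N) N)) (hd : d = 0 ∨ d = 1) {j : ℤ}
    (hj : j ∉ window N) : Y V j (j + d) f = 0 := by
  rw [mem_window] at hj
  refine Y_of_dependsOn hf ?_ ?_ <;> rw [Set.mem_Icc] <;> omega

theorem Y_shift_eq_zero (hf : DependsOn f (Set.Icc (-N) N)) (hd : d = 0 ∨ d = 1) {j : ℤ}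
    (hj : j ∉ window N) : Y V 0 d (shift j f) = 0 := by
  rw [mem_window] at hj
  rw [Y_shift, Y_of_dependsOn hf]
  · rfl
  all_goals rw [Set.mem_Icc]; omega

theorem fieldGamma_eq_sum (hf : DependsOn f (Set.Icc (-N) N)) (hd : d = 0 ∨ d = 1) :
    fieldGamma V d f = ∑ j ∈ window N, Y V 0 d (shift j f) := by
  funext ω
  rw [fieldGamma, Finset.sum_apply]
  refine finsum_eq_sum_of_support_subset _ fun j hj => ?_
  by_contra h
  exact hj (congrFun (Y_shift_eq_zero hf hd h) ω)

theorem sum_window_neg {M : Type*} [AddCommMonoid M] (c : ℤ → M) :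
    ∑ i ∈ window N, c (-i) = ∑ i ∈ window N, c i :=
  Finset.sum_nbij' (fun i => -i) (fun i => -i) (by simp only [mem_window]; omega)
    (by simp only [mem_window]; omega) (by simp) (by simp) (by simp)

/-- The part of `Γ_f` that contributes to `X_0 Γ_f` and `Y_{0,1} Γ_f`. -/
noncomputable def localGamma (N : ℤ) (f : Config → ℝ) : Config → ℝ := ∑ j ∈ window N, shift j f

theorem Mild.localGamma (hf : Mild f) (N : ℤ) : Mild (localGamma N f) :=
  Mild.sum fun j _ => hf.shift j

theorem fieldGamma_eq_Y (hf : Mild f) (hN : DependsOn f (Set.Icc (-N) N)) (hd : d = 0 ∨ d = 1) :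
    fieldGamma V d f = Y V 0 d (localGamma N f) := by
  rw [fieldGamma_eq_sum hN hd, localGamma, Y_sum fun j _ => (hf.shift j).smooth]

theorem Mild.fieldGamma (hf : Mild f) (hd : d = 0 ∨ d = 1) : AllLp V β (fieldGamma V d f) := by
  obtain ⟨N, hN⟩ := hf.exists_dependsOn
  rw [fieldGamma_eq_Y hf hN hd]
  exact ((hf.localGamma N).tame).Y 0 d

theorem DependsOn_Icc_mono {N' : ℤ} (hf : DependsOn f (Set.Icc (-N) N)) (h : N ≤ N') :
    DependsOn f (Set.Icc (-N') N') := fun _ _ hω =>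
  hf fun i hi => hω i ⟨by linarith [hi.1], hi.2.trans h⟩

theorem fieldGamma_add (hf : Mild f) (hg : Mild g) (hd : d = 0 ∨ d = 1) :
    fieldGamma V d (f + g) = fieldGamma V d f + fieldGamma V d g := by
  obtain ⟨N, hN⟩ := hf.exists_dependsOn
  obtain ⟨N', hN'⟩ := hg.exists_dependsOn
  have h1 := DependsOn_Icc_mono hN (le_max_left N N')
  have h2 := DependsOn_Icc_mono hN' (le_max_right N N')
  have h3 : DependsOn (f + g) (Set.Icc (-(max N N')) (max N N')) := fun _ _ hω => by
    rw [Pi.add_apply, Pi.add_apply, h1 hω, h2 hω]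
  rw [fieldGamma_eq_sum h1 hd, fieldGamma_eq_sum h2 hd, fieldGamma_eq_sum h3 hd,
    ← Finset.sum_add_distrib]
  refine Finset.sum_congr rfl fun j _ => ?_
  rw [shift_add, Y_add (hf.shift j).smooth (hg.shift j).smooth]

theorem fieldGamma_smul (c : ℝ) (hf : Mild f) (hd : d = 0 ∨ d = 1) :
    fieldGamma V d (c • f) = c • fieldGamma V d f := by
  obtain ⟨N, hN⟩ := hf.exists_dependsOn
  have h3 : DependsOn (c • f) (Set.Icc (-N) N) := fun _ _ hω => by
    rw [Pi.smul_apply, Pi.smul_apply, hN hω]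
  rw [fieldGamma_eq_sum hN hd, fieldGamma_eq_sum h3 hd, Finset.smul_sum]
  refine Finset.sum_congr rfl fun j _ => ?_
  rw [shift_smul, Y_smul]

theorem avg_pair_Y (hg : Mild g) (hF : Tame V β F) (k d i : ℤ) :
    avg V β (g * shift i (Y V k (k + d) F))
      = -avg V β (shift k (Y V 0 d (shift (-(i + k)) g)) * F) := by
  rw [avg_mul_shift, (hg.shift (-i)).tame.avg_mul_Y hF, shift_Y, shift_shift, zero_add,
    add_comm d k]
  congr 5
  ring

theorem support_pair_Y (hg : Mild g) (hN : DependsOn g (Set.Icc (-N) N)) (hF : Tame V β F)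
    (hd : d = 0 ∨ d = 1) (k : ℤ) {j : ℤ} (hj : j ∉ window N) :
    avg V β (g * shift (-(j + k)) (Y V k (k + d) F)) = 0 := by
  rw [avg_pair_Y hg hF, show -(-(j + k) + k) = j by ring, Y_shift_eq_zero hN hd hj]
  have : shift k 0 * F = 0 := by
    funext ω
    simp [shift]
  rw [this, avg_zero, neg_zero]

/-- The bijection `j ↦ -(j + k)`. -/
def negAdd (k : ℤ) : ℤ ≃ ℤ := (Equiv.addRight k).trans (Equiv.neg ℤ)

theorem negAdd_apply (k j : ℤ) : negAdd k j = -(j + k) := rfl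

theorem finite_support_pair_Y (hg : Mild g) (hF : Tame V β F) (hd : d = 0 ∨ d = 1) (k : ℤ) :
    (Function.support fun i : ℤ => avg V β (g * shift i (Y V k (k + d) F))).Finite := by
  obtain ⟨N, hN⟩ := hg.exists_dependsOn
  refine ((window N).finite_toSet.image (negAdd k)).subset fun i hi => ?_
  refine ⟨(negAdd k).symm i, ?_, by simp⟩
  by_contra hj
  have := support_pair_Y hg hN hF hd k hj
  rw [← negAdd_apply, Equiv.apply_symm_apply] at this
  exact hi this

theorem pairStar_Y (hg : Mild g) (hF : Tame V β F) (hd : d = 0 ∨ d = 1) (k : ℤ) :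
    pairStar V β g (Y V k (k + d) F) = -avg V β (shift k (fieldGamma V d g) * F) := by
  obtain ⟨N, hN⟩ := hg.exists_dependsOn
  change ∑ᶠ i : ℤ, avg V β (g * shift i (Y V k (k + d) F)) = _
  rw [← finsum_comp_equiv (negAdd k), finsum_eq_sum_of_support_subset (s := window N)]
  · simp only [negAdd_apply, avg_pair_Y hg hF, show ∀ j : ℤ, -(-(j + k) + k) = j by intro j; ring]
    rw [fieldGamma_eq_sum hN hd, shift_sum, Finset.sum_mul, AllLp.avg_sum, Finset.sum_neg_distrib]
    intro j _
    exact (((hg.shift j).tame.Y 0 d).shift k).mul hF.allLp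
  · intro j hj
    by_contra h
    exact hj (support_pair_Y hg hN hF hd k h)

/-- `p_0 V'(r_d)`. -/
noncomputable def flux (V : ℝ → ℝ) (d : ℤ) : Config → ℝ := fun ω => (ω 0).1 * deriv V (ω d).2

theorem tame_flux (d : ℤ) : Tame V β (flux V d) := (tame_mom 0).mul (tame_deriv_potential d)

theorem Y_energy (k l i : ℤ) : Y V k l (energy V i)
    = ((if l = i then 1 else 0) - (if k = i then 1 else 0) : ℝ) • shift k (flux V (l - k)) := by
  have h1 : energy V i = (fun ω : Config => (fun p : ℝ => p ^ 2 / 2) (ω i).1)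
      + fun ω : Config => V (ω i).2 := rfl
  rw [h1, Y_add (IsSmoothLocal.comp_mom (u := fun p : ℝ => p ^ 2 / 2) (by fun_prop) i)
    (IsSmoothLocal.comp_dist hV.out.smooth i)]
  have h2 := dP_comp_mom (fun p : ℝ => p ^ 2 / 2) k i
  have h3 := dR_comp_mom (fun p : ℝ => p ^ 2 / 2) l i
  have h4 : deriv (fun p : ℝ => p ^ 2 / 2) = fun p => p := by
    funext p
    simp
  rw [h4] at h2
  funext ω
  simp only [Y, Pi.add_apply, h2, h3, dP_comp_dist, dR_comp_dist,
    Pi.smul_apply, shift, flux, sub_add_cancel, zero_add, Pi.zero_apply, smul_eq_mul]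
  by_cases hl : l = i <;> by_cases hk : k = i <;> simp [hl, hk, mul_comm]

theorem avg_Y_mul_energy (hF : Tame V β F) (k l i : ℤ) :
    avg V β (Y V k l F * energy V i)
      = -(((if l = i then 1 else 0) - (if k = i then 1 else 0)) *
        avg V β (shift k (flux V (l - k)) * F)) := by
  have h := hF.avg_mul_Y (tame_energy i) k l
  rw [Y_energy, mul_smul_comm, avg_smul, mul_comm F] at h
  linarith

theorem finite_support_moment_Y (hF : Tame V β F) (k l : ℤ) :
    (Function.support fun i : ℤ => (i : ℝ) * avg V β (Y V k l F * energy V i)).Finite := by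
  refine (Set.toFinite {k, l}).subset fun i hi => ?_
  by_contra h
  simp only [Set.mem_insert_iff, Set.mem_singleton_iff, not_or] at h
  refine hi ?_
  simp [avg_Y_mul_energy hF, Ne.symm h.1, Ne.symm h.2]

theorem momentStar_Y (hF : Tame V β F) (k d : ℤ) :
    momentStar V β (Y V k (k + d) F) = -(d * avg V β (shift k (flux V d) * F)) := by
  change ∑ᶠ i : ℤ, (i : ℝ) * avg V β (Y V k (k + d) F * energy V i) = _
  rw [finsum_eq_sum_of_support_subset (s := {k, k + d})]
  · simp only [avg_Y_mul_energy hF, add_sub_cancel_left]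
    by_cases hd : d = 0
    · simp [hd]
    · have h1 : k ≠ k + d := by omega
      rw [Finset.sum_pair h1]
      simp [h1, hd]
      ring
  · intro i hi
    by_contra h
    simp only [Finset.coe_insert, Finset.coe_singleton, Set.mem_insert_iff,
      Set.mem_singleton_iff, not_or] at h
    refine hi ?_
    simp [avg_Y_mul_energy hF, Ne.symm h.1, Ne.symm h.2]

/-- `X_0` (`d = 0`) or `Y_{0,1}` (`d = 1`) applied to `Γ_g + a ∑_i i ℰ_i`. -/
noncomputable def grad (V : ℝ → ℝ) (d : ℤ) (g : Config → ℝ) (a : ℝ) : Config → ℝ :=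
  fieldGamma V d g + (a * d) • flux V d

theorem Mild.grad (hg : Mild g) (hd : d = 0 ∨ d = 1) (a : ℝ) : AllLp V β (grad V d g a) :=
  (hg.fieldGamma hd).add ((tame_flux d).allLp.smul _)

/-- The functional on `Γ_g + a ∑_i i ℰ_i` defined by the local function `h`. -/
noncomputable def ell (V : ℝ → ℝ) (β : ℝ) (h g : Config → ℝ) (a : ℝ) : ℝ :=
  pairStar V β g h + a * momentStar V β h

theorem ell_Y (hg : Mild g) (hF : Tame V β F) (hd : d = 0 ∨ d = 1) (k : ℤ) (a : ℝ) :
    ell V β (Y V k (k + d) F) g a = -avg V β (shift k (grad V d g a) * F) := by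
  rw [ell, pairStar_Y hg hF hd, momentStar_Y hF, grad, shift_add, shift_smul, add_mul,
    smul_mul_assoc, (((hg.fieldGamma hd).shift k).mul hF.allLp).avg_add
      ((((tame_flux d).allLp.shift k).mul hF.allLp).smul _), avg_smul]
  ring

end Gamma


section Currents

variable {V : ℝ → ℝ} {β : ℝ} [hV : Fact (IsPotential V)] [hβ : Fact (0 < β)]
  {F G f g h h' : Config → ℝ} {N d : ℤ} {l l' : (Config → ℝ) → ℝ → ℝ}

theorem Tame.mem_Ctilde (hF : Tame V β F) : F ∈ Ctilde V β :=
  ⟨hF.smooth, hF.allLp.memLp_two, fun i => ⟨(hF.Y i i).memLp_two, (hF.Y i (i + 1)).memLp_two⟩⟩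

theorem add_mem_Ctilde (hF : F ∈ Ctilde V β) (hG : G ∈ Ctilde V β) : F + G ∈ Ctilde V β := by
  refine ⟨hF.1.add hG.1, hF.2.1.add hG.2.1, fun i => ⟨?_, ?_⟩⟩
  · rw [X, Y_add hF.1 hG.1]
    exact (hF.2.2 i).1.add (hG.2.2 i).1
  · rw [Y_add hF.1 hG.1]
    exact (hF.2.2 i).2.add (hG.2.2 i).2

theorem smul_mem_Ctilde (c : ℝ) (hF : F ∈ Ctilde V β) : c • F ∈ Ctilde V β := by
  refine ⟨hF.1.smul c, hF.2.1.const_smul c, fun i => ⟨?_, ?_⟩⟩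
  · rw [X, Y_smul]
    exact (hF.2.2 i).1.const_smul c
  · rw [Y_smul]
    exact (hF.2.2 i).2.const_smul c

theorem mem_C0_iff : h ∈ C0 V β ↔ ∃ (Λ : Finset ℤ) (F G : ℤ → Config → ℝ),
    (∀ i, F i ∈ Ctilde V β ∧ G i ∈ Ctilde V β) ∧ (∀ i, i ∉ Λ → F i = 0 ∧ G i = 0) ∧
    h = ∑ i ∈ Λ, (X V i (F i) + Y V i (i + 1) (G i)) := by
  classical
  constructor
  · rintro ⟨Λ, F, G, hFG, rfl⟩
    refine ⟨Λ, fun i => if i ∈ Λ then F i else 0, fun i => if i ∈ Λ then G i else 0, fun i => ?_,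
      fun i hi => by simp [hi], Finset.sum_congr rfl fun i hi => by simp [hi]⟩
    by_cases hi : i ∈ Λ
    · simpa [hi] using hFG i hi
    · simpa [hi] using Tame.zero.mem_Ctilde
  · rintro ⟨Λ, F, G, hFG, -, rfl⟩
    exact ⟨Λ, F, G, fun i _ => hFG i, rfl⟩

theorem add_mem_C0 (hh : h ∈ C0 V β) (hh' : h' ∈ C0 V β) : h + h' ∈ C0 V β := by
  classical
  obtain ⟨Λ, F, G, hFG, h0, rfl⟩ := mem_C0_iff.1 hh
  obtain ⟨Λ', F', G', hFG', h0', rfl⟩ := mem_C0_iff.1 hh'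
  refine ⟨Λ ∪ Λ', F + F', G + G', fun i _ => ⟨add_mem_Ctilde (hFG i).1 (hFG' i).1,
    add_mem_Ctilde (hFG i).2 (hFG' i).2⟩, ?_⟩
  rw [Finset.sum_subset (Finset.subset_union_left (s₁ := Λ) (s₂ := Λ')),
    Finset.sum_subset (Finset.subset_union_right (s₁ := Λ) (s₂ := Λ')), ← Finset.sum_add_distrib]
  · refine Finset.sum_congr rfl fun i _ => ?_
    rw [Pi.add_apply, Pi.add_apply, X, X, X, Y_add (hFG i).1.1 (hFG' i).1.1,
      Y_add (hFG i).2.1 (hFG' i).2.1]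
    abel
  · intro i _ hi
    rw [(h0' i hi).1, (h0' i hi).2, X, Y_zero, Y_zero, add_zero]
  · intro i _ hi
    rw [(h0 i hi).1, (h0 i hi).2, X, Y_zero, Y_zero, add_zero]

theorem smul_mem_C0 (c : ℝ) (hh : h ∈ C0 V β) : c • h ∈ C0 V β := by
  obtain ⟨Λ, F, G, hFG, rfl⟩ := hh
  refine ⟨Λ, fun i => c • F i, fun i => c • G i, fun i hi => ⟨smul_mem_Ctilde c (hFG i hi).1,
    smul_mem_Ctilde c (hFG i hi).2⟩, ?_⟩
  rw [Finset.smul_sum]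
  refine Finset.sum_congr rfl fun i _ => ?_
  rw [X, X, Y_smul, Y_smul, smul_add]

theorem Y_mem_C0 (hF : Tame V β F) (hd : d = 0 ∨ d = 1) (k : ℤ) : Y V k (k + d) F ∈ C0 V β := by
  rcases hd with rfl | rfl
  · refine ⟨{k}, fun _ => F, fun _ => 0, fun _ _ => ⟨hF.mem_Ctilde, Tame.zero.mem_Ctilde⟩, ?_⟩
    rw [Finset.sum_singleton, Y_zero, add_zero, X, add_zero]
  · refine ⟨{k}, fun _ => 0, fun _ => F, fun _ _ => ⟨Tame.zero.mem_Ctilde, hF.mem_Ctilde⟩, ?_⟩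
    rw [Finset.sum_singleton, X, Y_zero, zero_add]

/-- `h` is an element of `𝒞_0` that defines the functional `l` on the functions `g` and the
parameters `a`; the sums that define it have finitely many terms. -/
structure IsCurrent (V : ℝ → ℝ) (β : ℝ) (h : Config → ℝ) (l : (Config → ℝ) → ℝ → ℝ) : Prop where
  mem_C0 : h ∈ C0 V β
  allLp : AllLp V β h
  finite_pair : ∀ g, Mild g → (Function.support fun i : ℤ => avg V β (g * shift i h)).Finite
  finite_moment : (Function.support fun i : ℤ => (i : ℝ) * avg V β (h * energy V i)).Finite
  eq : ∀ g, Mild g → avg V β g = 0 → ∀ a, ell V β h g a = l g a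

theorem pairStar_eq_finsum (g h : Config → ℝ) :
    pairStar V β g h = ∑ᶠ i : ℤ, avg V β (g * shift i h) := rfl

theorem momentStar_eq_finsum (h : Config → ℝ) :
    momentStar V β h = ∑ᶠ i : ℤ, (i : ℝ) * avg V β (h * energy V i) := rfl

namespace IsCurrent

theorem congr (hh : IsCurrent V β h l)
    (hl : ∀ g, Mild g → avg V β g = 0 → ∀ a, l g a = l' g a) : IsCurrent V β h l' :=
  { hh with eq := fun g hg h0 a => (hh.eq g hg h0 a).trans (hl g hg h0 a) }

theorem Y (hF : Tame V β F) (hd : d = 0 ∨ d = 1) (k : ℤ) :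
    IsCurrent V β (Y V k (k + d) F) fun g a => -avg V β (shift k (grad V d g a) * F) where
  mem_C0 := Y_mem_C0 hF hd k
  allLp := hF.Y _ _
  finite_pair _ hg := finite_support_pair_Y hg hF hd k
  finite_moment := finite_support_moment_Y hF k (k + d)
  eq _ hg _ a := ell_Y hg hF hd k a

theorem add (hh : IsCurrent V β h l) (hh' : IsCurrent V β h' l') :
    IsCurrent V β (h + h') fun g a => l g a + l' g a := by
  have h1 : ∀ g, Mild g → ∀ i : ℤ, avg V β (g * shift i (h + h'))
      = avg V β (g * shift i h) + avg V β (g * shift i h') := fun g hg i => by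
    have := hg.tame (V := V) (β := β)
    rw [shift_add, mul_add, (this.allLp.mul (hh.allLp.shift i)).avg_add
      (this.allLp.mul (hh'.allLp.shift i))]
  have h2 : ∀ i : ℤ, (i : ℝ) * avg V β ((h + h') * energy V i)
      = i * avg V β (h * energy V i) + i * avg V β (h' * energy V i) := fun i => by
    rw [add_mul, (hh.allLp.mul (tame_energy i).allLp).avg_add
      (hh'.allLp.mul (tame_energy i).allLp), mul_add]
  refine ⟨add_mem_C0 hh.mem_C0 hh'.mem_C0, hh.allLp.add hh'.allLp, fun g hg => ?_, ?_,
    fun g hg h0 a => ?_⟩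
  · simp only [h1 g hg]
    exact ((hh.finite_pair g hg).union (hh'.finite_pair g hg)).subset (Function.support_add _ _)
  · simp only [h2]
    exact (hh.finite_moment.union hh'.finite_moment).subset (Function.support_add _ _)
  · rw [← hh.eq g hg h0 a, ← hh'.eq g hg h0 a]
    simp only [ell, pairStar_eq_finsum, momentStar_eq_finsum, h1 g hg, h2]
    rw [finsum_add_distrib (hh.finite_pair g hg) (hh'.finite_pair g hg),
      finsum_add_distrib hh.finite_moment hh'.finite_moment]
    ring

theorem smul (c : ℝ) (hh : IsCurrent V β h l) : IsCurrent V β (c • h) fun g a => c * l g a := by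
  have h1 : ∀ (g : Config → ℝ) (i : ℤ), avg V β (g * shift i (c • h))
      = c * avg V β (g * shift i h) := fun g i => by
    rw [shift_smul, mul_smul_comm, avg_smul]
  have h2 : ∀ i : ℤ, (i : ℝ) * avg V β ((c • h) * energy V i)
      = c * (i * avg V β (h * energy V i)) := fun i => by
    rw [smul_mul_assoc, avg_smul]
    ring
  refine ⟨smul_mem_C0 c hh.mem_C0, hh.allLp.smul c, fun g hg => ?_, ?_, fun g hg h0 a => ?_⟩
  · simp only [h1 g]
    exact (hh.finite_pair g hg).subset (Function.support_mul_subset_right _ _)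
  · simp only [h2]
    exact hh.finite_moment.subset (Function.support_mul_subset_right _ _)
  · rw [← hh.eq g hg h0 a]
    simp only [ell, pairStar_eq_finsum, momentStar_eq_finsum, h1 g, h2]
    rw [← mul_finsum' _ _ (hh.finite_pair g hg), ← mul_finsum' _ _ hh.finite_moment]
    ring

theorem sub (hh : IsCurrent V β h l) (hh' : IsCurrent V β h' l') :
    IsCurrent V β (h - h') fun g a => l g a - l' g a := by
  have := hh.add (hh'.smul (-1))
  rw [neg_one_smul, ← sub_eq_add_neg] at this
  exact this.congr fun g _ _ a => by ring

theorem zero : IsCurrent V β 0 fun _ _ => 0 := by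
  have := (IsCurrent.Y (V := V) (β := β) Tame.zero (Or.inl rfl) 0).smul 0
  rw [zero_smul] at this
  exact this.congr fun g _ _ a => by ring

theorem sum {ι : Type*} {s : Finset ι} {h : ι → Config → ℝ} {l : ι → (Config → ℝ) → ℝ → ℝ}
    (hh : ∀ i ∈ s, IsCurrent V β (h i) (l i)) :
    IsCurrent V β (∑ i ∈ s, h i) fun g a => ∑ i ∈ s, l i g a := by
  classical
  induction s using Finset.induction_on with
  | empty => simpa using zero
  | insert a s ha ih =>
    simp only [Finset.sum_insert ha]
    exact (hh a (by simp)).add (ih fun i hi => hh i (by simp [hi]))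

end IsCurrent

theorem sum_avg_shift_mul (hG : AllLp V β G) (hf : Mild f) :
    ∑ i ∈ window N, avg V β (shift i G * f) = avg V β (G * localGamma N f) := by
  simp only [avg_shift_mul]
  rw [sum_window_neg fun i => avg V β (G * shift i f), localGamma, Finset.mul_sum, AllLp.avg_sum]
  exact fun i _ => hG.mul (hf.shift i).tame.allLp

theorem A_eq_sum (hN : DependsOn f (Set.Icc (-N) N)) :
    A V f = ∑ i ∈ window N, (Y V i (i + 0) f - Y V i (i + 1) f) := by
  funext ω
  rw [A, Finset.sum_apply]
  simp only [add_zero]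
  refine finsum_eq_sum_of_support_subset _ fun i hi => ?_
  by_contra h
  have h0 := Y_eq_zero_of_notMem_window (V := V) hN (Or.inl rfl) h
  have h1 := Y_eq_zero_of_notMem_window (V := V) hN (Or.inr rfl) h
  rw [add_zero] at h0
  refine hi ?_
  simp [X, h0, h1]

theorem isCurrent_A (hf : Mild f) (hN : DependsOn f (Set.Icc (-N) N)) :
    IsCurrent V β (A V f) fun g a =>
      avg V β (grad V 1 g a * localGamma N f) - avg V β (grad V 0 g a * localGamma N f) := by
  rw [A_eq_sum hN]
  refine (IsCurrent.sum fun i _ => (IsCurrent.Y hf.tame (Or.inl rfl) i).sub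
    (IsCurrent.Y hf.tame (Or.inr rfl) i)).congr fun g hg _ a => ?_
  rw [Finset.sum_sub_distrib, Finset.sum_neg_distrib, Finset.sum_neg_distrib,
    sum_avg_shift_mul (hg.grad (Or.inl rfl) a) hf, sum_avg_shift_mul (hg.grad (Or.inr rfl) a) hf]
  ring

theorem S_eq_sum (γ : ℝ) (hN : DependsOn f (Set.Icc (-N) N)) :
    S V γ f = (γ / 2) • ∑ i ∈ window N, (Y V i (i + 0) (Y V i (i + 0) f)
      + Y V i (i + 1) (Y V i (i + 1) f)) := by
  funext ω
  rw [S, Pi.smul_apply, Finset.sum_apply, smul_eq_mul]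
  congr 1
  simp only [add_zero]
  refine finsum_eq_sum_of_support_subset _ fun i hi => ?_
  by_contra h
  have h0 := Y_eq_zero_of_notMem_window (V := V) hN (Or.inl rfl) h
  have h1 := Y_eq_zero_of_notMem_window (V := V) hN (Or.inr rfl) h
  rw [add_zero] at h0
  refine hi ?_
  simp [X, h0, h1, Y_zero]

theorem sum_avg_shift_mul_Y (hG : AllLp V β G) (hf : Mild f) (hN : DependsOn f (Set.Icc (-N) N))
    (hd : d = 0 ∨ d = 1) :
    ∑ i ∈ window N, avg V β (shift i G * Y V i (i + d) f) = avg V β (G * fieldGamma V d f) := by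
  have h1 : ∀ i : ℤ, avg V β (shift i G * Y V i (i + d) f)
      = avg V β (G * Y V 0 d (shift (-i) f)) := fun i => by
    rw [avg_shift_mul, shift_Y]
    congr 3 <;> ring
  simp only [h1]
  rw [sum_window_neg fun i => avg V β (G * Y V 0 d (shift i f)), fieldGamma_eq_sum hN hd,
    Finset.mul_sum, AllLp.avg_sum]
  exact fun i _ => hG.mul ((hf.shift i).tame.Y _ _)

theorem isCurrent_S (γ : ℝ) (hf : f ∈ C V β) :
    IsCurrent V β (S V γ f) fun g a => -(γ / 2 *
      (avg V β (grad V 0 g a * fieldGamma V 0 f) + avg V β (grad V 1 g a * fieldGamma V 1 f))) := by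
  have hm := mild_of_mem_C hf
  obtain ⟨N, hN⟩ := hm.exists_dependsOn
  rw [S_eq_sum γ hN]
  refine ((IsCurrent.sum fun i _ => (IsCurrent.Y (tame_Y_of_mem_C hf i (i + 0)) (Or.inl rfl) i).add
    (IsCurrent.Y (tame_Y_of_mem_C hf i (i + 1)) (Or.inr rfl) i)).smul (γ / 2)).congr
    fun g hg _ a => ?_
  rw [Finset.sum_add_distrib, Finset.sum_neg_distrib, Finset.sum_neg_distrib,
    sum_avg_shift_mul_Y (hg.grad (Or.inl rfl) a) hm hN (Or.inl rfl),
    sum_avg_shift_mul_Y (hg.grad (Or.inr rfl) a) hm hN (Or.inr rfl)]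
  ring

theorem Y_potential : Y V 0 1 (fun ω => V (ω 1).2) = flux V 1 := by
  funext ω
  rw [Y, dR_comp_dist, dP_comp_dist]
  simp [flux]

theorem isCurrent_WA :
    IsCurrent V β (WA V) fun g a => avg V β (grad V 1 g a * fun ω => V (ω 1).2) := by
  have h := (IsCurrent.Y (V := V) (β := β) (tame_potential 1) (Or.inr rfl) 0).smul (-1)
  have h1 : WA V = (-1 : ℝ) • Y V 0 (0 + 1) fun ω => V (ω 1).2 := by
    rw [zero_add, Y_potential]
    funext ω
    simp [WA, flux]
  rw [h1]
  refine h.congr fun g _ _ a => ?_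
  rw [shift_zero]
  ring

theorem Y_flux : Y V 0 1 (flux V 1)
    = fun ω => (ω 0).1 ^ 2 * deriv (deriv V) (ω 1).2 - deriv V (ω 1).2 ^ 2 := by
  have h1 := dR_comp_mom (fun x => x) 1 0
  have h2 := dP_comp_mom (fun x => x) 0 0
  have h3 : flux V 1 = (fun ω : Config => (ω 0).1) * fun ω => deriv V (ω 1).2 := rfl
  rw [h3, Y_mul (IsSmoothLocal.comp_mom (u := fun x => x) contDiff_id 0)
    (IsSmoothLocal.comp_dist hV.out.contDiff_deriv 1)]
  funext ω
  simp only [Pi.add_apply, Pi.mul_apply, Y, h1, h2, dR_comp_dist, dP_comp_dist]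
  simp
  ring

theorem isCurrent_WS (γ : ℝ) :
    IsCurrent V β (WS V γ) fun g a => -(γ / 2 * avg V β (grad V 1 g a * flux V 1)) := by
  have h := (IsCurrent.Y (V := V) (β := β) (tame_flux 1) (Or.inr rfl) 0).smul (γ / 2)
  have h1 : WS V γ = (γ / 2) • Y V 0 (0 + 1) (flux V 1) := by
    rw [zero_add, Y_flux]
    rfl
  rw [h1]
  refine h.congr fun g _ _ a => ?_
  rw [shift_zero]
  ring

/-- `p_i r_j`. -/
noncomputable def momDist (i j : ℤ) : Config → ℝ := fun ω => (ω i).1 * (ω j).2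

theorem tame_momDist (i j : ℤ) : Tame V β (momDist i j) := (tame_mom i).mul (tame_dist j)

theorem Y_momDist (i j : ℤ) : Y V i j (momDist i j)
    = (fun ω => (ω i).1 ^ 2) - fun ω => deriv V (ω j).2 * (ω j).2 := by
  have h1 := dR_comp_mom (fun x => x) j i
  have h2 := dP_comp_mom (fun x => x) i i
  have h3 := dR_comp_dist (fun x => x) j j
  have h4 := dP_comp_dist (fun x => x) i j
  have h5 : momDist i j = (fun ω : Config => (ω i).1) * fun ω => (ω j).2 := rfl
  rw [h5, Y_mul (IsSmoothLocal.comp_mom (u := fun x => x) contDiff_id i)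
    (IsSmoothLocal.comp_dist (u := fun x => x) contDiff_id j)]
  funext ω
  simp only [Pi.add_apply, Pi.mul_apply, Pi.sub_apply, Y, h1, h2, h3, h4]
  simp
  ring

theorem tame_virial (j : ℤ) : Tame V β fun ω => deriv V (ω j).2 * (ω j).2 :=
  (tame_deriv_potential j).mul (tame_dist j)

theorem beta_mul_avg_mul_virial (hG : Tame V β G) (h0 : avg V β G = 0) (j : ℤ) :
    β * avg V β (G * fun ω => deriv V (ω j).2 * (ω j).2)
      = avg V β (dR j G * fun ω => (ω j).2) := by
  have h1 := (hG.mul (tame_dist j)).avg_dR j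
  have h3 := dR_comp_dist (fun x => x) j j
  rw [hG.smooth.dR_mul (tame_dist (V := V) (β := β) j).smooth, h3,
    ((hG.dR j).mul (allLp_dist j)).avg_add (hG.allLp.mul (by simpa using allLp_const 1))] at h1
  have h4 : avg V β (G * fun ω : Config => if j = j then deriv (fun x : ℝ => x) (ω j).2 else 0)
      = 0 := by
    rw [← h0]
    congr 1
    funext ω
    simp
  rw [h4, add_zero] at h1
  rw [h1]
  congr 2
  funext ω
  simp
  ring

theorem beta_mul_avg_virial (j : ℤ) : β * avg V β (fun ω => deriv V (ω j).2 * (ω j).2) = 1 := by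
  have h1 := (tame_dist (V := V) (β := β) j).avg_dR j
  have h3 := dR_comp_dist (fun x => x) j j
  rw [h3] at h1
  rw [← h1]
  simp [avg]

theorem beta_mul_avg_sq_mul_virial (i j : ℤ) :
    β ^ 2 * avg V β (fun ω => (ω i).1 ^ 2 * (deriv V (ω j).2 * (ω j).2)) = 1 := by
  have h1 := ((tame_mom (V := V) (β := β) i).mul (tame_virial j)).avg_dP i
  have h2 := dP_comp_mom (fun x => x) i i
  have h3 := dP_comp_dist (fun x => deriv V x * x) i j
  rw [(tame_mom (V := V) (β := β) i).smooth.dP_mul (tame_virial (V := V) (β := β) j).smooth, h2,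
    h3, mul_zero, add_zero] at h1
  rw [← beta_mul_avg_virial (V := V) (β := β) j, pow_two, mul_assoc]
  congr 1
  have h4 : (fun ω : Config => (ω i).1 ^ 2 * (deriv V (ω j).2 * (ω j).2))
      = fun ω => (ω i).1 * ((fun ω : Config => (ω i).1) *
        fun ω : Config => deriv V (ω j).2 * (ω j).2) ω := by
    funext ω
    simp
    ring
  rw [h4, ← h1]
  congr 1
  funext ω
  simp

theorem avg_localGamma_virial (hg : Mild g) (h0 : avg V β g = 0)
    (hN : DependsOn g (Set.Icc (-N) N)) {j : ℤ} (hj : j = 0 ∨ j = 1) :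
    β * avg V β (localGamma N g * fun ω => deriv V (ω j).2 * (ω j).2)
      = ∑ k ∈ Finset.Icc (-N) N, avg V β (dR k g * fun ω => (ω k).2) := by
  have h1 : ∀ i : ℤ, β * avg V β (shift i g * fun ω => deriv V (ω j).2 * (ω j).2)
      = avg V β (dR (j - i) g * fun ω => (ω (j - i)).2) := fun i => by
    rw [beta_mul_avg_mul_virial (hg.shift i).tame (by rw [avg_shift, h0]), dR_shift, avg_shift_mul]
    congr 2
  rw [localGamma, Finset.sum_mul, AllLp.avg_sum fun i _ =>
    (hg.shift i).tame.allLp.mul (tame_virial j).allLp, Finset.mul_sum]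
  simp only [h1]
  set c : ℤ → ℝ := fun k => avg V β (dR k g * fun ω => (ω k).2)
  have hc : ∀ k, k ∉ Set.Icc (-N) N → c k = 0 := fun k hk => by
    change avg V β (dR k g * fun ω => (ω k).2) = 0
    rw [dR_of_dependsOn hN hk, zero_mul, avg_zero]
  have h2 : ∑ᶠ k, c k = ∑ k ∈ Finset.Icc (-N) N, c k := by
    refine finsum_eq_sum_of_support_subset _ fun k hk => ?_
    by_contra h
    exact hk (hc k (by simpa using h))
  have h3 : ∑ᶠ k, c (Equiv.subLeft j k) = ∑ i ∈ window N, c (j - i) := by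
    refine finsum_eq_sum_of_support_subset _ fun i hi => ?_
    by_contra h
    refine hi (hc _ ?_)
    rw [Finset.mem_coe, mem_window] at h
    simp only [Equiv.subLeft_apply, Set.mem_Icc]
    omega
  rw [← h2, ← finsum_comp_equiv (Equiv.subLeft j), h3]

theorem gradP_eq : gradP = Y V 1 (1 + 0) (momDist 1 1) - Y V 0 (0 + 1) (momDist 0 1) := by
  rw [add_zero, zero_add, Y_momDist, Y_momDist]
  funext ω
  simp [gradP]

theorem avg_flux_mul_momDist : avg V β (flux V 1 * momDist 0 1) = 1 / β ^ 2 := by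
  have hb : β ≠ 0 := hβ.out.ne'
  rw [eq_div_iff (by positivity), mul_comm, ← beta_mul_avg_sq_mul_virial (V := V) (β := β) 0 1]
  congr 2
  funext ω
  simp [flux, momDist]
  ring

theorem isCurrent_gradP : IsCurrent V β gradP fun _ a => 1 / β ^ 2 * a := by
  rw [gradP_eq (V := V)]
  refine ((IsCurrent.Y (tame_momDist 1 1) (Or.inl rfl) 1).sub
    (IsCurrent.Y (tame_momDist 0 1) (Or.inr rfl) 0)).congr fun g hg h0 a => ?_
  obtain ⟨N, hN⟩ := hg.exists_dependsOn
  have hb : β ≠ 0 := hβ.out.ne'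
  have hΓ := (hg.localGamma N).tame (V := V) (β := β)
  have h1 : shift (-1) (momDist 1 1) = momDist 0 0 := by
    funext ω
    simp [shift, momDist]
  have key : ∀ j, j = 0 ∨ j = 1 → avg V β (fieldGamma V j g * momDist 0 j)
      = -avg V β (localGamma N g * fun ω => (ω 0).1 ^ 2)
        + β⁻¹ * ∑ k ∈ Finset.Icc (-N) N, avg V β (dR k g * fun ω => (ω k).2) := fun j hj => by
    have hp : AllLp V β fun ω => (ω 0).1 ^ 2 :=
      ((allLp_mom 0).mul (allLp_mom 0)).congr (by funext ω; simp [pow_two])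
    rw [fieldGamma_eq_Y hg hN hj, ← neg_neg (avg V β (Y V 0 j _ * _)), ← hΓ.avg_mul_Y
      (tame_momDist 0 j), Y_momDist, mul_sub, (hΓ.allLp.mul hp).avg_sub
      (hΓ.allLp.mul (tame_virial j).allLp), ← avg_localGamma_virial hg h0 hN hj]
    field_simp
    ring
  rw [avg_shift_mul, h1, shift_zero, grad, grad, Int.cast_zero, mul_zero, zero_smul, add_zero,
    Int.cast_one, mul_one, add_mul, smul_mul_assoc, ((hg.fieldGamma (Or.inr rfl)).mul
      (tame_momDist 0 1).allLp).avg_add (((tame_flux 1).allLp.mul (tame_momDist 0 1).allLp).smul a),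
    avg_smul, key 0 (Or.inl rfl), key 1 (Or.inr rfl),
    avg_flux_mul_momDist]
  ring

end Currents


section Forms

variable {V : ℝ → ℝ} {β : ℝ} [hV : Fact (IsPotential V)] [hβ : Fact (0 < β)]
  {F G f g h : Config → ℝ} {N d : ℤ}

/-- The space of bounded smooth local functions with bounded derivatives and mean zero. -/
noncomputable def mildZero (V : ℝ → ℝ) (β : ℝ) [Fact (IsPotential V)] [Fact (0 < β)] :
    Submodule ℝ (Config → ℝ) where
  carrier := {f | Mild f ∧ avg V β f = 0}
  add_mem' hf hg := ⟨hf.1.add hg.1, by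
    rw [hf.1.tame.allLp.avg_add hg.1.tame.allLp, hf.2, hg.2, add_zero]⟩
  zero_mem' := ⟨Mild.zero, avg_zero⟩
  smul_mem' c _ hf := ⟨hf.1.smul c, by rw [avg_smul, hf.2, mul_zero]⟩

theorem mem_mildZero_of_mem_C (hf : f ∈ C V β) : f ∈ mildZero V β := ⟨mild_of_mem_C hf, hf.2⟩

theorem mild_coe (f : mildZero V β) : Mild (f : Config → ℝ) := f.2.1

theorem grad_add (hf : Mild f) (hg : Mild g) (hd : d = 0 ∨ d = 1) (a b : ℝ) :
    grad V d (f + g) (a + b) = grad V d f a + grad V d g b := by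
  rw [grad, grad, grad, fieldGamma_add hf hg hd, add_mul, add_smul]
  abel

theorem grad_smul (hf : Mild f) (hd : d = 0 ∨ d = 1) (c a : ℝ) :
    grad V d (c • f) (c * a) = c • grad V d f a := by
  rw [grad, grad, fieldGamma_smul c hf hd, mul_assoc, mul_smul, smul_add]

/-- The gradient of an element of `mildZero × ℝ`. -/
noncomputable def gradOf (d : ℤ) (u : mildZero V β × ℝ) : Config → ℝ := grad V d u.1 u.2

theorem gradOf_add (hd : d = 0 ∨ d = 1) (u v : mildZero V β × ℝ) :
    gradOf d (u + v) = gradOf d u + gradOf d v :=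
  grad_add (mild_coe u.1) (mild_coe v.1) hd _ _

theorem gradOf_smul (hd : d = 0 ∨ d = 1) (c : ℝ) (u : mildZero V β × ℝ) :
    gradOf d (c • u) = c • gradOf d u :=
  grad_smul (mild_coe u.1) hd _ _

theorem allLp_gradOf (hd : d = 0 ∨ d = 1) (u : mildZero V β × ℝ) : AllLp V β (gradOf d u) :=
  (mild_coe u.1).grad hd _

theorem avg_gradOf_add_mul (hd : d = 0 ∨ d = 1) (u v : mildZero V β × ℝ) (hG : AllLp V β G) :
    avg V β (gradOf d (u + v) * G) = avg V β (gradOf d u * G) + avg V β (gradOf d v * G) := by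
  rw [gradOf_add hd, add_mul, ((allLp_gradOf hd u).mul hG).avg_add ((allLp_gradOf hd v).mul hG)]

theorem avg_gradOf_smul_mul (hd : d = 0 ∨ d = 1) (c : ℝ) (u : mildZero V β × ℝ)
    (G : Config → ℝ) : avg V β (gradOf d (c • u) * G) = c * avg V β (gradOf d u * G) := by
  rw [gradOf_smul hd, smul_mul_assoc, avg_smul]

/-- A form that is linear in its first argument, and symmetric or antisymmetric, is bilinear. -/
noncomputable def bilinOfSymm {E : Type*} [AddCommGroup E] [Module ℝ E] (b : E → E → ℝ) (s : ℝ)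
    (hadd : ∀ u v w, b (u + v) w = b u w + b v w) (hsmul : ∀ (c : ℝ) u w, b (c • u) w = c * b u w)
    (hs : ∀ u v, b u v = s * b v u) : E →ₗ[ℝ] E →ₗ[ℝ] ℝ :=
  LinearMap.mk₂ ℝ b hadd hsmul
    (fun u v w => by rw [hs u, hadd, hs u v, hs u w, mul_add])
    (fun c u v => by rw [hs u, hsmul, hs u v, smul_eq_mul]; ring)

/-- The Dirichlet form. -/
noncomputable def dirichlet (V : ℝ → ℝ) (β γ : ℝ) [Fact (IsPotential V)] [Fact (0 < β)] :
    (mildZero V β × ℝ) →ₗ[ℝ] (mildZero V β × ℝ) →ₗ[ℝ] ℝ :=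
  bilinOfSymm (fun u v => γ / 2 *
      (avg V β (gradOf 0 u * gradOf 0 v) + avg V β (gradOf 1 u * gradOf 1 v))) 1
    (fun u v w => by
      rw [avg_gradOf_add_mul (Or.inl rfl) u v (allLp_gradOf (Or.inl rfl) w),
        avg_gradOf_add_mul (Or.inr rfl) u v (allLp_gradOf (Or.inr rfl) w)]
      ring)
    (fun c u w => by
      rw [avg_gradOf_smul_mul (Or.inl rfl), avg_gradOf_smul_mul (Or.inr rfl)]
      ring)
    (fun u v => by rw [one_mul, mul_comm (gradOf 0 u), mul_comm (gradOf 1 u)])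

theorem dirichlet_apply (γ : ℝ) (u v : mildZero V β × ℝ) : dirichlet V β γ u v = γ / 2 *
    (avg V β (gradOf 0 u * gradOf 0 v) + avg V β (gradOf 1 u * gradOf 1 v)) := rfl

/-- The functional of the antisymmetric current associated with an element of `mildZero × ℝ`. -/
noncomputable def antiForm (u v : mildZero V β × ℝ) : ℝ :=
  ell V β (A V v.1 + v.2 • WA V) u.1 u.2

theorem antiForm_eq (u v : mildZero V β × ℝ) (hN : DependsOn (v.1 : Config → ℝ) (Set.Icc (-N) N)) :
    antiForm u v = avg V β (gradOf 1 u * localGamma N v.1) - avg V β (gradOf 0 u * localGamma N v.1)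
      + v.2 * avg V β (gradOf 1 u * fun ω => V (ω 1).2) :=
  ((isCurrent_A (mild_coe v.1) hN).add (isCurrent_WA.smul v.2)).eq _ (mild_coe u.1) u.1.2.2 _

theorem exists_common_dependsOn (hf : Mild f) (hg : Mild g) :
    ∃ N : ℤ, DependsOn f (Set.Icc (-N) N) ∧ DependsOn g (Set.Icc (-N) N) := by
  obtain ⟨N, hN⟩ := hf.exists_dependsOn
  obtain ⟨N', hN'⟩ := hg.exists_dependsOn
  exact ⟨max N N', DependsOn_Icc_mono hN (le_max_left _ _),
    DependsOn_Icc_mono hN' (le_max_right _ _)⟩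

theorem gradOf_zero_eq (u : mildZero V β × ℝ) (hN : DependsOn (u.1 : Config → ℝ) (Set.Icc (-N) N)) :
    gradOf 0 u = Y V 0 0 (localGamma N u.1) := by
  rw [gradOf, grad, fieldGamma_eq_Y (mild_coe u.1) hN (Or.inl rfl), Int.cast_zero, mul_zero,
    zero_smul, add_zero]

theorem gradOf_one_eq (u : mildZero V β × ℝ) (hN : DependsOn (u.1 : Config → ℝ) (Set.Icc (-N) N)) :
    gradOf 1 u = Y V 0 1 (localGamma N u.1 + u.2 • fun ω => V (ω 1).2) := by
  rw [gradOf, grad, fieldGamma_eq_Y (mild_coe u.1) hN (Or.inr rfl), Int.cast_one, mul_one,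
    Y_add ((mild_coe u.1).localGamma N).smooth ((tame_potential (V := V) (β := β) 1).smul _).smooth,
    Y_smul, Y_potential]

theorem antiForm_eq_sub (u v : mildZero V β × ℝ)
    (hN : DependsOn (v.1 : Config → ℝ) (Set.Icc (-N) N)) :
    antiForm u v = avg V β (gradOf 1 u * (localGamma N v.1 + v.2 • fun ω => V (ω 1).2))
      - avg V β (gradOf 0 u * localGamma N v.1) := by
  have h1 := allLp_gradOf (Or.inr rfl) u
  rw [antiForm_eq u v hN, mul_add, mul_smul_comm, (h1.mul
    ((mild_coe v.1).localGamma N).tame.allLp).avg_add ((h1.mul (tame_potential 1).allLp).smul _),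
    avg_smul]
  ring

theorem antiForm_antisymm (u v : mildZero V β × ℝ) : antiForm u v = -antiForm v u := by
  obtain ⟨N, hu, hv⟩ := exists_common_dependsOn (mild_coe u.1) (mild_coe v.1)
  have hΓ : ∀ w : mildZero V β × ℝ, Tame V β (localGamma N w.1) := fun w =>
    ((mild_coe w.1).localGamma N).tame
  have hΓ' : ∀ w : mildZero V β × ℝ, Tame V β (localGamma N w.1 + w.2 • fun ω => V (ω 1).2) :=
    fun w => (hΓ w).add ((tame_potential 1).smul _)
  rw [antiForm_eq_sub u v hv, antiForm_eq_sub v u hu, gradOf_one_eq u hu, gradOf_one_eq v hv,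
    gradOf_zero_eq u hu, gradOf_zero_eq v hv]
  have h1 := (hΓ' v).avg_mul_Y (hΓ' u) 0 1
  have h2 := (hΓ v).avg_mul_Y (hΓ u) 0 0
  rw [mul_comm] at h1 h2
  linarith

theorem antiForm_add_left (u v w : mildZero V β × ℝ) :
    antiForm (u + v) w = antiForm u w + antiForm v w := by
  obtain ⟨N, hN⟩ := (mild_coe w.1).exists_dependsOn
  have hΓ := ((mild_coe w.1).localGamma N).tame (V := V) (β := β)
  rw [antiForm_eq_sub _ w hN, antiForm_eq_sub u w hN, antiForm_eq_sub v w hN,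
    avg_gradOf_add_mul (Or.inl rfl) u v hΓ.allLp,
    avg_gradOf_add_mul (Or.inr rfl) u v (hΓ.add ((tame_potential 1).smul _)).allLp]
  ring

theorem antiForm_smul_left (c : ℝ) (u w : mildZero V β × ℝ) :
    antiForm (c • u) w = c * antiForm u w := by
  obtain ⟨N, hN⟩ := (mild_coe w.1).exists_dependsOn
  rw [antiForm_eq_sub _ w hN, antiForm_eq_sub u w hN, avg_gradOf_smul_mul (Or.inl rfl),
    avg_gradOf_smul_mul (Or.inr rfl)]
  ring

/-- `antiForm` as a bilinear form. -/
noncomputable def antiBilin (V : ℝ → ℝ) (β : ℝ) [Fact (IsPotential V)] [Fact (0 < β)] :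
    (mildZero V β × ℝ) →ₗ[ℝ] (mildZero V β × ℝ) →ₗ[ℝ] ℝ :=
  bilinOfSymm antiForm (-1) antiForm_add_left antiForm_smul_left fun u v => by
    rw [antiForm_antisymm, neg_one_mul]

theorem antiBilin_apply (u v : mildZero V β × ℝ) : antiBilin V β u v = antiForm u v := rfl

theorem sqrt_avg_gradOf_le {γ : ℝ} (hγ : 0 < γ) (hd : d = 0 ∨ d = 1) (u : mildZero V β × ℝ) :
    √(avg V β (gradOf d u * gradOf d u)) ≤ √(2 / γ) * √(dirichlet V β γ u u) := by
  have h0 := avg_mul_self_nonneg (V := V) (β := β) (gradOf 0 u)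
  have h1 := avg_mul_self_nonneg (V := V) (β := β) (gradOf 1 u)
  rw [← Real.sqrt_mul (by positivity), dirichlet_apply]
  refine Real.sqrt_le_sqrt ?_
  have : 2 / γ * (γ / 2 * (avg V β (gradOf 0 u * gradOf 0 u) + avg V β (gradOf 1 u * gradOf 1 u)))
      = avg V β (gradOf 0 u * gradOf 0 u) + avg V β (gradOf 1 u * gradOf 1 u) := by
    field_simp
  rw [this]
  rcases hd with rfl | rfl <;> linarith

theorem abs_avg_gradOf_mul_le {γ : ℝ} (hγ : 0 < γ) (hd : d = 0 ∨ d = 1) (u : mildZero V β × ℝ)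
    (hG : AllLp V β G) : |avg V β (gradOf d u * G)|
      ≤ √(2 / γ) * √(avg V β (G * G)) * √(dirichlet V β γ u u) := by
  refine ((allLp_gradOf hd u).abs_avg_mul_le hG).trans ?_
  rw [mul_right_comm]
  exact mul_le_mul_of_nonneg_right (sqrt_avg_gradOf_le hγ hd u) (Real.sqrt_nonneg _)

theorem abs_antiForm_le {γ : ℝ} (hγ : 0 < γ) (u v : mildZero V β × ℝ)
    (hN : DependsOn (v.1 : Config → ℝ) (Set.Icc (-N) N)) :
    |antiForm u v| ≤ √(2 / γ) * (2 * √(avg V β (localGamma N v.1 * localGamma N v.1))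
      + |v.2| * √(avg V β ((fun ω => V (ω 1).2) * fun ω => V (ω 1).2))) * √(dirichlet V β γ u u) := by
  have hΓ := ((mild_coe v.1).localGamma N).tame (V := V) (β := β)
  have h0 := abs_avg_gradOf_mul_le hγ (Or.inl rfl) u hΓ.allLp
  have h1 := abs_avg_gradOf_mul_le hγ (Or.inr rfl) u hΓ.allLp
  have h2 := mul_le_mul_of_nonneg_left
    (abs_avg_gradOf_mul_le hγ (Or.inr rfl) u (tame_potential (V := V) (β := β) 1).allLp)
    (abs_nonneg v.2)
  rw [← abs_mul] at h2
  rw [antiForm_eq u v hN]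
  refine (abs_add_le _ _).trans ((add_le_add ((abs_sub _ _).trans (add_le_add h1 h0)) h2).trans
    (le_of_eq ?_))
  ring

theorem exists_sector {γ : ℝ} (hγ : 0 < γ) : ∃ M, ∀ f g : mildZero V β,
    |antiForm (f, 0) (g, 0)|
      ≤ M * √(dirichlet V β γ (f, 0) (f, 0)) * √(dirichlet V β γ (g, 0) (g, 0)) := by
  obtain ⟨δ, -, hδ0, -, hδ, -⟩ := hV.out.exists_bounds
  refine ⟨2 * (2 * (√δ)⁻¹ * (√(2 / γ) * √(2 / γ))), fun f g => ?_⟩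
  obtain ⟨N, hf, hg⟩ := exists_common_dependsOn (mild_coe f) (mild_coe g)
  have hΓ : ∀ w : mildZero V β, Mild (localGamma N (w : Config → ℝ)) := fun w =>
    (mild_coe w).localGamma N
  have key : ∀ d, d = 0 ∨ d = 1 → |avg V β (gradOf d (f, 0) * localGamma N (g : Config → ℝ))|
      ≤ 2 * (√δ)⁻¹ * (√(2 / γ) * √(dirichlet V β γ (f, 0) (f, 0)))
        * (√(2 / γ) * √(dirichlet V β γ (g, 0) (g, 0))) := fun d hd => by
    have hY : ∀ w : mildZero V β, DependsOn (w : Config → ℝ) (Set.Icc (-N) N) →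
        gradOf d (w, 0) = Y V 0 d (localGamma N (w : Config → ℝ)) := fun w hw => by
      rw [gradOf, grad, fieldGamma_eq_Y (mild_coe w) hw hd, zero_mul, zero_smul, add_zero]
    have h1 := abs_avg_Y_mul_le hδ0 hδ (hΓ f).tame (hΓ g).tame ((hΓ f).dP 0) ((hΓ g).dP 0) d
      (β := β)
    rw [← hY f hf, ← hY g hg] at h1
    have := sqrt_avg_gradOf_le hγ hd (f, 0)
    have := sqrt_avg_gradOf_le hγ hd (g, 0)
    exact h1.trans (by gcongr)
  rw [antiForm_eq _ _ hg, zero_mul, add_zero]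
  refine (abs_sub _ _).trans ((add_le_add (key 1 (Or.inr rfl)) (key 0 (Or.inl rfl))).trans
    (le_of_eq ?_))
  ring

theorem exists_bound_snd {γ : ℝ} (hγ : 0 < γ) : ∃ M, ∀ u : mildZero V β × ℝ,
    |1 / β ^ 2 * u.2| ≤ M * √(dirichlet V β γ u u) := by
  have h1 := ((IsCurrent.Y (V := V) (β := β) (tame_momDist 1 1) (Or.inl rfl) 1).sub
    (IsCurrent.Y (tame_momDist 0 1) (Or.inr rfl) 0))
  rw [← gradP_eq] at h1
  refine ⟨√(2 / γ) * √(avg V β (shift (-1) (momDist 1 1) * shift (-1) (momDist 1 1)))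
    + √(2 / γ) * √(avg V β (momDist 0 1 * momDist 0 1)), fun u => ?_⟩
  rw [← isCurrent_gradP.eq _ (mild_coe u.1) u.1.2.2 u.2, h1.eq _ (mild_coe u.1) u.1.2.2 u.2,
    avg_shift_mul, shift_zero, add_mul]
  refine (abs_sub _ _).trans ?_
  rw [abs_neg, abs_neg]
  exact add_le_add (abs_avg_gradOf_mul_le hγ (Or.inl rfl) u ((tame_momDist 1 1).shift _).allLp)
    (abs_avg_gradOf_mul_le hγ (Or.inr rfl) u (tame_momDist 0 1).allLp)

end Forms

section Parity

variable {V : ℝ → ℝ} {β : ℝ} [hV : Fact (IsPotential V)] [hβ : Fact (0 < β)]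
  {F G f g h : Config → ℝ} {N d : ℤ}

/-- `F` is even (`s = 1`) or odd (`s = -1`) under the reversal of all momenta. -/
def HasParity (s : ℝ) (F : Config → ℝ) : Prop :=
  ∀ ω : Config, F (fun i => (-(ω i).1, (ω i).2)) = s * F ω

theorem flip_univ [DecidablePred (· ∈ (Set.univ : Set ℤ))] (ω : Config) :
    flip Set.univ ω = fun i => (-(ω i).1, (ω i).2) := by
  funext i
  simp [flip]

theorem avg_eq_zero_of_odd (hF : HasParity (-1) F) : avg V β F = 0 := by
  classical
  have h1 := avg_comp_flip (V := V) (β := β) Set.univ F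
  have h2 : (fun ω => F (flip Set.univ ω)) = -F := by
    funext ω
    rw [flip_univ, hF, neg_one_mul, Pi.neg_apply]
  rw [h2, avg_neg] at h1
  linarith

theorem HasParity.mul {s t : ℝ} (hF : HasParity s F) (hG : HasParity t G) :
    HasParity (s * t) (F * G) := fun ω => by
  rw [Pi.mul_apply, Pi.mul_apply, hF, hG]
  ring

theorem HasParity.add {s : ℝ} (hF : HasParity s F) (hG : HasParity s G) :
    HasParity s (F + G) := fun ω => by
  rw [Pi.add_apply, Pi.add_apply, hF, hG]
  ring

theorem HasParity.smul {s : ℝ} (c : ℝ) (hF : HasParity s F) : HasParity s (c • F) := fun ω => by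
  rw [Pi.smul_apply, Pi.smul_apply, hF, smul_eq_mul, smul_eq_mul]
  ring

theorem HasParity.sum {ι : Type*} {t : Finset ι} {F : ι → Config → ℝ} {s : ℝ}
    (h : ∀ i ∈ t, HasParity s (F i)) : HasParity s (∑ i ∈ t, F i) := fun ω => by
  rw [Finset.sum_apply, Finset.sum_apply, Finset.mul_sum]
  exact Finset.sum_congr rfl fun i hi => h i hi ω

theorem HasParity.shift {s : ℝ} (hF : HasParity s F) (j : ℤ) : HasParity s (shift j F) :=
  fun ω => hF fun i => ω (i + j)

theorem HasParity.localGamma {s : ℝ} (hF : HasParity s F) (N : ℤ) :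
    HasParity s (localGamma N F) :=
  HasParity.sum fun j _ => hF.shift j

theorem HasParity.Y {s : ℝ} (hF : HasParity s F) (i j : ℤ) : HasParity (-s) (Y V i j F) := by
  classical
  have h1 : (fun ω => F (flip Set.univ ω)) = s • F := by
    funext ω
    rw [flip_univ, hF]
    rfl
  have h2 := Y_comp_flip (V := V) (Set.mem_univ i) j F
  rw [h1, Y_smul] at h2
  intro ω
  have := congrFun h2 ω
  rw [flip_univ] at this
  rw [Pi.smul_apply, smul_eq_mul] at this
  linarith

theorem hasParity_flux (d : ℤ) : HasParity (-1) (flux V d) := fun ω => by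
  simp [flux]

theorem hasParity_gradOf {s : ℝ} {u : mildZero V β × ℝ} (hd : d = 0 ∨ d = 1)
    (hu : HasParity s (u.1 : Config → ℝ)) (hs : s = 1 ∨ u.2 = 0) : HasParity (-s) (gradOf d u) := by
  obtain ⟨N, hN⟩ := (mild_coe u.1).exists_dependsOn
  rw [gradOf, grad, fieldGamma_eq_Y (mild_coe u.1) hN hd]
  refine ((hu.localGamma N).Y 0 d).add ?_
  rcases hs with rfl | h
  · exact (hasParity_flux d).smul _
  · rw [h, zero_mul, zero_smul]
    intro ω
    simp

/-- The elements of `mildZero` of a given parity. -/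
noncomputable def parityPart (V : ℝ → ℝ) (β : ℝ) [Fact (IsPotential V)] [Fact (0 < β)] (s : ℝ) :
    Submodule ℝ (mildZero V β) where
  carrier := {f | HasParity s (f : Config → ℝ)}
  add_mem' hf hg := hf.add hg
  zero_mem' ω := by simp
  smul_mem' c _ hf := hf.smul c

theorem exists_parity_decomposition (f : mildZero V β) :
    ∃ e ∈ parityPart V β 1, ∃ o ∈ parityPart V β (-1), f = e + o := by
  classical
  have hm := (mild_coe f).comp_flip Set.univ
  have h0 : (fun ω => (f : Config → ℝ) (flip Set.univ ω)) ∈ mildZero V β :=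
    ⟨hm, by rw [avg_comp_flip, f.2.2]⟩
  refine ⟨(1 / 2 : ℝ) • (f + ⟨_, h0⟩), fun ω => ?_, (1 / 2 : ℝ) • (f - ⟨_, h0⟩), fun ω => ?_, ?_⟩
  · simp [flip_univ]
    ring
  · simp [flip_univ]
    ring
  · module

theorem dirichlet_even_odd (γ : ℝ) {e o : mildZero V β} (he : e ∈ parityPart V β 1)
    (ho : o ∈ parityPart V β (-1)) (a : ℝ) : dirichlet V β γ (e, a) (o, 0) = 0 := by
  have key : ∀ d, d = 0 ∨ d = 1 → avg V β (gradOf d (e, a) * gradOf d (o, 0)) = 0 := fun d hd => by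
    refine avg_eq_zero_of_odd ?_
    have := (hasParity_gradOf (u := (e, a)) hd he (Or.inl rfl)).mul
      (hasParity_gradOf (u := (o, 0)) hd ho (Or.inr rfl))
    norm_num at this
    exact this
  rw [dirichlet_apply, key 0 (Or.inl rfl), key 1 (Or.inr rfl), add_zero, mul_zero]

theorem antiForm_even_even {e e' : mildZero V β} (he : e ∈ parityPart V β 1)
    (he' : e' ∈ parityPart V β 1) (a b : ℝ) : antiForm (e, a) (e', b) = 0 := by
  obtain ⟨N, hN⟩ := (mild_coe e').exists_dependsOn
  have hg : ∀ d, d = 0 ∨ d = 1 → ∀ G, HasParity 1 G → avg V β (gradOf d (e, a) * G) = 0 :=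
    fun d hd G hG => by
      refine avg_eq_zero_of_odd ?_
      have := (hasParity_gradOf (u := (e, a)) hd he (Or.inl rfl)).mul hG
      norm_num at this
      exact this
  rw [antiForm_eq _ _ hN, hg 0 (Or.inl rfl) _ (HasParity.localGamma he' N),
    hg 1 (Or.inr rfl) _ (HasParity.localGamma he' N), hg 1 (Or.inr rfl) _ fun ω => by simp]
  simp

theorem antiForm_odd_odd {o o' : mildZero V β} (ho : o ∈ parityPart V β (-1))
    (ho' : o' ∈ parityPart V β (-1)) : antiForm (o, 0) (o', 0) = 0 := by
  obtain ⟨N, hN⟩ := (mild_coe o').exists_dependsOn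
  have hg : ∀ d, d = 0 ∨ d = 1 → ∀ G, HasParity (-1) G → avg V β (gradOf d (o, 0) * G) = 0 :=
    fun d hd G hG => by
      refine avg_eq_zero_of_odd ?_
      have := (hasParity_gradOf (u := (o, 0)) hd ho (Or.inr rfl)).mul hG
      norm_num at this
      exact this
  rw [antiForm_eq _ _ hN, hg 0 (Or.inl rfl) _ (HasParity.localGamma ho' N),
    hg 1 (Or.inr rfl) _ (HasParity.localGamma ho' N)]
  simp

end Parity


section Cutoff

variable {V : ℝ → ℝ} {β : ℝ} [hV : Fact (IsPotential V)] [hβ : Fact (0 < β)]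
  {F G f g h : Config → ℝ} {N d : ℤ}

theorem dP_comp_left {u : ℝ → ℝ} (hu : Differentiable ℝ u) (hF : IsSmoothLocal F) (i : ℤ) :
    dP i (fun ω => u (F ω)) = (fun ω => deriv u (F ω)) * dP i F := by
  funext ω
  have := deriv_comp (h₂ := u) (h := fun t : ℝ => F (Function.update ω i (t, (ω i).2))) (ω i).1
    (hu _) (hF.differentiable_fst i ω (ω i).2 (ω i).1)
  simpa [dP, Function.comp_def] using this

theorem dR_comp_left {u : ℝ → ℝ} (hu : Differentiable ℝ u) (hF : IsSmoothLocal F) (i : ℤ) :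
    dR i (fun ω => u (F ω)) = (fun ω => deriv u (F ω)) * dR i F := by
  funext ω
  have := deriv_comp (h₂ := u) (h := fun t : ℝ => F (Function.update ω i ((ω i).1, t))) (ω i).2
    (hu _) (hF.differentiable_snd i ω (ω i).1 (ω i).2)
  simpa [dR, Function.comp_def] using this

theorem Y_comp_left {u : ℝ → ℝ} (hu : Differentiable ℝ u) (hF : IsSmoothLocal F) (i j : ℤ) :
    Y V i j (fun ω => u (F ω)) = (fun ω => deriv u (F ω)) * Y V i j F := by
  funext ω
  simp only [Y, dP_comp_left hu hF, dR_comp_left hu hF, Pi.mul_apply]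
  ring

/-- `∑ (p_i² + r_i²)` over the sites of `Λ`. -/
noncomputable def radiusSq (Λ : Finset ℤ) : Config → ℝ :=
  ∑ i ∈ Λ, ((fun ω : Config => (ω i).1) * (fun ω => (ω i).1)
    + (fun ω => (ω i).2) * fun ω => (ω i).2)

theorem tame_radiusSq (Λ : Finset ℤ) : Tame V β (radiusSq Λ) :=
  Tame.sum fun i _ => ((tame_mom i).mul (tame_mom i)).add ((tame_dist i).mul (tame_dist i))

theorem radiusSq_apply (Λ : Finset ℤ) (ω : Config) :
    radiusSq Λ ω = ∑ k : Λ, ((ω k).1 * (ω k).1 + (ω k).2 * (ω k).2) := by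
  rw [radiusSq, Finset.sum_apply]
  exact (Finset.sum_coe_sort Λ fun i => (ω i).1 * (ω i).1 + (ω i).2 * (ω i).2).symm

theorem radiusSq_nonneg (Λ : Finset ℤ) (ω : Config) : 0 ≤ radiusSq Λ ω := by
  rw [radiusSq_apply]
  exact Finset.sum_nonneg fun k _ => add_nonneg (mul_self_nonneg _) (mul_self_nonneg _)

/-- A smooth bump on the line. -/
noncomputable def lineBump : ContDiffBump (0 : ℝ) := ⟨1, 2, one_pos, one_lt_two⟩

theorem exists_bound_deriv_lineBump : ∃ M, 0 ≤ M ∧ ∀ t, |deriv lineBump t| ≤ M := by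
  have h1 : ContDiff ℝ 1 (lineBump : ℝ → ℝ) := lineBump.contDiff
  obtain ⟨M, hM⟩ := (lineBump.hasCompactSupport.deriv).exists_bound_of_continuous
    (h1.continuous_deriv le_rfl)
  exact ⟨M, (abs_nonneg _).trans (hM 0), hM⟩

/-- The smooth cutoff at radius of order `ε ^ (-1/2)`. -/
noncomputable def cutoff (Λ : Finset ℤ) (ε : ℝ) : Config → ℝ :=
  fun ω => lineBump ((ε • radiusSq Λ) ω)

theorem one_sub_cutoff_le (Λ : Finset ℤ) {ε : ℝ} (hε : 0 < ε) (ω : Config) :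
    |1 - cutoff Λ ε ω| ≤ ε * radiusSq Λ ω := by
  have h0 : 0 ≤ ε * radiusSq Λ ω := mul_nonneg hε.le (radiusSq_nonneg Λ ω)
  have h1 : cutoff Λ ε ω ≤ 1 := lineBump.le_one
  have h2 : 0 ≤ cutoff Λ ε ω := lineBump.nonneg
  by_cases h : ε * radiusSq Λ ω ≤ 1
  · have : cutoff Λ ε ω = 1 := lineBump.one_of_mem_closedBall (by
      rw [mem_closedBall_zero_iff, Pi.smul_apply, smul_eq_mul, Real.norm_eq_abs, abs_of_nonneg h0]
      exact h)
    rw [this, sub_self, abs_zero]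
    exact h0
  · rw [abs_of_nonneg (by linarith)]
    linarith

theorem abs_cutoff_le (Λ : Finset ℤ) (ε : ℝ) (ω : Config) : |cutoff Λ ε ω| ≤ 1 := by
  unfold cutoff
  rw [abs_of_nonneg lineBump.nonneg]
  exact lineBump.le_one

theorem Y_cutoff_le {M : ℝ} (hM : ∀ t, |deriv lineBump t| ≤ M) (Λ : Finset ℤ) {ε : ℝ} (hε : 0 < ε)
    (i j : ℤ) (ω : Config) :
    |Y V i j (cutoff Λ ε) ω| ≤ ε * (M * |Y V i j (radiusSq Λ) ω|) := by
  have hs := (tame_radiusSq (V := V) (β := 1) Λ).smooth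
  have hd : Differentiable ℝ (lineBump : ℝ → ℝ) :=
    (lineBump.contDiff (n := 1)).differentiable (by simp)
  unfold cutoff
  rw [Y_comp_left hd (hs.smul ε), Y_smul, Pi.mul_apply, abs_mul]
  simp only [Pi.smul_apply, smul_eq_mul]
  rw [abs_mul, abs_of_pos hε, mul_left_comm]
  gcongr
  exact hM _

/-- The cutoff as a function of the coordinates in `Λ`. -/
noncomputable def cutoffFn (Λ : Finset ℤ) (ε : ℝ) (x : Λ → ℝ × ℝ) : ℝ :=
  lineBump (ε * ∑ k : Λ, ((x k).1 * (x k).1 + (x k).2 * (x k).2))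

theorem cutoff_eq (Λ : Finset ℤ) (ε : ℝ) (ω : Config) :
    cutoff Λ ε ω = cutoffFn Λ ε (Λ.restrict ω) := by
  rw [cutoff, Pi.smul_apply, radiusSq_apply]
  rfl

theorem contDiff_cutoffFn (Λ : Finset ℤ) (ε : ℝ) :
    ContDiff ℝ ((⊤ : ℕ∞) : WithTop ℕ∞) (cutoffFn Λ ε) := by
  refine lineBump.contDiff.comp ?_
  fun_prop

theorem hasCompactSupport_cutoffFn (Λ : Finset ℤ) {ε : ℝ} (hε : 0 < ε) :
    HasCompactSupport (cutoffFn Λ ε) := by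
  refine HasCompactSupport.intro (isCompact_closedBall 0 (√(2 / ε))) fun x hx => ?_
  rw [mem_closedBall_zero_iff, pi_norm_le_iff_of_nonneg (Real.sqrt_nonneg _)] at hx
  push Not at hx
  obtain ⟨k, hk⟩ := hx
  have h1 : 2 / ε < ‖x k‖ ^ 2 := by
    rw [← Real.sqrt_lt' ((Real.sqrt_nonneg _).trans_lt hk)]
    exact hk
  have h2 : ‖x k‖ ^ 2 ≤ (x k).1 * (x k).1 + (x k).2 * (x k).2 := by
    rw [Prod.norm_def]
    rcases max_choice ‖(x k).1‖ ‖(x k).2‖ with h | h <;> rw [h, Real.norm_eq_abs, sq_abs]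
    · nlinarith [mul_self_nonneg (x k).2]
    · nlinarith [mul_self_nonneg (x k).1]
  have h3 : (x k).1 * (x k).1 + (x k).2 * (x k).2
      ≤ ∑ k : Λ, ((x k).1 * (x k).1 + (x k).2 * (x k).2) :=
    Finset.single_le_sum (f := fun k : Λ => (x k).1 * (x k).1 + (x k).2 * (x k).2)
      (fun k _ => add_nonneg (mul_self_nonneg _) (mul_self_nonneg _)) (Finset.mem_univ k)
  rw [cutoffFn]
  refine lineBump.zero_of_le_dist ?_
  rw [dist_zero_right, Real.norm_eq_abs]
  refine le_trans ?_ (le_abs_self _)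
  have h4 := mul_le_mul_of_nonneg_left (h1.le.trans (h2.trans h3)) hε.le
  rwa [mul_div_cancel₀ _ hε.ne'] at h4

theorem hasParity_cutoff (Λ : Finset ℤ) (ε : ℝ) : HasParity 1 (cutoff Λ ε) := fun ω => by
  rw [cutoff_eq, cutoff_eq, one_mul]
  simp [cutoffFn]

theorem mild_cutoff (Λ : Finset ℤ) {ε : ℝ} (hε : 0 < ε) : Mild (cutoff Λ ε) :=
  Mild.of_compactSupport (s := fun k : Λ => (k : ℤ)) (contDiff_cutoffFn Λ ε)
    (hasCompactSupport_cutoffFn Λ hε) (cutoff_eq Λ ε)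

theorem Mild.exists_finset (hf : Mild f) : ∃ (Λ : Finset ℤ) (φ : (Λ → ℝ × ℝ) → ℝ) (N : ℤ),
    ContDiff ℝ ((⊤ : ℕ∞) : WithTop ℕ∞) φ ∧ (∀ ω, f ω = φ (Λ.restrict ω)) ∧
    (Λ : Set ℤ) ⊆ Set.Icc (-N) N := by
  obtain ⟨Λ, φ, hφ, h⟩ := hf.smooth
  refine ⟨Λ, φ, ∑ i ∈ Λ, |i|, hφ, h, fun k hk => ?_⟩
  rw [Set.mem_Icc, ← abs_le]
  exact Finset.single_le_sum (f := fun i : ℤ => |i|) (fun i _ => abs_nonneg i) hk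

theorem avg_mono (hF : AllLp V β F) (hG : AllLp V β G) (h : ∀ ω, F ω ≤ G ω) :
    avg V β F ≤ avg V β G :=
  integral_mono hF.integrable hG.integrable h

theorem avg_one : avg V β 1 = 1 := by
  simp [avg]

theorem sqrt_avg_sq_le {ε : ℝ} (hε : 0 ≤ ε) (hF : AllLp V β F) (hG : AllLp V β G)
    (h : ∀ ω, |F ω| ≤ ε * G ω) : √(avg V β (F * F)) ≤ ε * √(avg V β (G * G)) := by
  have h1 : avg V β (F * F) ≤ avg V β ((ε • G) * (ε • G)) := by
    refine avg_mono (hF.mul hF) ((hG.smul ε).mul (hG.smul ε)) fun ω => ?_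
    exact abs_le_iff_mul_self_le.1 ((h ω).trans (le_abs_self _))
  refine (Real.sqrt_le_sqrt h1).trans (le_of_eq ?_)
  rw [smul_mul_smul_comm, avg_smul, Real.sqrt_mul (mul_self_nonneg ε), Real.sqrt_mul_self hε]

/-- Elements of `mildZero` are approximated by compactly supported ones, with the same parity. -/
theorem exists_approx (hf : f ∈ mildZero V β) : ∃ (N : ℤ) (H : Config → ℝ)
    (K : ℤ → ℤ → Config → ℝ) (ε₀ : ℝ), AllLp V β H ∧ (∀ i j, AllLp V β (K i j)) ∧ 0 < ε₀ ∧
    ∀ ε, 0 < ε → ε ≤ ε₀ → ∃ g ∈ C V β, DependsOn (f - g) (Set.Icc (-N) N) ∧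
      (∀ ω, |(f - g) ω| ≤ ε * H ω) ∧ (∀ i j ω, |Y V i j (f - g) ω| ≤ ε * K i j ω) ∧
      (HasParity 1 f → HasParity 1 g) ∧ (HasParity (-1) f → HasParity (-1) g) := by
  obtain ⟨Λ, φ, N, hφ, hfφ, hΛ⟩ := hf.1.exists_finset
  obtain ⟨M, hM⟩ := hf.1.bdd
  obtain ⟨M', hM'0, hM'⟩ := exists_bound_deriv_lineBump
  have hM0 : 0 ≤ M := (abs_nonneg _).trans (hM fun _ => 0)
  have hft := hf.1.tame (V := V) (β := β)
  have hρ := tame_radiusSq (V := V) (β := β) Λ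
  set R := avg V β (radiusSq Λ)
  have hR : 0 ≤ R := integral_nonneg (radiusSq_nonneg Λ)
  refine ⟨N, M • radiusSq Λ + fun _ => 2 * M * R, fun i j => (fun ω => |Y V i j f ω|) * radiusSq Λ
    + (M + 2 * M * R * 1) • fun ω => M' * |Y V i j (radiusSq Λ) ω|, min 1 (1 / (2 * (R + 1))),
    (hρ.allLp.smul M).add (allLp_const _), fun i j => ?_, by positivity, fun ε hε hε0 => ?_⟩
  · refine (AllLp.mul ?_ hρ.allLp).add (AllLp.smul _ (AllLp.smul M' ?_))
    · exact fun q hq => (hft.Y i j q hq).abs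
    · exact fun q hq => (hρ.Y i j q hq).abs
  have hε1 : ε ≤ 1 := hε0.trans (min_le_left _ _)
  have hεR : ε * R ≤ 1 / 2 := by
    have h1 : ε ≤ 1 / (2 * (R + 1)) := hε0.trans (min_le_right _ _)
    rw [le_div_iff₀ (by positivity)] at h1
    nlinarith
  set χ := cutoff Λ ε
  have hχ : Mild χ := mild_cutoff Λ hε
  have hχt := hχ.tame (V := V) (β := β)
  have hc1 : ∀ ω, |1 - χ ω| ≤ ε * radiusSq Λ ω := one_sub_cutoff_le Λ hε
  have havg : 1 / 2 ≤ avg V β χ := by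
    have h1 : avg V β (1 - χ) ≤ avg V β (ε • radiusSq Λ) :=
      avg_mono ((allLp_const 1).sub hχt.allLp) (hρ.allLp.smul ε) fun ω =>
        (le_abs_self _).trans (hc1 ω)
    have h2 : avg V β (1 - χ) = 1 - avg V β χ := by
      rw [← avg_one (V := V) (β := β)]
      exact (allLp_const 1).avg_sub hχt.allLp
    rw [h2, avg_smul] at h1
    linarith
  set c := avg V β (f * χ) / avg V β χ
  have hc : |c| ≤ ε * (2 * M * R) := by
    have h1 : avg V β (f * χ) = -avg V β (f * (1 - χ)) := by
      have h1 : f * χ = f - f * (1 - χ) := by ring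
      have h2 : AllLp V β (f * (1 - χ)) := hft.allLp.mul ((allLp_const 1).sub hχt.allLp)
      conv_lhs => rw [h1, hft.allLp.avg_sub h2, hf.2, zero_sub]
    have h2 : |avg V β (f * (1 - χ))| ≤ avg V β ((ε * M) • radiusSq Λ) := by
      have h3 : ∀ ω, |(f * (1 - χ)) ω| ≤ ((ε * M) • radiusSq Λ) ω := fun ω => by
        rw [Pi.mul_apply, abs_mul]
        refine (mul_le_mul (hM ω) (hc1 ω) (abs_nonneg _) hM0).trans (le_of_eq ?_)
        simp
        ring
      refine (abs_integral_le_integral_abs).trans (integral_mono ?_ ?_ h3)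
      · exact (hft.allLp.mul ((allLp_const 1).sub hχt.allLp)).integrable.abs
      · exact (hρ.allLp.smul _).integrable
    rw [abs_div, h1, abs_neg, abs_of_pos (by linarith : 0 < avg V β χ), div_le_iff₀ (by linarith)]
    rw [avg_smul] at h2
    have h3 : 0 ≤ ε * (2 * M * R) := by positivity
    nlinarith
  have hc' : |c| ≤ 2 * M * R * 1 := hc.trans (by
    rw [mul_one]
    exact mul_le_of_le_one_left (by positivity) hε1)
  have hg : f - (f * χ - c • χ) = f * (1 - χ) + c • χ := by ring
  refine ⟨f * χ - c • χ, ⟨⟨Λ, fun x => (φ x - c) * cutoffFn Λ ε x,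
    (hφ.sub contDiff_const).mul (contDiff_cutoffFn Λ ε),
    (hasCompactSupport_cutoffFn Λ hε).mul_left, fun ω => ?_⟩, ?_⟩, ?_, ?_, ?_, ?_, ?_⟩
  · rw [Pi.sub_apply, Pi.mul_apply, Pi.smul_apply, smul_eq_mul, hfφ]
    change _ = (φ (Λ.restrict ω) - c) * cutoffFn Λ ε (Λ.restrict ω)
    rw [← cutoff_eq]
    ring
  · rw [(hft.allLp.mul hχt.allLp).avg_sub (hχt.allLp.smul c), avg_smul,
      div_mul_cancel₀ _ (by linarith), sub_self]
  · intro ω ω' hω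
    have h1 : Λ.restrict ω = Λ.restrict ω' := by
      funext k
      exact hω k (hΛ k.2)
    have h2 : χ ω = χ ω' := by
      change cutoff Λ ε ω = cutoff Λ ε ω'
      rw [cutoff_eq, cutoff_eq, h1]
    simp only [Pi.sub_apply, Pi.mul_apply, Pi.smul_apply, hfφ, h1, h2]
  · intro ω
    rw [hg, Pi.add_apply, Pi.mul_apply, Pi.smul_apply, smul_eq_mul]
    refine (abs_add_le _ _).trans ?_
    rw [abs_mul, abs_mul]
    have h1 : |f ω| * |1 - χ ω| ≤ M * (ε * radiusSq Λ ω) :=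
      mul_le_mul (hM ω) (hc1 ω) (abs_nonneg _) hM0
    have h2 : |c| * |χ ω| ≤ ε * (2 * M * R) * 1 :=
      mul_le_mul hc (abs_cutoff_le Λ ε ω) (abs_nonneg _) (by positivity)
    refine (add_le_add h1 h2).trans (le_of_eq ?_)
    simp
    ring
  · intro i j ω
    have h1 : f - (f * χ - c • χ) = f + (-1 : ℝ) • (f * χ) + c • χ := by
      rw [neg_one_smul]
      ring
    rw [h1, Y_add (hf.1.smooth.add ((hf.1.smooth.mul hχ.smooth).smul _)) (hχ.smooth.smul c),
      Y_add hf.1.smooth ((hf.1.smooth.mul hχ.smooth).smul _), Y_smul, Y_smul,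
      Y_mul hf.1.smooth hχ.smooth]
    have h2 : (Y V i j f + (-1 : ℝ) • (Y V i j f * χ + f * Y V i j χ) + c • Y V i j χ) ω
        = Y V i j f ω * (1 - χ ω) + (c - f ω) * Y V i j χ ω := by
      simp
      ring
    rw [h2]
    refine (abs_add_le _ _).trans ?_
    rw [abs_mul, abs_mul]
    have h3 : |Y V i j f ω| * |1 - χ ω| ≤ |Y V i j f ω| * (ε * radiusSq Λ ω) :=
      mul_le_mul_of_nonneg_left (hc1 ω) (abs_nonneg _)
    have h4 : |c - f ω| ≤ M + 2 * M * R * 1 := by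
      refine (abs_sub _ _).trans ?_
      linarith [hM ω]
    have h5 : |c - f ω| * |Y V i j χ ω|
        ≤ (M + 2 * M * R * 1) * (ε * (M' * |Y V i j (radiusSq Λ) ω|)) :=
      mul_le_mul h4 (Y_cutoff_le hM' Λ hε i j ω) (abs_nonneg _) (by positivity)
    refine (add_le_add h3 h5).trans (le_of_eq ?_)
    simp
    ring
  · intro hp ω
    have := hasParity_cutoff Λ ε ω
    change χ _ = 1 * χ ω at this
    simp only [Pi.sub_apply, Pi.mul_apply, Pi.smul_apply, smul_eq_mul, hp ω, this]
    ring
  · intro hp ω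
    have hpar := hasParity_cutoff Λ ε
    have hc0 : c = 0 := by
      have h1 : avg V β (f * χ) = 0 := avg_eq_zero_of_odd (by
        have := hp.mul hpar
        norm_num at this
        exact this)
      simp only [c, h1, zero_div]
    have := hpar ω
    change χ _ = 1 * χ ω at this
    simp only [Pi.sub_apply, Pi.mul_apply, Pi.smul_apply, smul_eq_mul, hp ω, this, hc0]
    ring

/-- Approximation by elements of `𝒞` in the Dirichlet norm and as vectors of the form. -/
theorem exists_approx_forms {γ : ℝ} (hγ : 0 < γ) (f : mildZero V β) (ε : ℝ) (hε : 0 < ε) :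
    ∃ g ∈ {g : mildZero V β | (g : Config → ℝ) ∈ C V β},
      √(dirichlet V β γ (f - g, 0) (f - g, 0)) ≤ ε ∧
      (∀ u, |antiBilin V β u (f - g, 0)| ≤ ε * √(dirichlet V β γ u u)) ∧
      (f ∈ parityPart V β 1 → g ∈ parityPart V β 1) ∧
      (f ∈ parityPart V β (-1) → g ∈ parityPart V β (-1)) := by
  obtain ⟨N, H, K, ε₀, hH, hK, hε₀, happ⟩ := exists_approx f.2
  set H' := ∑ j ∈ window N, shift j H with hH'
  set K' : ℤ → Config → ℝ := fun d => ∑ j ∈ window N, shift j (K (0 - j) (d - j))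
  have hHL : AllLp V β H' := AllLp.sum fun j _ => hH.shift j
  have hKL : ∀ d, AllLp V β (K' d) := fun d => AllLp.sum fun j _ => (hK _ _).shift j
  set c₁ := √(γ / 2) * (√(avg V β (K' 0 * K' 0)) + √(avg V β (K' 1 * K' 1)))
  set c₂ := √(2 / γ) * (2 * √(avg V β (H' * H')))
  have hc₁ : 0 ≤ c₁ := by positivity
  have hc₂ : 0 ≤ c₂ := by positivity
  set η := min ε₀ (ε / (c₁ + c₂ + 1))
  have hη : 0 < η := by positivity
  have hη' : η * (c₁ + c₂ + 1) ≤ ε := by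
    rw [← le_div_iff₀ (by positivity)]
    exact min_le_right _ _
  obtain ⟨g, hgC, hN, h0, h1, he, ho⟩ := happ η hη (min_le_left _ _)
  set w : mildZero V β := f - ⟨g, mem_mildZero_of_mem_C hgC⟩ with hw
  have hwc : (w : Config → ℝ) = f - g := rfl
  refine ⟨⟨g, mem_mildZero_of_mem_C hgC⟩, hgC, ?_, fun u => ?_, he, ho⟩
  · have key : ∀ d, d = 0 ∨ d = 1 → √(avg V β (gradOf d (w, 0) * gradOf d (w, 0)))
        ≤ η * √(avg V β (K' d * K' d)) := fun d hd => by
      refine sqrt_avg_sq_le hη.le (allLp_gradOf hd _) (hKL d) fun ω => ?_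
      rw [gradOf, grad, zero_mul, zero_smul, add_zero, fieldGamma_eq_sum (hwc ▸ hN) hd,
        Finset.sum_apply]
      change _ ≤ η * (∑ j ∈ window N, shift j (K (0 - j) (d - j))) ω
      rw [Finset.sum_apply, Finset.mul_sum]
      refine (Finset.abs_sum_le_sum_abs _ _).trans (Finset.sum_le_sum fun j _ => ?_)
      rw [Y_shift]
      exact h1 _ _ _
    have h2 : dirichlet V β γ (w, 0) (w, 0)
        ≤ (√(γ / 2) * (√(avg V β (gradOf 0 (w, 0) * gradOf 0 (w, 0)))
          + √(avg V β (gradOf 1 (w, 0) * gradOf 1 (w, 0))))) ^ 2 := by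
      rw [dirichlet_apply, mul_pow, Real.sq_sqrt (by positivity), add_sq,
        Real.sq_sqrt (avg_mul_self_nonneg _), Real.sq_sqrt (avg_mul_self_nonneg _)]
      refine mul_le_mul_of_nonneg_left ?_ (by positivity)
      have : 0 ≤ 2 * √(avg V β (gradOf 0 (w, 0) * gradOf 0 (w, 0)))
        * √(avg V β (gradOf 1 (w, 0) * gradOf 1 (w, 0))) := by positivity
      linarith
    refine (Real.sqrt_le_sqrt h2).trans ?_
    rw [Real.sqrt_sq (by positivity)]
    have k0 := key 0 (Or.inl rfl)
    have k1 := key 1 (Or.inr rfl)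
    calc _ ≤ √(γ / 2) * (η * √(avg V β (K' 0 * K' 0)) + η * √(avg V β (K' 1 * K' 1))) := by gcongr
      _ = η * c₁ := by ring
      _ ≤ η * (c₁ + c₂ + 1) := by gcongr; linarith
      _ ≤ ε := hη'
  · have h2 : √(avg V β (localGamma N (w : Config → ℝ) * localGamma N (w : Config → ℝ)))
        ≤ η * √(avg V β (H' * H')) := by
      refine sqrt_avg_sq_le hη.le ((mild_coe w).localGamma N).tame.allLp hHL fun ω => ?_
      rw [localGamma, Finset.sum_apply, hH', Finset.sum_apply, Finset.mul_sum]
      exact (Finset.abs_sum_le_sum_abs _ _).trans (Finset.sum_le_sum fun j _ => h0 _)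
    refine (abs_antiForm_le hγ u (w, 0) (N := N) (hwc ▸ hN)).trans ?_
    rw [abs_zero, zero_mul, add_zero]
    refine mul_le_mul_of_nonneg_right ?_ (Real.sqrt_nonneg _)
    calc _ ≤ √(2 / γ) * (2 * (η * √(avg V β (H' * H')))) := by gcongr
      _ = η * c₂ := by ring
      _ ≤ η * (c₁ + c₂ + 1) := by gcongr; linarith
      _ ≤ ε := hη'

end Cutoff


section Main

variable {V : ℝ → ℝ} {β : ℝ} [hV : Fact (IsPotential V)] [hβ : Fact (0 < β)]
  {F G f g h : Config → ℝ} {N d : ℤ} {l : (Config → ℝ) → ℝ → ℝ}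

theorem chi_ne_zero : chi V β ≠ 0 := by
  intro h0
  have hE := tame_energy (V := V) (β := β) 0
  set m := avg V β (energy V 0)
  have hEm : AllLp V β (energy V 0 - fun _ => m) := hE.allLp.sub (allLp_const m)
  have h1 : avg V β ((energy V 0 - fun _ => m) * (energy V 0 - fun _ => m)) = 0 := by
    rw [← h0, chi, variance_eq_integral hE.smooth.measurable.aemeasurable]
    simp only [avg, pow_two]
    rfl
  have hF := tame_momDist (V := V) (β := β) 0 1
  have h2 : avg V β ((energy V 0 - fun _ => m) * Y V 0 1 (momDist 0 1)) = 1 / β ^ 2 := by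
    have h3 := avg_Y_mul_energy hF 0 1 0
    rw [shift_zero, sub_zero, avg_flux_mul_momDist, mul_comm] at h3
    have h4 : (energy V 0 - fun _ => m) * Y V 0 1 (momDist 0 1)
        = energy V 0 * Y V 0 1 (momDist 0 1) - m • Y V 0 1 (momDist 0 1) := by
      funext ω
      simp
      ring
    rw [h4, (hE.allLp.mul (hF.Y 0 1)).avg_sub ((hF.Y 0 1).smul m), avg_smul, hF.avg_Y, h3]
    simp
  have h3 := hEm.abs_avg_mul_le (hF.Y 0 1)
  rw [h1, h2, Real.sqrt_zero, zero_mul] at h3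
  have hb := hβ.out
  have h4 : 0 < 1 / β ^ 2 := by positivity
  rw [abs_of_pos h4] at h3
  linarith

theorem neg_mem_C (hf : f ∈ C V β) : -f ∈ C V β := by
  obtain ⟨⟨Λ, φ, hφ, hc, h⟩, h0⟩ := hf
  refine ⟨⟨Λ, -φ, hφ.neg, hc.neg, fun ω => by rw [Pi.neg_apply, Pi.neg_apply, h]⟩, ?_⟩
  rw [avg_neg, h0, neg_zero]

/-- The class `𝒞` inside `mildZero`. -/
def coreSet (V : ℝ → ℝ) (β : ℝ) [Fact (IsPotential V)] [Fact (0 < β)] : Set (mildZero V β) :=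
  {f | (f : Config → ℝ) ∈ C V β}

theorem iSup_subtype_of_subset {s : Set (Config → ℝ)} (hs : s ⊆ C V β)
    (φ : (Config → ℝ) → EReal) :
    ⨆ f ∈ s, φ f = ⨆ f ∈ {f : mildZero V β | (f : Config → ℝ) ∈ s}, φ f := by
  refine le_antisymm (iSup₂_le fun f hf => ?_) (iSup₂_le fun f hf => ?_)
  · exact le_iSup₂_of_le (⟨f, mem_mildZero_of_mem_C (hs hf)⟩ : mildZero V β) hf le_rfl
  · exact le_iSup₂_of_le (f : Config → ℝ) hf le_rfl

theorem iInf_subtype_of_subset {s : Set (Config → ℝ)} (hs : s ⊆ C V β)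
    (φ : (Config → ℝ) → EReal) :
    ⨅ f ∈ s, φ f = ⨅ f ∈ {f : mildZero V β | (f : Config → ℝ) ∈ s}, φ f := by
  refine le_antisymm (le_iInf₂ fun f hf => ?_) (le_iInf₂ fun f hf => ?_)
  · exact iInf₂_le_of_le (f : Config → ℝ) hf le_rfl
  · exact iInf₂_le_of_le (⟨f, mem_mildZero_of_mem_C (hs hf)⟩ : mildZero V β) hf le_rfl

theorem gradOf_prod_zero (d : ℤ) (f : mildZero V β) : gradOf d (f, 0) = fieldGamma V d f := by
  rw [gradOf, grad, zero_mul, zero_smul, add_zero]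

theorem fieldGamma_zero (hd : d = 0 ∨ d = 1) : fieldGamma V d 0 = 0 := by
  have := fieldGamma_smul (V := V) 0 Mild.zero hd
  rwa [zero_smul, zero_smul] at this

theorem gradOf_zero_prod (hd : d = 0 ∨ d = 1) (a : ℝ) :
    gradOf d ((0 : mildZero V β), a) = (a * d) • flux V d := by
  rw [gradOf, grad, ZeroMemClass.coe_zero, fieldGamma_zero hd, zero_add]

theorem normSq_eq (γ : ℝ) (h : Config → ℝ) : normSq V β γ h
    = dualNormSq (dirichlet V β γ) (coreSet V β) fun u => ell V β h u.1 u.2 := by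
  rw [normSq, iSup_subtype_of_subset subset_rfl, dualNormSq]
  refine iSup_congr fun g => iSup_congr fun _ => iSup_congr fun a => ?_
  congr 1
  have h1 : avg V β (fun ω => (a * ((ω 0).1 * deriv V (ω 1).2) + YGamma V g ω) ^ 2)
      = avg V β (gradOf 1 (g, a) * gradOf 1 (g, a)) := by
    congr 1
    funext ω
    have : gradOf 1 (g, a) ω = a * ((ω 0).1 * deriv V (ω 1).2) + YGamma V g ω := by
      simp [gradOf, grad, fieldGamma, YGamma, flux, add_comm]
    rw [Pi.mul_apply, this, pow_two]
  have h2 : avg V β (fun ω => XGamma V g ω ^ 2)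
      = avg V β (gradOf 0 (g, a) * gradOf 0 (g, a)) := by
    congr 1
    funext ω
    have : gradOf 0 (g, a) ω = XGamma V g ω := by
      simp [gradOf, grad, fieldGamma, XGamma, X]
    rw [Pi.mul_apply, this, pow_two]
  rw [h1, h2, dirichlet_apply, ell]
  ring

theorem IsCurrent.self (hh : IsCurrent V β h l) : IsCurrent V β h (ell V β h) :=
  hh.congr fun g hg h0 a => (hh.eq g hg h0 a).symm

theorem A_zero : A V 0 = 0 := by
  funext ω
  simp [A, X, Y_zero]

theorem exists_isCurrent_A (hf : f ∈ C V β) : IsCurrent V β (A V f) (ell V β (A V f)) := by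
  have hm := mild_of_mem_C hf
  obtain ⟨N, hN⟩ := hm.exists_dependsOn
  exact (isCurrent_A hm hN).self

theorem ell_A (u : mildZero V β × ℝ) (f : mildZero V β) :
    ell V β (A V f) u.1 u.2 = antiBilin V β u (f, 0) := by
  rw [antiBilin_apply, antiForm, zero_smul, add_zero]

theorem ell_WA (u : mildZero V β × ℝ) : ell V β (WA V) u.1 u.2 = antiBilin V β u (0, 1) := by
  rw [antiBilin_apply, antiForm, one_smul, ZeroMemClass.coe_zero, A_zero, zero_add]

theorem ell_S (γ : ℝ) (u : mildZero V β × ℝ) {f : mildZero V β} (hf : f ∈ coreSet V β) :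
    ell V β (S V γ f) u.1 u.2 = -dirichlet V β γ u (f, 0) := by
  rw [(isCurrent_S γ hf).eq _ (mild_coe u.1) u.1.2.2, dirichlet_apply, gradOf_prod_zero,
    gradOf_prod_zero]
  rfl

theorem ell_WS (γ : ℝ) (u : mildZero V β × ℝ) :
    ell V β (WS V γ) u.1 u.2 = -dirichlet V β γ u (0, 1) := by
  rw [(isCurrent_WS γ).eq _ (mild_coe u.1) u.1.2.2, dirichlet_apply,
    gradOf_zero_prod (Or.inl rfl), gradOf_zero_prod (Or.inr rfl), Int.cast_zero, Int.cast_one,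
    mul_zero, zero_smul, mul_zero, avg_zero, zero_add, mul_one, one_smul]
  rfl

theorem ell_gradP (u : mildZero V β × ℝ) : ell V β gradP u.1 u.2 = 1 / β ^ 2 * u.2 :=
  isCurrent_gradP.eq _ (mild_coe u.1) u.1.2.2 u.2

theorem neg_prod_one (f : mildZero V β) :
    ((-f, 1) : mildZero V β × ℝ) = (0, 1) - (f, 0) := by
  simp

theorem isCurrent_W_add (γ c : ℝ) :
    IsCurrent V β (W V γ + c • gradP) fun g a =>
      ell V β (WS V γ) g a + ell V β (WA V) g a + c * ell V β gradP g a :=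
  ((isCurrent_WS γ).self.add isCurrent_WA.self).add (isCurrent_gradP.self.smul c)

theorem isCurrent_L (γ : ℝ) (hf : f ∈ C V β) :
    IsCurrent V β (L V γ f) fun g a => ell V β (S V γ f) g a + ell V β (A V f) g a :=
  (isCurrent_S γ hf).self.add (exists_isCurrent_A hf)

theorem isCurrent_Lstar (γ : ℝ) (hf : f ∈ C V β) :
    IsCurrent V β (Lstar V γ f) fun g a => ell V β (S V γ f) g a - ell V β (A V f) g a :=
  (isCurrent_S γ hf).self.sub (exists_isCurrent_A hf)

theorem normSq_W_sub (γ c : ℝ) {f : mildZero V β} (hf : f ∈ coreSet V β) :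
    normSq V β γ (W V γ + c • gradP - L V γ f)
      = dualNormSq (dirichlet V β γ) (coreSet V β) fun u =>
        -dirichlet V β γ u (-f, 1) + antiBilin V β u (-f, 1) + c * (1 / β ^ 2 * u.2) := by
  rw [normSq_eq]
  congr 1
  funext u
  rw [((isCurrent_W_add γ c).sub (isCurrent_L γ hf)).eq _ (mild_coe u.1) u.1.2.2, ell_WS, ell_WA,
    ell_gradP, ell_S γ u hf, ell_A, neg_prod_one, map_sub, map_sub]
  ring

theorem normSq_Wstar_sub (γ : ℝ) {f : mildZero V β} (hf : f ∈ coreSet V β) :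
    normSq V β γ (Wstar V γ - Lstar V γ f)
      = dualNormSq (dirichlet V β γ) (coreSet V β) fun u =>
        -dirichlet V β γ u (-f, 1) - antiBilin V β u (-f, 1) := by
  rw [normSq_eq]
  congr 1
  funext u
  have h1 := ((isCurrent_WS (V := V) (β := β) γ).self.sub isCurrent_WA.self).sub
    (isCurrent_Lstar γ hf)
  rw [Wstar, h1.eq _ (mild_coe u.1) u.1.2.2, ell_WS, ell_WA,
    ell_S γ u hf, ell_A, neg_prod_one, map_sub, map_sub]
  ring

theorem normSq_gradP_sub (γ : ℝ) {f : mildZero V β} (hf : f ∈ coreSet V β) :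
    normSq V β γ (gradP - Lstar V γ f)
      = dualNormSq (dirichlet V β γ) (coreSet V β) fun u =>
        1 / β ^ 2 * u.2 + (dirichlet V β γ u (f, 0) + antiBilin V β u (f, 0)) := by
  rw [normSq_eq]
  congr 1
  funext u
  rw [(isCurrent_gradP.self.sub (isCurrent_Lstar γ hf)).eq _ (mild_coe u.1) u.1.2.2, ell_gradP,
    ell_S γ u hf, ell_A]
  ring

theorem pairStar_comm (F G : Config → ℝ) : pairStar V β F G = pairStar V β G F := by
  rw [pairStar_eq_finsum, pairStar_eq_finsum, ← finsum_comp_equiv (Equiv.neg ℤ)]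
  refine finsum_congr fun i => ?_
  rw [Equiv.neg_apply, avg_mul_shift, neg_neg, mul_comm]

theorem infSupFunctional_eq (γ : ℝ) {f g : mildZero V β} (hf : f ∈ coreSet V β) :
    infSupFunctional V β γ f g = dirichlet V β γ (-f, 1) (-f, 1)
      + 2 * antiBilin V β (g, 0) (-f, 1) - dirichlet V β γ (g, 0) (g, 0) := by
  have h0 : ∀ d, d = 0 ∨ d = 1 → ∀ ω, gradOf d (-f, 1) ω = d * flux V d ω - fieldGamma V d f ω := by
    intro d hd ω
    have h1 : ((-f, 1) : mildZero V β × ℝ) = (0, 1) + (-1 : ℝ) • (f, 0) := by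
      refine Prod.ext (Subtype.ext ?_) (by simp)
      simp
    rw [h1, gradOf_add hd, gradOf_smul hd, gradOf_zero_prod hd, gradOf_prod_zero]
    simp
    ring
  have h1 : ell V β (WA V - A V f) (g : Config → ℝ) 0 = antiBilin V β (g, 0) (-f, 1) := by
    rw [(isCurrent_WA.self.sub (exists_isCurrent_A hf)).eq _ (mild_coe g) g.2.2,
      ell_WA (g, 0), ell_A (g, 0), neg_prod_one, map_sub]
  have h2 : pairStar V β (WA V - A V f) g = antiBilin V β (g, 0) (-f, 1) := by
    rw [pairStar_comm, ← h1, ell, zero_mul, add_zero]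
  have h3 : gradOf 0 (-f, 1) * gradOf 0 (-f, 1) = fun ω => XGamma V f ω ^ 2 := by
    funext ω
    rw [Pi.mul_apply, h0 0 (Or.inl rfl)]
    simp [fieldGamma, XGamma, X, pow_two]
  have h4 : gradOf 1 (-f, 1) * gradOf 1 (-f, 1)
      = fun ω => ((ω 0).1 * deriv V (ω 1).2 - YGamma V f ω) ^ 2 := by
    funext ω
    rw [Pi.mul_apply, h0 1 (Or.inr rfl)]
    simp [fieldGamma, YGamma, flux, pow_two]
  have h5 : fieldGamma V 0 (g : Config → ℝ) * fieldGamma V 0 g = fun ω => XGamma V g ω ^ 2 := by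
    funext ω
    simp [fieldGamma, XGamma, X, pow_two]
  have h6 : fieldGamma V 1 (g : Config → ℝ) * fieldGamma V 1 g = fun ω => YGamma V g ω ^ 2 := by
    funext ω
    simp [fieldGamma, YGamma, pow_two]
  rw [infSupFunctional, h2, dirichlet_apply, dirichlet_apply, h3, h4, gradOf_prod_zero,
    gradOf_prod_zero, h5, h6]
  ring

theorem memClosureLC_iff (γ c : ℝ) : MemClosureLC V β γ (W V γ + c • gradP) ↔
    ∀ ε > 0, ∃ f ∈ coreSet V β, dualNormSq (dirichlet V β γ) (coreSet V β) (fun u =>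
        -dirichlet V β γ u (-f, 1) + antiBilin V β u (-f, 1) + c * (1 / β ^ 2 * u.2))
      < ((ε ^ 2 : ℝ) : EReal) := by
  constructor
  · rintro ⟨-, h⟩ ε hε
    obtain ⟨f, hf, -, hlt⟩ := h ε hε
    have hf' : (⟨f, mem_mildZero_of_mem_C hf⟩ : mildZero V β) ∈ coreSet V β := hf
    exact ⟨_, hf', by rwa [← normSq_W_sub γ c hf']⟩
  · intro h
    refine ⟨(isCurrent_W_add γ c).mem_C0, fun ε hε => ?_⟩
    obtain ⟨f, hf, hlt⟩ := h ε hε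
    exact ⟨f, hf, (isCurrent_L γ hf).mem_C0, by rwa [normSq_W_sub γ c hf]⟩

theorem exists_kappa {γ : ℝ} (hγ : 0 < γ) : ∃ κ > 0,
    (∀ c : ℝ, MemClosureLC V β γ (W V γ + c • gradP) ↔ c = κ) ∧
    ⨅ f ∈ C V β, normSq V β γ (Wstar V γ - Lstar V γ f) = ((κ * (1 / β ^ 2) : ℝ) : EReal) ∧
    ⨅ f ∈ C V β, normSq V β γ (gradP - Lstar V γ f) = ((1 / β ^ 2 / κ : ℝ) : EReal) ∧
    ⨅ f ∈ Ceven V β, ⨆ g ∈ Codd V β, ((infSupFunctional V β γ f g : ℝ) : EReal)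
      = ((κ * (1 / β ^ 2) : ℝ) : EReal) := by
  have hb := hβ.out
  obtain ⟨M, hM⟩ := exists_sector (V := V) (β := β) hγ
  obtain ⟨κ, hκ, h1, h2, h3, h4⟩ := exists_diffusivity (dirichlet V β γ) (antiBilin V β)
    (fun u v => by
      rw [dirichlet_apply, dirichlet_apply, mul_comm (gradOf 0 u), mul_comm (gradOf 1 u)])
    (fun u => by
      rw [dirichlet_apply]
      exact mul_nonneg (by positivity) (add_nonneg (avg_mul_self_nonneg _) (avg_mul_self_nonneg _)))
    antiForm_antisymm
    (fun v => by
      obtain ⟨N, hN⟩ := (mild_coe v.1).exists_dependsOn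
      exact ⟨_, fun u => abs_antiForm_le hγ u v hN⟩)
    hM (ρ := 1 / β ^ 2) (by positivity) (exists_bound_snd hγ) (parityPart V β 1)
    (parityPart V β (-1)) exists_parity_decomposition
    (fun e he a o ho => dirichlet_even_odd γ he ho a)
    (fun e he a e' he' b => antiForm_even_even he he' a b)
    (fun o ho o' ho' => antiForm_odd_odd ho ho') (coreSet V β)
    (fun f hf => neg_mem_C hf) (exists_approx_forms hγ)
  refine ⟨κ, hκ, fun c => (memClosureLC_iff γ c).trans (h1 c), ?_, ?_, ?_⟩
  · rw [← h2, iInf_subtype_of_subset subset_rfl]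
    exact iInf_congr fun f => iInf_congr fun hf => normSq_Wstar_sub γ hf
  · rw [← h3, iInf_subtype_of_subset subset_rfl]
    exact iInf_congr fun f => iInf_congr fun hf => normSq_gradP_sub γ hf
  · have he : {f : mildZero V β | (f : Config → ℝ) ∈ Ceven V β}
        = {f ∈ coreSet V β | f ∈ parityPart V β 1} := by
      ext f
      exact and_congr Iff.rfl (forall_congr' fun ω => by rw [one_mul])
    have ho : {f : mildZero V β | (f : Config → ℝ) ∈ Codd V β}
        = {f ∈ coreSet V β | f ∈ parityPart V β (-1)} := by
      ext f
      exact and_congr Iff.rfl (forall_congr' fun ω => by rw [neg_one_mul])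
    rw [← h4, iInf_subtype_of_subset fun f hf => hf.1, he]
    refine iInf_congr fun f => iInf_congr fun hf => ?_
    rw [iSup_subtype_of_subset fun f hf => hf.1, ho]
    exact iSup_congr fun g => iSup_congr fun _ => by rw [infSupFunctional_eq γ hf.1]

end Main

end OscChain

theorem mainTheorem2 (V : ℝ → ℝ) (hV : OscChain.IsPotential V) (β γ : ℝ) (hβ : 0 < β)
    (hγ : 0 < γ) :
    ∃ D κ : ℝ, κ = D * OscChain.chi V β * β ^ 2 ∧ 0 < κ ∧
      (∀ c : ℝ, OscChain.MemClosureLC V β γ (OscChain.W V γ + c • OscChain.gradP) ↔ c = κ) ∧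
      (κ : EReal) = ((β ^ 2 : ℝ) : EReal) *
        ⨅ f ∈ OscChain.C V β,
          OscChain.normSq V β γ (OscChain.Wstar V γ - OscChain.Lstar V γ f) ∧
      (κ : EReal) = 1 / (((β ^ 2 : ℝ) : EReal) *
        ⨅ f ∈ OscChain.C V β,
          OscChain.normSq V β γ (OscChain.gradP - OscChain.Lstar V γ f)) ∧
      (κ : EReal) = ((β ^ 2 : ℝ) : EReal) *
        ⨅ f ∈ OscChain.Ceven V β, ⨆ g ∈ OscChain.Codd V β,
          ((OscChain.infSupFunctional V β γ f g : ℝ) : EReal) := by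
  have : Fact (OscChain.IsPotential V) := ⟨hV⟩
  have : Fact (0 < β) := ⟨hβ⟩
  obtain ⟨κ, hκ, h1, h2, h3, h4⟩ := OscChain.exists_kappa (V := V) (β := β) hγ
  have hχ := OscChain.chi_ne_zero (V := V) (β := β)
  have e1 : (κ : EReal) = ((β ^ 2 : ℝ) : EReal) * ((κ * (1 / β ^ 2) : ℝ) : EReal) := by
    rw [← EReal.coe_mul]
    congr 1
    field_simp
  refine ⟨κ / (OscChain.chi V β * β ^ 2), κ, by field_simp, hκ, h1, ?_, ?_, ?_⟩
  · rw [h2, ← e1]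
  · rw [h3, ← EReal.coe_mul, ← EReal.coe_one, ← EReal.coe_div]
    congr 1
    field_simp
  · rw [h4, ← e1]
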